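/- Throughout, a square is a square in $\mathbb{R}^2$ with axes-parallel sides and positive side length. Let $\dim_H$, $\dim_P$, $\overline{\dim}_B$, $\underline{\dim}_B$ denote Hausdorff, packing, upper box and lower box dimension; the sets whose box dimensions are considered are assumed to be bounded. If $\overline{\dim}_B E=\underline{\dim}_B E$, the common value is written $\dim_B E$. Let $S,B\subset\mathbb{R}^2$. (a) If for every $x\in S$ the set $B$ contains at least one vertex of some square centred at $x$ (in particular, if it contains all four vertices), then $\dim_H B\ge\max(\dim_H S-1,0)$. In particular, if $S=[0,1]^2$, then $\dim_H B\ge 1$. (b) If for every $x\in S$ the set $B$ contains the four vertices of some square centred at $x$, then $\dim B\ge\frac34\dim S$ for each of $\dim=\dim_P,\overline{\dim}_B,\underline{\dim}_B$ (with $B$, and hence $S$, bounded in the case of the box dimensions). In particular, if $S=[0,1]^2$, then $\dim B\ge\frac32$. Conversely, for each $s\in[0,2]$: (a') there are nonempty compact sets $S,B\subset\mathbb{R}^2$ such that $B$ contains the four vertices of a square centred at every point of $S$, $\dim_H S=s$ and $\dim_H B=\max(s-1,0)$; (b') there are nonempty compact sets $S,B\subset\mathbb{R}^2$ such that $B$ contains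 the four vertices of a square centred at every point of $S$, $\dim_P S=\dim_B S=s$ and $\dim_P B=\dim_B B=\frac34 s$. When $s=2$, one can take $S=[0,1]^2$ both in (a') and in (b'). -/

import Mathlib

open Set Filter Topology
open scoped NNReal ENNReal

/-- The plane `ℝ²` with its Euclidean metric. -/
abbrev Plane : Type := EuclideanSpace ℝ (Fin 2)

/-- The unit square `[0,1]²`. -/
def unitSquare : Set Plane := {p | p 0 ∈ Icc (0 : ℝ) 1 ∧ p 1 ∈ Icc (0 : ℝ) 1}

/-- The set of the four vertices of the axes-parallel square with centre `p` and half side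
length `r`. -/
def squareVertices (p : Plane) (r : ℝ) : Set Plane :=
  {!₂[p 0 - r, p 1 - r], !₂[p 0 + r, p 1 - r], !₂[p 0 - r, p 1 + r], !₂[p 0 + r, p 1 + r]}

/-- `B` contains the four vertices of a (nondegenerate) axes-parallel square centred at every
point of `S`. -/
def ContainsSquareVertices (B S : Set Plane) : Prop :=
  ∀ p ∈ S, ∃ r : ℝ, 0 < r ∧ squareVertices p r ⊆ B

/-- `B` contains at least one vertex of a (nondegenerate) axes-parallel square centred at every
point of `S`. -/
def ContainsSomeSquareVertex (B S : Set Plane) : Prop :=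
  ∀ p ∈ S, ∃ r : ℝ, 0 < r ∧ (squareVertices p r ∩ B).Nonempty

section Dimensions

variable {X : Type*} [MetricSpace X]

open Classical in
/-- `log N_δ(A) / (- log δ)`, where `N_δ(A)` is the least number of closed balls of radius `δ`
that cover `A`. It is `∞` if no finite number of balls suffices, and `0` if `A` is empty. -/
noncomputable def boxQuotient (A : Set X) (δ : ℝ≥0) : ℝ≥0∞ :=
  if Metric.externalCoveringNumber δ A = ⊤ then ⊤
  else ENNReal.ofReal
    (Real.log ((Metric.externalCoveringNumber δ A).toNat : ℝ) / (-Real.log (δ : ℝ)))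

/-- The upper box counting dimension: the upper limit of `boxQuotient A δ` as `δ → 0+`. -/
noncomputable def upperBoxDim (A : Set X) : ℝ≥0∞ := limsup (boxQuotient A) (𝓝[>] 0)

/-- The lower box counting dimension: the lower limit of `boxQuotient A δ` as `δ → 0+`. -/
noncomputable def lowerBoxDim (A : Set X) : ℝ≥0∞ := liminf (boxQuotient A) (𝓝[>] 0)

/-- `IsBallPacking A δ P`: the pairs (centre, radius) in `P` describe pairwise disjoint closed
balls with centres in `A` and positive radii at most `δ`. -/
def IsBallPacking (A : Set X) (δ : ℝ) (P : Finset (X × ℝ)) : Prop :=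
  (∀ b ∈ P, b.1 ∈ A ∧ 0 < b.2 ∧ b.2 ≤ δ) ∧
    (P : Set (X × ℝ)).PairwiseDisjoint fun b => Metric.closedBall b.1 b.2

/-- `P^s_δ(A)`: the supremum of `∑ (2 r_i)^s` over all packings by disjoint balls of radii
`r_i ≤ δ` with centres in `A`; in Euclidean space `2 r_i` is the diameter of the ball. Infinite
packings give the same supremum, since all terms are nonnegative. -/
noncomputable def packingContent (s : ℝ≥0) (δ : ℝ) (A : Set X) : ℝ≥0∞ :=
  ⨆ (P : Finset (X × ℝ)) (_ : IsBallPacking A δ P),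
    ∑ b ∈ P, ENNReal.ofReal ((2 * b.2) ^ (s : ℝ))

/-- `P^s_0(A)`: the limit as `δ → 0+`, hence the infimum over `δ > 0`, of `P^s_δ(A)`. -/
noncomputable def packingPremeasure (s : ℝ≥0) (A : Set X) : ℝ≥0∞ :=
  ⨅ (δ : ℝ) (_ : 0 < δ), packingContent s δ A

/-- The `s`-dimensional packing measure `P^s(A)`: the infimum of `∑ P^s_0(A_i)` over all
countable covers `(A_i)` of `A`. -/
noncomputable def packingMeasure (s : ℝ≥0) (A : Set X) : ℝ≥0∞ :=
  ⨅ (C : ℕ → Set X) (_ : A ⊆ ⋃ i, C i), ∑' i, packingPremeasure s (C i)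

/-- The packing dimension `sup {s ≥ 0 : P^s(A) = ∞}`. -/
noncomputable def packingDim (A : Set X) : ℝ≥0∞ :=
  ⨆ (s : ℝ≥0) (_ : packingMeasure s A = ⊤), (s : ℝ≥0∞)

end Dimensions

/-! Everything happens in the diagonal coordinates `u = x + y`, `w = x - y`. A square with centre
`(u, w)` and half side `r` has vertices `(u ± 2r, w)` and `(u, w ± 2r)`, so each vertex shares one
diagonal coordinate with the centre.

Hausdorff lower bound: one vertex per square already places `S` in the union of the lines of two
fixed directions through `B`. Such a family of lines is a Lipschitz image of (projection of `B`) ×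
ℝ, and a factor ℝ raises the Hausdorff dimension by at most one (`dimH_prod_univ_le`,
`dimH_diagonal_lines_le`).

Box and packing lower bounds: at scale `δ`, replace the sets by grid cells. Every centre cell is, up
to rounding, the midpoint of two cells of `B` on its row and of two on its column. With `n` cells in
`B` and a threshold `K`, rows holding at most `K` cells carry `O(K n)` centres, and likewise for
columns; the other centres lie on one of at most `n / K` heavy rows and one of at most `n / K` heavy
columns. Taking `K = n ^ (1/3)` gives `O(n ^ (4/3))` centres (`card_centres_le`,
`coveredBy_centres`). Packing dimension is reached through countable covers by sets of controlled
upper box dimension.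

Sharpness: points are given by digits in the mixed radix system with radices `k + 3`. Their products
grow faster than any exponential, so a constant factor per digit, or a shift by one scale, costs no
dimension. The half side is chosen digit by digit as a function of the centre, so that each vertex
has few possible digit pairs. For box dimension, split a digit `d < N` as `d₀ + n d₁` with `n ≈ √N`
and use `τ = d₀ - n d₁`: then `d + τ = 2 d₀` and `d - τ = 2 n d₁` each take about `√N` values, so
`N²` centre pairs yield `O(N ^ (3/2))` vertex pairs. For Hausdorff dimension, covers at a sparse
sequence of scales suffice: the digit positions are cut into doubly exponential blocks, in turn
favourable to each of the four vertices, and the block just ended outweighs all earlier digits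
(`dimH_digitSet_le_of_blocks`). Lower bounds for `S` come from a Hölder parametrisation
(`le_dimH_digitRect`). -/

/-- `A` can be covered by at most `N` closed balls of radius `δ`. -/
def CoveredBy {X : Type*} [MetricSpace X] (A : Set X) (δ N : ℝ) : Prop :=
  ∃ F : Finset X, (F.card : ℝ) ≤ N ∧ ∀ a ∈ A, ∃ x ∈ F, dist a x ≤ δ

/-! ### Box dimensions and Hausdorff upper bounds in terms of covers. -/

section BoxCounting

variable {X : Type*} [MetricSpace X]

theorem CoveredBy.mono {A : Set X} {δ δ' N N' : ℝ} (h : CoveredBy A δ N) (hδ : δ ≤ δ')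
    (hN : N ≤ N') : CoveredBy A δ' N' := by
  obtain ⟨F, hF, hc⟩ := h
  refine ⟨F, hF.trans hN, fun a ha => ?_⟩
  obtain ⟨x, hx, hd⟩ := hc a ha
  exact ⟨x, hx, hd.trans hδ⟩

theorem CoveredBy.subset {A B : Set X} {δ N : ℝ} (h : CoveredBy B δ N) (hAB : A ⊆ B) :
    CoveredBy A δ N := by
  obtain ⟨F, hF, hc⟩ := h
  exact ⟨F, hF, fun a ha => hc a (hAB ha)⟩

theorem CoveredBy.union {A B : Set X} {δ N M : ℝ} (hA : CoveredBy A δ N)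
    (hB : CoveredBy B δ M) : CoveredBy (A ∪ B) δ (N + M) := by
  classical
  obtain ⟨F, hF, hFc⟩ := hA
  obtain ⟨G, hG, hGc⟩ := hB
  refine ⟨F ∪ G, ?_, ?_⟩
  · have : ((F ∪ G).card : ℝ) ≤ F.card + G.card := by exact_mod_cast Finset.card_union_le F G
    linarith
  · rintro a (ha | ha)
    · obtain ⟨x, hx, hd⟩ := hFc a ha
      exact ⟨x, Finset.mem_union_left _ hx, hd⟩
    · obtain ⟨x, hx, hd⟩ := hGc a ha
      exact ⟨x, Finset.mem_union_right _ hx, hd⟩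

theorem CoveredBy.image {Y : Type*} [MetricSpace Y] {A : Set X} {δ N : ℝ}
    (h : CoveredBy A δ N) {f : X → Y} {K : ℝ} (hf : ∀ x y, dist (f x) (f y) ≤ K * dist x y)
    (hK : 0 ≤ K) : CoveredBy (f '' A) (K * δ) N := by
  classical
  obtain ⟨F, hF, hc⟩ := h
  refine ⟨F.image f, le_trans (by exact_mod_cast Finset.card_image_le) hF, ?_⟩
  rintro _ ⟨a, ha, rfl⟩
  obtain ⟨x, hx, hd⟩ := hc a ha
  exact ⟨f x, Finset.mem_image_of_mem _ hx,
    (hf a x).trans (mul_le_mul_of_nonneg_left hd hK)⟩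

/-- Covers with arbitrary centres from a finite family of sets of small diameter. -/
theorem CoveredBy.of_fibers {ι : Type*} {A : Set X} {δ : ℝ} (I : Finset ι) (f : X → ι)
    (hI : ∀ a ∈ A, f a ∈ I) (hd : ∀ a ∈ A, ∀ b ∈ A, f a = f b → dist a b ≤ δ) :
    CoveredBy A δ I.card := by
  classical
  rcases A.eq_empty_or_nonempty with rfl | ⟨a₀, _⟩
  · exact ⟨∅, by simp, by simp⟩
  let g : ι → X := fun i => if h : ∃ a ∈ A, f a = i then h.choose else a₀
  refine ⟨I.image g, by exact_mod_cast Finset.card_image_le, fun a ha => ?_⟩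
  have h : ∃ b ∈ A, f b = f a := ⟨a, ha, rfl⟩
  refine ⟨g (f a), Finset.mem_image_of_mem _ (hI a ha), ?_⟩
  have hg : g (f a) = h.choose := dif_pos h
  rw [hg]
  exact hd _ ha _ h.choose_spec.1 h.choose_spec.2.symm

theorem CoveredBy.externalCoveringNumber_le {A : Set X} {δ : ℝ≥0} {N : ℝ}
    (h : CoveredBy A δ N) :
    ∃ n : ℕ, (n : ℝ) ≤ N ∧ Metric.externalCoveringNumber δ A ≤ n := by
  obtain ⟨F, hF, hc⟩ := h
  refine ⟨F.card, hF, ?_⟩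
  have : Metric.IsCover δ A (F : Set X) := by
    intro a ha
    obtain ⟨x, hx, hd⟩ := hc a ha
    refine ⟨x, hx, ?_⟩
    change edist a x ≤ δ
    rw [edist_nndist]
    exact_mod_cast hd
  simpa using this.externalCoveringNumber_le_encard

/-- The infimum of a nonempty family in `ℕ∞` is attained, and `A` covers itself, so an optimal cover
exists; it is finite by hypothesis. -/
theorem coveredBy_of_externalCoveringNumber_ne_top {A : Set X} {δ : ℝ≥0}
    (h : Metric.externalCoveringNumber δ A ≠ ⊤) :
    CoveredBy A δ ((Metric.externalCoveringNumber δ A).toNat : ℝ) := by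
  have : Nonempty { s : Set X // Metric.IsCover δ A s } := ⟨⟨A, Metric.IsCover.rfl⟩⟩
  obtain ⟨C, hC⟩ := ENat.exists_eq_iInf
    (fun C : {s : Set X // Metric.IsCover δ A s} => (C : Set X).encard)
  have hC' : (C : Set X).encard = Metric.externalCoveringNumber δ A := by
    rw [hC, Metric.externalCoveringNumber, iInf_subtype]
  have hfin : (C : Set X).Finite := by
    rw [← Set.encard_lt_top_iff, hC']
    exact lt_top_iff_ne_top.2 h
  refine ⟨hfin.toFinset, ?_, fun a ha => ?_⟩
  · rw [← hC', hfin.encard_eq_coe_toFinset_card]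
    simp
  · obtain ⟨x, hx, hd⟩ := C.2 ha
    refine ⟨x, by simpa using hx, ?_⟩
    change edist a x ≤ δ at hd
    rw [edist_nndist] at hd
    exact_mod_cast hd

/-- With its converse below, this turns dimension bounds into covers by `δ ^ (-t)` balls. The
condition `δ < 1` makes `-log δ` positive. -/
theorem coveredBy_of_boxQuotient_le {A : Set X} {δ : ℝ≥0} (h0 : 0 < δ) (h1 : δ < 1) {t : ℝ}
    (ht : 0 ≤ t) (h : boxQuotient A δ ≤ ENNReal.ofReal t) :
    CoveredBy A δ ((δ : ℝ) ^ (-t)) := by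
  have h0' : (0 : ℝ) < δ := h0
  have h1' : (δ : ℝ) < 1 := h1
  have hlog : 0 < -Real.log (δ : ℝ) := by
    have := Real.log_neg h0' h1'
    linarith
  unfold boxQuotient at h
  split_ifs at h with htop
  · simp at h
  · refine (coveredBy_of_externalCoveringNumber_ne_top htop).mono le_rfl ?_
    set N := (Metric.externalCoveringNumber δ A).toNat
    rcases Nat.eq_zero_or_pos N with hN | hN
    · rw [hN]
      simpa using Real.rpow_nonneg h0'.le _
    · have hN' : (0 : ℝ) < N := by exact_mod_cast hN
      rw [ENNReal.ofReal_le_ofReal_iff ht, div_le_iff₀ hlog] at h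
      rw [← Real.log_le_log_iff hN' (Real.rpow_pos_of_pos h0' _), Real.log_rpow h0']
      linarith

theorem boxQuotient_le_of_coveredBy {A : Set X} {δ : ℝ≥0} (h0 : 0 < δ) (h1 : δ < 1) {t : ℝ}
    (h : CoveredBy A δ ((δ : ℝ) ^ (-t))) : boxQuotient A δ ≤ ENNReal.ofReal t := by
  have h0' : (0 : ℝ) < δ := h0
  have h1' : (δ : ℝ) < 1 := h1
  have hlog : 0 < -Real.log (δ : ℝ) := by
    have := Real.log_neg h0' h1'
    linarith
  obtain ⟨n, hn, hle⟩ := h.externalCoveringNumber_le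
  have htop : Metric.externalCoveringNumber δ A ≠ ⊤ := ne_top_of_le_ne_top (by simp) hle
  unfold boxQuotient
  rw [if_neg htop]
  set N := (Metric.externalCoveringNumber δ A).toNat with hNdef
  have hNn : N ≤ n := by
    have := ENat.toNat_le_toNat hle (by simp)
    simpa using this
  rcases Nat.eq_zero_or_pos N with hN | hN
  · simp [hN]
  · apply ENNReal.ofReal_le_ofReal
    have hN' : (0 : ℝ) < N := by exact_mod_cast hN
    have : (N : ℝ) ≤ (δ : ℝ) ^ (-t) := le_trans (by exact_mod_cast hNn) hn
    rw [← Real.log_le_log_iff hN' (Real.rpow_pos_of_pos h0' _), Real.log_rpow h0'] at this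
    rw [div_le_iff₀ hlog]
    linarith

theorem eventually_pos_lt_nhdsGT_zero {c : ℝ≥0} (hc : 0 < c) :
    ∀ᶠ δ : ℝ≥0 in 𝓝[>] 0, 0 < δ ∧ δ < c := by
  filter_upwards [Ioo_mem_nhdsGT hc] with δ hδ using hδ

/-- A constant factor is negligible against a small power of `δ`. -/
theorem eventually_const_mul_rpow_le (K : ℝ) {t t' : ℝ} (h : t < t') :
    ∀ᶠ δ : ℝ≥0 in 𝓝[>] 0, K * (δ : ℝ) ^ (-t) ≤ (δ : ℝ) ^ (-t') := by
  have hlim : Tendsto (fun δ : ℝ≥0 => (δ : ℝ) ^ (t' - t)) (𝓝 0) (𝓝 0) := by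
    have : ContinuousAt (fun δ : ℝ≥0 => (δ : ℝ) ^ (t' - t)) 0 :=
      NNReal.continuous_coe.continuousAt.rpow_const (Or.inr (by linarith))
    have h2 := this.tendsto
    simpa [Real.zero_rpow (by linarith : t' - t ≠ 0)] using h2
  have hev : ∀ᶠ δ : ℝ≥0 in 𝓝[>] 0, (δ : ℝ) ^ (t' - t) < 1 / (|K| + 1) :=
    (hlim.mono_left nhdsWithin_le_nhds).eventually_lt_const (by positivity)
  filter_upwards [hev, eventually_pos_lt_nhdsGT_zero one_pos] with δ h1 h2
  have h0 : (0 : ℝ) < δ := h2.1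
  have e : (δ : ℝ) ^ (-t) = (δ : ℝ) ^ (t' - t) * (δ : ℝ) ^ (-t') := by
    rw [← Real.rpow_add h0]
    ring_nf
  rw [e, ← mul_assoc]
  have hp := Real.rpow_pos_of_pos h0 (-t')
  have hq := Real.rpow_pos_of_pos h0 (t' - t)
  have : K * (δ : ℝ) ^ (t' - t) ≤ 1 := by
    rw [lt_div_iff₀ (by positivity)] at h1
    nlinarith [le_abs_self K]
  nlinarith

theorem upperBoxDim_le {A : Set X} {t : ℝ} (ht : 0 ≤ t)
    (h : ∀ t' > t, ∃ K : ℝ, ∀ᶠ δ : ℝ≥0 in 𝓝[>] 0, CoveredBy A δ (K * (δ : ℝ) ^ (-t'))) :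
    upperBoxDim A ≤ ENNReal.ofReal t := by
  refine ENNReal.le_of_forall_pos_le_add fun ε hε _ => ?_
  have hε' : (0 : ℝ) < ε := hε
  -- Half of the slack `ε` goes to the hypothesis, the other half absorbs the constant `K`.
  obtain ⟨K, hK⟩ := h (t + ε / 2) (by linarith)
  refine limsup_le_of_le (h := ?_)
  filter_upwards [hK, eventually_const_mul_rpow_le K (show t + ε / 2 < t + ε by linarith),
    eventually_pos_lt_nhdsGT_zero one_pos] with δ h1 h2 h3
  refine (boxQuotient_le_of_coveredBy h3.1 h3.2 (h1.mono le_rfl h2)).trans ?_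
  rw [ENNReal.ofReal_add ht hε'.le]
  simp

theorem lowerBoxDim_le {A : Set X} {t : ℝ} (ht : 0 ≤ t)
    (h : ∀ t' > t, ∃ K : ℝ, ∃ᶠ δ : ℝ≥0 in 𝓝[>] 0, CoveredBy A δ (K * (δ : ℝ) ^ (-t'))) :
    lowerBoxDim A ≤ ENNReal.ofReal t := by
  refine ENNReal.le_of_forall_pos_le_add fun ε hε _ => ?_
  have hε' : (0 : ℝ) < ε := hε
  obtain ⟨K, hK⟩ := h (t + ε / 2) (by linarith)
  refine liminf_le_of_frequently_le' ?_
  refine (hK.and_eventually ((eventually_const_mul_rpow_le K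
    (show t + ε / 2 < t + ε by linarith)).and
    (eventually_pos_lt_nhdsGT_zero one_pos))).mono ?_
  rintro δ ⟨h1, h2, h3⟩
  refine (boxQuotient_le_of_coveredBy h3.1 h3.2 (h1.mono le_rfl h2)).trans ?_
  rw [ENNReal.ofReal_add ht hε'.le]
  simp

theorem eventually_coveredBy_of_upperBoxDim_lt {A : Set X} {t : ℝ}
    (h : upperBoxDim A < ENNReal.ofReal t) :
    ∀ᶠ δ : ℝ≥0 in 𝓝[>] 0, CoveredBy A δ ((δ : ℝ) ^ (-t)) := by
  have ht : 0 < t := by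
    by_contra hneg
    rw [ENNReal.ofReal_of_nonpos (not_lt.1 hneg)] at h
    simp at h
  filter_upwards [eventually_lt_of_limsup_lt h, eventually_pos_lt_nhdsGT_zero one_pos]
    with δ h1 h2 using coveredBy_of_boxQuotient_le h2.1 h2.2 ht.le h1.le

theorem frequently_coveredBy_of_lowerBoxDim_lt {A : Set X} {t : ℝ}
    (h : lowerBoxDim A < ENNReal.ofReal t) :
    ∃ᶠ δ : ℝ≥0 in 𝓝[>] 0, CoveredBy A δ ((δ : ℝ) ^ (-t)) := by
  have ht : 0 < t := by
    by_contra hneg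
    rw [ENNReal.ofReal_of_nonpos (not_lt.1 hneg)] at h
    simp at h
  refine ((frequently_lt_of_liminf_lt (by isBoundedDefault) h).and_eventually
    (eventually_pos_lt_nhdsGT_zero one_pos)).mono ?_
  rintro δ ⟨h1, h2⟩
  exact coveredBy_of_boxQuotient_le h2.1 h2.2 ht.le h1.le

theorem lowerBoxDim_le_upperBoxDim (A : Set X) : lowerBoxDim A ≤ upperBoxDim A :=
  liminf_le_limsup

/-- Hausdorff dimension bound from covers at arbitrarily small scales. -/
theorem dimH_le_of_frequently_coveredBy {A : Set X} {t : ℝ} (ht : 0 ≤ t)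
    {K : ℝ} (h : ∃ᶠ δ : ℝ≥0 in 𝓝[>] 0, CoveredBy A δ (K * (δ : ℝ) ^ (-t))) :
    dimH A ≤ ENNReal.ofReal t := by
  borelize X
  obtain ⟨u, hu, hcov⟩ := exists_seq_forall_of_frequently
    (h.and_eventually (eventually_pos_lt_nhdsGT_zero one_pos))
  choose F hF hc using fun n => (hcov n).1
  have hu0 : Tendsto (fun n => ((2 * u n : ℝ≥0) : ℝ≥0∞)) atTop (𝓝 0) := by
    have h1 : Tendsto u atTop (𝓝 0) := hu.mono_right nhdsWithin_le_nhds
    have h2 : Tendsto (fun n => 2 * u n) atTop (𝓝 (2 * 0)) := h1.const_mul 2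
    rw [mul_zero] at h2
    simpa only [ENNReal.coe_zero] using ENNReal.tendsto_coe.2 h2
  have hdiam : ∀ n (i : F n), Metric.ediam (Metric.closedBall (i : X) (u n)) ≤
      ((2 * u n : ℝ≥0) : ℝ≥0∞) := by
    intro n i
    refine (Metric.ediam_le_of_forall_dist_le (C := 2 * u n) fun x hx y hy => ?_).trans ?_
    · have := dist_triangle_right x y (i : X)
      rw [Metric.mem_closedBall] at hx hy
      linarith
    · rw [show (2 * (u n : ℝ)) = ((2 * u n : ℝ≥0) : ℝ) by push_cast; rfl,
        ENNReal.ofReal_coe_nnreal]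
  -- Along a sequence of good radii, `K u⁻ᵗ` balls of diameter at most `2u` have total `t`-content
  -- at most `K 2ᵗ`, so the `t`-dimensional measure is finite.
  have key := MeasureTheory.Measure.hausdorffMeasure_le_liminf_sum t A (l := atTop)
    (fun n => ((2 * u n : ℝ≥0) : ℝ≥0∞)) hu0
    (fun n (i : F n) => Metric.closedBall (i : X) (u n))
    (Eventually.of_forall fun n i => hdiam n i)
    (Eventually.of_forall fun n a ha => by
      obtain ⟨x, hx, hd⟩ := hc n a ha
      exact mem_iUnion.2 ⟨⟨x, hx⟩, hd⟩)
  have hbound : ∀ n, ∑ i : F n, Metric.ediam (Metric.closedBall (i : X) (u n)) ^ t ≤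
      ENNReal.ofReal (K * 2 ^ t) := by
    intro n
    have hu' : (0 : ℝ) < u n := (hcov n).2.1
    calc ∑ i : F n, Metric.ediam (Metric.closedBall (i : X) (u n)) ^ t
        ≤ ∑ i : F n, ((2 * u n : ℝ≥0) : ℝ≥0∞) ^ t :=
          Finset.sum_le_sum fun i _ => ENNReal.rpow_le_rpow (hdiam n i) ht
      _ = (F n).card * ((2 * u n : ℝ≥0) : ℝ≥0∞) ^ t := by simp
      _ = ENNReal.ofReal ((F n).card * (2 * u n) ^ t) := by
          rw [ENNReal.ofReal_mul (by positivity), ENNReal.ofReal_natCast,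
            ← ENNReal.ofReal_rpow_of_pos (by positivity), ENNReal.ofReal]
          congr 3
          ext
          simp
      _ ≤ ENNReal.ofReal (K * 2 ^ t) := by
          apply ENNReal.ofReal_le_ofReal
          have e : (u n : ℝ) ^ (-t) * (u n : ℝ) ^ t = 1 := by
            rw [← Real.rpow_add hu']
            simp
          calc ((F n).card : ℝ) * (2 * u n) ^ t
              ≤ (K * (u n : ℝ) ^ (-t)) * (2 * u n) ^ t :=
                mul_le_mul_of_nonneg_right (hF n) (by positivity)
            _ = K * 2 ^ t * ((u n : ℝ) ^ (-t) * (u n : ℝ) ^ t) := by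
                rw [Real.mul_rpow (by norm_num) hu'.le]
                ring
            _ = K * 2 ^ t := by rw [e, mul_one]
  have hfin : MeasureTheory.Measure.hausdorffMeasure ((⟨t, ht⟩ : ℝ≥0) : ℝ) A ≠ ⊤ := by
    refine ne_top_of_le_ne_top (ENNReal.ofReal_ne_top (r := K * 2 ^ t)) (key.trans ?_)
    exact liminf_le_of_frequently_le' (Frequently.of_forall hbound)
  have := dimH_le_of_hausdorffMeasure_ne_top hfin
  rwa [ENNReal.ofReal, show t.toNNReal = ⟨t, ht⟩ from Real.toNNReal_of_nonneg ht]

theorem dimH_le_lowerBoxDim (A : Set X) : dimH A ≤ lowerBoxDim A := by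
  by_contra hcon
  obtain ⟨r, h1, h2⟩ := ENNReal.lt_iff_exists_nnreal_btwn.1 (not_le.1 hcon)
  have h1' : lowerBoxDim A < ENNReal.ofReal (r : ℝ) := by simpa using h1
  have := dimH_le_of_frequently_coveredBy (A := A) (t := r) (K := 1) r.2
    (by simpa using frequently_coveredBy_of_lowerBoxDim_lt h1')
  simp only [ENNReal.ofReal_coe_nnreal] at this
  exact absurd h2 (not_lt.2 this)

end BoxCounting

/-! ### Packing dimension as countably stabilised upper box dimension. -/

section Packing

variable {X : Type*} [MetricSpace X]

/-- If the finite `δ`-separated subsets of `A` have at most `N` points, then a maximal one shows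
that `A` is covered by `N` balls of radius `δ`. -/
theorem CoveredBy.of_separated {A : Set X} {δ N : ℝ} (hδ : 0 ≤ δ)
    (h : ∀ F : Finset X, (F : Set X) ⊆ A → (F : Set X).Pairwise (fun x y => δ < dist x y) →
      (F.card : ℝ) ≤ N) : CoveredBy A δ N := by
  classical
  let T : Set ℕ := {n | ∃ F : Finset X, (F : Set X) ⊆ A ∧
    (F : Set X).Pairwise (fun x y => δ < dist x y) ∧ F.card = n}
  have hne : T.Nonempty := ⟨0, ∅, by simp, by simp, rfl⟩
  have hbdd : BddAbove T := by
    refine ⟨⌊N⌋₊, ?_⟩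
    rintro n ⟨F, h1, h2, rfl⟩
    exact Nat.le_floor (h F h1 h2)
  obtain ⟨F, hFA, hFs, hFc⟩ := Nat.sSup_mem hne hbdd
  refine ⟨F, h F hFA hFs, fun a ha => ?_⟩
  by_contra! hcon
  have haF : a ∉ F := fun haF => absurd (hcon a haF) (by simpa using hδ)
  have hmem : (insert a F).card ∈ T := by
    refine ⟨insert a F, ?_, ?_, rfl⟩
    · rw [Finset.coe_insert]
      exact Set.insert_subset ha hFA
    · rw [Finset.coe_insert]
      refine hFs.insert fun x hx _ => ⟨hcon x hx, ?_⟩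
      rw [dist_comm]
      exact hcon x hx
  have := le_csSup hbdd hmem
  rw [Finset.card_insert_of_notMem haF] at this
  omega

/-- Balls of radius `δ / 2` around `δ`-separated points form a packing in which each ball
contributes `δ ^ s`; the content therefore bounds the number of points. The condition `δ ≤ 2 δ₀`
makes this packing admissible. -/
theorem coveredBy_of_packingContent_ne_top {A : Set X} {s : ℝ≥0} {δ₀ δ : ℝ} (hδ : 0 < δ)
    (hδδ : δ ≤ 2 * δ₀) (h : packingContent s δ₀ A ≠ ⊤) :
    CoveredBy A δ ((packingContent s δ₀ A).toReal * δ ^ (-(s : ℝ))) := by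
  classical
  refine CoveredBy.of_separated hδ.le fun F hFA hF => ?_
  let P : Finset (X × ℝ) := F.image fun x => (x, δ / 2)
  have hinj : Set.InjOn (fun x : X => (x, δ / 2)) F := fun x _ y _ hxy => (Prod.mk.inj hxy).1
  have hP : IsBallPacking A δ₀ P := by
    constructor
    · intro b hb
      obtain ⟨x, hx, rfl⟩ := Finset.mem_image.1 hb
      exact ⟨hFA hx, by positivity, by simp only; linarith⟩
    · intro b hb c hc hbc
      obtain ⟨x, hx, rfl⟩ := Finset.mem_image.1 (Finset.mem_coe.1 hb)
      obtain ⟨y, hy, rfl⟩ := Finset.mem_image.1 (Finset.mem_coe.1 hc)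
      have hxy : x ≠ y := fun e => hbc (by rw [e])
      exact Metric.closedBall_disjoint_closedBall (by linarith [hF hx hy hxy])
  have hle : ∑ b ∈ P, ENNReal.ofReal ((2 * b.2) ^ (s : ℝ)) ≤ packingContent s δ₀ A :=
    le_iSup₂_of_le (f := fun P (_ : IsBallPacking A δ₀ P) =>
      ∑ b ∈ P, ENNReal.ofReal ((2 * b.2) ^ (s : ℝ))) P hP le_rfl
  rw [Finset.sum_image hinj] at hle
  have e : (2 * (δ / 2)) = δ := by ring
  simp only [e, Finset.sum_const, nsmul_eq_mul] at hle
  have hle' := ENNReal.toReal_mono h hle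
  rw [ENNReal.toReal_mul, ENNReal.toReal_natCast,
    ENNReal.toReal_ofReal (Real.rpow_nonneg hδ.le _)] at hle'
  rw [Real.rpow_neg hδ.le, ← div_eq_mul_inv, le_div_iff₀ (Real.rpow_pos_of_pos hδ _)]
  exact hle'

theorem upperBoxDim_le_of_packingPremeasure_ne_top {A : Set X} {s : ℝ≥0}
    (h : packingPremeasure s A ≠ ⊤) : upperBoxDim A ≤ s := by
  obtain ⟨δ₀, hδ₀, hfin⟩ : ∃ δ₀ : ℝ, 0 < δ₀ ∧ packingContent s δ₀ A ≠ ⊤ := by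
    by_contra! hcon
    exact h (by simpa [packingPremeasure] using hcon)
  have := upperBoxDim_le (A := A) (t := s) s.2 fun t' ht' =>
    ⟨(packingContent s δ₀ A).toReal, by
      filter_upwards [eventually_pos_lt_nhdsGT_zero (c := min (2 * δ₀.toNNReal) 1)
        (by simpa using hδ₀)] with δ hδ
      have h1 : (δ : ℝ) < 1 := by exact_mod_cast hδ.2.trans_le (min_le_right _ _)
      have h2 : (δ : ℝ) ≤ 2 * δ₀ := by
        have : (δ : ℝ) ≤ ((2 * δ₀.toNNReal : ℝ≥0) : ℝ) := by
          exact_mod_cast hδ.2.le.trans (min_le_left _ _)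
        rwa [NNReal.coe_mul, Real.coe_toNNReal _ hδ₀.le] at this
      refine (coveredBy_of_packingContent_ne_top hδ.1 h2 hfin).mono le_rfl ?_
      refine mul_le_mul_of_nonneg_left ?_ ENNReal.toReal_nonneg
      exact Real.rpow_le_rpow_of_exponent_ge hδ.1 h1.le (by linarith)⟩
  simpa using this

/-- A packing ball of radius at least `ρ` contains a centre of the `ρ`-cover, and disjoint balls
contain different ones. -/
theorem IsBallPacking.card_filter_le {A : Set X} {δ : ℝ} {P : Finset (X × ℝ)}
    (hP : IsBallPacking A δ P) {ρ N : ℝ} (hA : CoveredBy A ρ N) {p : X × ℝ → Prop}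
    [DecidablePred p] (hp : ∀ b, p b → ρ ≤ b.2) : ((P.filter p).card : ℝ) ≤ N := by
  classical
  obtain ⟨F, hF, hc⟩ := hA
  refine le_trans ?_ hF
  have hex : ∀ b ∈ P.filter p, ∃ x ∈ F, x ∈ Metric.closedBall b.1 b.2 := by
    intro b hb
    rw [Finset.mem_filter] at hb
    obtain ⟨x, hx, hd⟩ := hc b.1 (hP.1 b hb.1).1
    refine ⟨x, hx, ?_⟩
    rw [Metric.mem_closedBall, dist_comm]
    exact hd.trans (hp b hb.2)
  rcases isEmpty_or_nonempty X with _ | _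
  · simp [Finset.eq_empty_of_isEmpty]
  choose! g hg using hex
  have : (P.filter p).card ≤ F.card := by
    refine Finset.card_le_card_of_injOn g (fun b hb => (hg b hb).1) fun b hb c hc' hbc => ?_
    by_contra hne
    have hb' := Finset.mem_coe.1 hb
    have hc'' := Finset.mem_coe.1 hc'
    have hdis := hP.2 (Finset.mem_filter.1 hb').1 (Finset.mem_filter.1 hc'').1 hne
    exact Set.disjoint_left.1 hdis (hg b hb').2 (hbc ▸ (hg c hc'').2)
  exact_mod_cast this

/-- Sort the balls dyadically by radius. A class with radii in `(ρ, 2ρ]` has at most `ρ ^ (-t)`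
members, each contributing at most `(4ρ) ^ s`; since `t < s` the classes sum to a geometric series.
-/
theorem packingContent_le {A : Set X} {s : ℝ≥0} {t δ : ℝ} (hts : t < s)
    (hδ : 0 < δ) (hcov : ∀ ρ, 0 < ρ → ρ ≤ δ → CoveredBy A ρ (ρ ^ (-t))) :
    packingContent s δ A ≤ ENNReal.ofReal
      (4 ^ (s : ℝ) * (∑' k : ℕ, ((1 / 2 : ℝ) ^ ((s : ℝ) - t)) ^ k) * δ ^ ((s : ℝ) - t)) := by
  classical
  refine iSup₂_le fun P hP => ?_
  set q : ℝ := (1 / 2 : ℝ) ^ ((s : ℝ) - t) with hq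
  have hq0 : 0 < q := Real.rpow_pos_of_pos (by norm_num) _
  have hq1 : q < 1 := Real.rpow_lt_one (by norm_num) (by norm_num) (by linarith)
  have hsum : Summable fun k : ℕ => q ^ k := summable_geometric_of_lt_one hq0.le hq1
  rw [← ENNReal.ofReal_sum_of_nonneg
    (fun b hb => Real.rpow_nonneg (by linarith [(hP.1 b hb).2.1]) _)]
  apply ENNReal.ofReal_le_ofReal
  have hκ : ∀ b ∈ P, ∃ k : ℕ, (1 / 2 : ℝ) ^ (k + 1) < b.2 / δ ∧ b.2 / δ ≤ (1 / 2 : ℝ) ^ k := by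
    intro b hb
    obtain ⟨_, h1, h2⟩ := hP.1 b hb
    exact exists_nat_pow_near_of_lt_one (by positivity) ((div_le_one hδ).2 h2)
      (by norm_num) (by norm_num)
  choose! κ hκ1 hκ2 using hκ
  have hclass : ∀ k ∈ P.image κ, ∑ b ∈ P with κ b = k, (2 * b.2) ^ (s : ℝ) ≤
      4 ^ (s : ℝ) * δ ^ ((s : ℝ) - t) * q ^ k := by
    intro k _
    set ρ : ℝ := (1 / 2 : ℝ) ^ (k + 1) * δ with hρ
    have hρ0 : 0 < ρ := by positivity
    have hρδ : ρ ≤ δ := by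
      have : (1 / 2 : ℝ) ^ (k + 1) ≤ 1 := pow_le_one₀ (by norm_num) (by norm_num)
      nlinarith
    have hterm : ∀ b ∈ P.filter fun b => κ b = k, (2 * b.2) ^ (s : ℝ) ≤ (4 * ρ) ^ (s : ℝ) := by
      intro b hb
      obtain ⟨hbP, rfl⟩ := Finset.mem_filter.1 hb
      have h2 := hκ2 b hbP
      rw [div_le_iff₀ hδ] at h2
      refine Real.rpow_le_rpow (by linarith [(hP.1 b hbP).2.1]) ?_ s.2
      rw [hρ, pow_succ]
      linarith
    have hcard : (((P.filter fun b => κ b = k).card : ℕ) : ℝ) ≤ ρ ^ (-t) := by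
      have hP' : IsBallPacking A δ (P.filter fun b => κ b = k) :=
        ⟨fun b hb => hP.1 b (Finset.mem_filter.1 hb).1,
          hP.2.subset (by intro b hb; exact (Finset.mem_filter.1 (Finset.mem_coe.1 hb)).1)⟩
      have := hP'.card_filter_le (hcov ρ hρ0 hρδ) (p := fun b => ρ ≤ b.2) fun b hb => hb
      rwa [Finset.filter_true_of_mem] at this
      intro b hb
      obtain ⟨hbP, rfl⟩ := Finset.mem_filter.1 hb
      have h1 := hκ1 b hbP
      rw [lt_div_iff₀ hδ] at h1
      exact h1.le
    calc ∑ b ∈ P with κ b = k, (2 * b.2) ^ (s : ℝ)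
        ≤ ∑ b ∈ P with κ b = k, (4 * ρ) ^ (s : ℝ) := Finset.sum_le_sum hterm
      _ = (P.filter fun b => κ b = k).card * (4 * ρ) ^ (s : ℝ) := by simp
      _ ≤ ρ ^ (-t) * (4 * ρ) ^ (s : ℝ) :=
          mul_le_mul_of_nonneg_right hcard (Real.rpow_nonneg (by positivity) _)
      _ = 4 ^ (s : ℝ) * ρ ^ ((s : ℝ) - t) := by
          rw [Real.mul_rpow (by norm_num) hρ0.le, sub_eq_add_neg, Real.rpow_add hρ0]
          ring
      _ = 4 ^ (s : ℝ) * δ ^ ((s : ℝ) - t) * q ^ (k + 1) := by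
          rw [hρ, Real.mul_rpow (by positivity) hδ.le, hq, ← Real.rpow_natCast,
            ← Real.rpow_natCast, ← Real.rpow_mul (by norm_num), ← Real.rpow_mul (by norm_num),
            mul_comm ((k + 1 : ℕ) : ℝ)]
          ring
      _ ≤ 4 ^ (s : ℝ) * δ ^ ((s : ℝ) - t) * q ^ k :=
          mul_le_mul_of_nonneg_left (pow_le_pow_of_le_one hq0.le hq1.le (Nat.le_succ k))
            (by positivity)
  calc ∑ b ∈ P, (2 * b.2) ^ (s : ℝ)
      = ∑ k ∈ P.image κ, ∑ b ∈ P with κ b = k, (2 * b.2) ^ (s : ℝ) :=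
        (Finset.sum_fiberwise_of_maps_to (fun b hb => Finset.mem_image_of_mem κ hb) _).symm
    _ ≤ ∑ k ∈ P.image κ, 4 ^ (s : ℝ) * δ ^ ((s : ℝ) - t) * q ^ k := Finset.sum_le_sum hclass
    _ = 4 ^ (s : ℝ) * δ ^ ((s : ℝ) - t) * ∑ k ∈ P.image κ, q ^ k := by rw [Finset.mul_sum]
    _ ≤ 4 ^ (s : ℝ) * δ ^ ((s : ℝ) - t) * ∑' k : ℕ, q ^ k :=
        mul_le_mul_of_nonneg_left (hsum.sum_le_tsum _ fun k _ => by positivity) (by positivity)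
    _ = _ := by ring

theorem packingPremeasure_eq_zero_of_upperBoxDim_lt {A : Set X} {s : ℝ≥0}
    (h : upperBoxDim A < s) : packingPremeasure s A = 0 := by
  obtain ⟨t, h1, h2⟩ := ENNReal.lt_iff_exists_nnreal_btwn.1 h
  have hts : (t : ℝ) < s := by exact_mod_cast h2
  have hev := eventually_coveredBy_of_upperBoxDim_lt (A := A) (t := t) (by simpa using h1)
  obtain ⟨c, hc, hcov⟩ := mem_nhdsGT_iff_exists_Ioo_subset.1 hev
  have hc0 : (0 : ℝ) < c := hc
  set M : ℝ := 4 ^ (s : ℝ) * (∑' k : ℕ, ((1 / 2 : ℝ) ^ ((s : ℝ) - t)) ^ k)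
  have hle : ∀ δ : ℝ, 0 < δ → δ < c →
      packingPremeasure s A ≤ ENNReal.ofReal (M * δ ^ ((s : ℝ) - t)) := by
    intro δ hδ hδc
    refine (iInf₂_le δ hδ).trans (packingContent_le hts hδ fun ρ hρ hρδ => ?_)
    have : (⟨ρ, hρ.le⟩ : ℝ≥0) ∈ Ioo 0 c := ⟨hρ, hρδ.trans_lt hδc⟩
    exact hcov this
  have hlim : Tendsto (fun δ : ℝ => ENNReal.ofReal (M * δ ^ ((s : ℝ) - t))) (𝓝[>] 0) (𝓝 0) := by
    have hcont : ContinuousAt (fun δ : ℝ => M * δ ^ ((s : ℝ) - t)) 0 :=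
      continuousAt_const.mul (Real.continuousAt_rpow_const _ _ (Or.inr (by linarith)))
    have := (ENNReal.continuous_ofReal.tendsto _).comp hcont.tendsto
    simp only [Real.zero_rpow (by linarith : (s : ℝ) - t ≠ 0), mul_zero,
      ENNReal.ofReal_zero] at this
    exact this.mono_left nhdsWithin_le_nhds
  refine le_antisymm (ge_of_tendsto hlim ?_) bot_le
  filter_upwards [Ioo_mem_nhdsGT hc0] with δ hδ using hle δ hδ.1 hδ.2

theorem packingDim_le_of_forall_upperBoxDim_le {A : Set X} {C : ℕ → Set X}
    (hA : A ⊆ ⋃ i, C i) {t : ℝ≥0∞} (h : ∀ i, upperBoxDim (C i) ≤ t) : packingDim A ≤ t := by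
  refine iSup₂_le fun s hs => ?_
  by_contra hcon
  have hz : packingMeasure s A ≤ ∑' i, packingPremeasure s (C i) := iInf₂_le C hA
  have : ∀ i, packingPremeasure s (C i) = 0 := fun i =>
    packingPremeasure_eq_zero_of_upperBoxDim_lt ((h i).trans_lt (not_le.1 hcon))
  simp [this, hs] at hz

/-- Together with `packingDim_le_of_forall_upperBoxDim_le`, this reduces statements on packing
dimension to upper box dimensions of the pieces of a countable cover. -/
theorem exists_cover_of_packingDim_lt {A : Set X} {s : ℝ≥0} (h : packingDim A < s) :
    ∃ C : ℕ → Set X, A ⊆ ⋃ i, C i ∧ ∀ i, upperBoxDim (C i) ≤ s := by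
  have hne : packingMeasure s A ≠ ⊤ := fun htop =>
    absurd h (not_lt.2 (le_iSup₂_of_le (f := fun (s : ℝ≥0) (_ : packingMeasure s A = ⊤) =>
      (s : ℝ≥0∞)) s htop le_rfl))
  obtain ⟨C, hC, hfin⟩ : ∃ C : ℕ → Set X, A ⊆ ⋃ i, C i ∧
      ∑' i, packingPremeasure s (C i) ≠ ⊤ := by
    by_contra! hcon
    exact hne (by simpa [packingMeasure] using hcon)
  exact ⟨C, hC, fun i => upperBoxDim_le_of_packingPremeasure_ne_top
    (ENNReal.ne_top_of_tsum_ne_top hfin i)⟩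

theorem packingDim_le_upperBoxDim (A : Set X) : packingDim A ≤ upperBoxDim A :=
  packingDim_le_of_forall_upperBoxDim_le (C := fun _ => A) (by simp [Set.iUnion_const])
    fun _ => le_rfl

theorem dimH_le_packingDim (A : Set X) : dimH A ≤ packingDim A := by
  by_contra hcon
  obtain ⟨r, h1, h2⟩ := ENNReal.lt_iff_exists_nnreal_btwn.1 (not_le.1 hcon)
  obtain ⟨C, hC, hdim⟩ := exists_cover_of_packingDim_lt h1
  refine absurd h2 (not_lt.2 ((dimH_mono hC).trans ?_))
  rw [dimH_iUnion]
  exact iSup_le fun i =>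
    (dimH_le_lowerBoxDim _).trans ((lowerBoxDim_le_upperBoxDim _).trans (hdim i))

end Packing

/-! ### The discrete incidence bound with exponent 4/3. -/

section Combinatorics

open Classical in
/-- If every point of `S` lies, up to rounding, at the midpoint of two points of `B` on the same
row, then few points of `S` lie on rows that contain at most `K` points of `B`. -/
theorem card_filter_light_rows_le (S B : Finset (ℤ × ℤ)) {K : ℝ} (hK : 0 ≤ K)
    (h : ∀ p ∈ S, ∃ k l : ℤ, (k, p.2) ∈ B ∧ (l, p.2) ∈ B ∧ |k + l - 2 * p.1| ≤ 1) :
    ((S.filter fun p => ((B.filter fun b => b.2 = p.2).card : ℝ) ≤ K).card : ℝ) ≤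
      2 * K * B.card := by
  let R : ℤ → Finset (ℤ × ℤ) := fun j => B.filter fun b => b.2 = j
  let L := B.filter fun x => ((R x.2).card : ℝ) ≤ K
  -- The centres that can have `x` as one of their two symmetric points: choose the partner on the
  -- same row and a bit that corrects the rounding.
  let T : ℤ × ℤ → Finset (ℤ × ℤ) := fun x =>
    (R x.2 ×ˢ ({0, 1} : Finset ℤ)).image fun y => ((x.1 + y.1.1 + y.2) / 2, x.2)
  have hsub : (S.filter fun p => ((B.filter fun b => b.2 = p.2).card : ℝ) ≤ K) ⊆ L.biUnion T := by
    intro p hp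
    obtain ⟨hpS, hpK⟩ := Finset.mem_filter.1 hp
    obtain ⟨k, l, hk, hl, hkl⟩ := h p hpS
    rw [abs_le] at hkl
    refine Finset.mem_biUnion.2 ⟨(k, p.2), Finset.mem_filter.2 ⟨hk, hpK⟩, ?_⟩
    have hl' : (l, p.2) ∈ R p.2 := Finset.mem_filter.2 ⟨hl, rfl⟩
    -- Floor division by two already recovers `p.1` when the error is `0` or `1`; only the error
    -- `-1` needs the bit.
    by_cases hcase : k + l - 2 * p.1 = -1
    · exact Finset.mem_image.2 ⟨((l, p.2), 1), by simp [hl'], Prod.ext (by simp only; omega) rfl⟩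
    · exact Finset.mem_image.2 ⟨((l, p.2), 0), by simp [hl'], Prod.ext (by simp only; omega) rfl⟩
  have hT : ∀ x ∈ L, ((T x).card : ℝ) ≤ 2 * K := by
    intro x hx
    have h1 : (T x).card ≤ (R x.2).card * 2 := by
      refine Finset.card_image_le.trans ?_
      rw [Finset.card_product]
      simp
    have h2 : ((T x).card : ℝ) ≤ (R x.2).card * 2 := by exact_mod_cast h1
    linarith [(Finset.mem_filter.1 hx).2]
  calc ((S.filter fun p => ((B.filter fun b => b.2 = p.2).card : ℝ) ≤ K).card : ℝ)
      ≤ ((L.biUnion T).card : ℝ) := by exact_mod_cast Finset.card_le_card hsub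
    _ ≤ ∑ x ∈ L, ((T x).card : ℝ) := by exact_mod_cast Finset.card_biUnion_le
    _ ≤ ∑ x ∈ L, 2 * K := Finset.sum_le_sum hT
    _ = L.card * (2 * K) := by simp
    _ ≤ B.card * (2 * K) :=
        mul_le_mul_of_nonneg_right (by exact_mod_cast Finset.card_filter_le _ _) (by positivity)
    _ = 2 * K * B.card := by ring

open Classical in
theorem mul_card_heavy_rows_le (B : Finset (ℤ × ℤ)) (K : ℝ) :
    K * (((B.image Prod.snd).filter fun j => K < (B.filter fun b => b.2 = j).card).card : ℝ) ≤
      B.card := by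
  set H := (B.image Prod.snd).filter fun j => K < (B.filter fun b => b.2 = j).card
  calc K * (H.card : ℝ) = ∑ j ∈ H, K := by simp [mul_comm]
    _ ≤ ∑ j ∈ H, ((B.filter fun b => b.2 = j).card : ℝ) :=
        Finset.sum_le_sum fun j hj => (Finset.mem_filter.1 hj).2.le
    _ ≤ ∑ j ∈ B.image Prod.snd, ((B.filter fun b => b.2 = j).card : ℝ) :=
        Finset.sum_le_sum_of_subset_of_nonneg (Finset.filter_subset _ _)
          fun _ _ _ => Nat.cast_nonneg _
    _ = B.card := by
        rw [Finset.card_eq_sum_card_image Prod.snd B]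
        push_cast
        rfl

/-- A finite set `B` containing, up to rounding, two points symmetric about `p` on the row and on
the column of every `p ∈ S` satisfies `|S| ≲ |B|^{4/3}`. -/
theorem card_centres_le (S B : Finset (ℤ × ℤ))
    (hrow : ∀ p ∈ S, ∃ k l : ℤ, (k, p.2) ∈ B ∧ (l, p.2) ∈ B ∧ |k + l - 2 * p.1| ≤ 1)
    (hcol : ∀ p ∈ S, ∃ k l : ℤ, (p.1, k) ∈ B ∧ (p.1, l) ∈ B ∧ |k + l - 2 * p.2| ≤ 1) :
    (S.card : ℝ) ≤ 5 * (B.card : ℝ) ^ (4 / 3 : ℝ) := by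
  classical
  rcases S.eq_empty_or_nonempty with rfl | ⟨p₀, hp₀⟩
  · simp only [Finset.card_empty, Nat.cast_zero]
    positivity
  have hBpos : (0 : ℝ) < B.card := by
    obtain ⟨k, l, hk, _⟩ := hrow p₀ hp₀
    exact_mod_cast Finset.card_pos.2 ⟨_, hk⟩
  set n : ℝ := (B.card : ℝ) with hn
  -- This threshold balances `K n` against `(n / K) ^ 2`; both become `n ^ (4/3)`. The constant is
  -- `2 + 2 + 1 = 5`.
  set K : ℝ := n ^ (1 / 3 : ℝ) with hK
  have hKpos : 0 < K := Real.rpow_pos_of_pos hBpos _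
  let B' := B.image Prod.swap
  let S' := S.image Prod.swap
  have hB'card : (B'.card : ℝ) = n := by
    rw [hn, Finset.card_image_of_injective _ Prod.swap_injective]
  have h1 := card_filter_light_rows_le S B hKpos.le hrow
  have h2 := card_filter_light_rows_le S' B' hKpos.le (by
    intro p hp
    obtain ⟨q, hq, rfl⟩ := Finset.mem_image.1 hp
    obtain ⟨k, l, hk, hl, hkl⟩ := hcol q hq
    exact ⟨k, l, Finset.mem_image.2 ⟨_, hk, rfl⟩, Finset.mem_image.2 ⟨_, hl, rfl⟩, hkl⟩)
  have h3 := mul_card_heavy_rows_le B K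
  have h4 := mul_card_heavy_rows_le B' K
  rw [hB'card] at h2 h4
  set S1 := S.filter fun p => ((B.filter fun b => b.2 = p.2).card : ℝ) ≤ K
  set S2 := S'.filter fun p => ((B'.filter fun b => b.2 = p.2).card : ℝ) ≤ K
  set H1 := (B.image Prod.snd).filter fun j => K < (B.filter fun b => b.2 = j).card
  set H2 := (B'.image Prod.snd).filter fun j => K < (B'.filter fun b => b.2 = j).card
  have hsub : S ⊆ S1 ∪ S2.image Prod.swap ∪ H2 ×ˢ H1 := by
    intro p hp
    by_cases c1 : ((B.filter fun b => b.2 = p.2).card : ℝ) ≤ K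
    · exact Finset.mem_union_left _ (Finset.mem_union_left _ (Finset.mem_filter.2 ⟨hp, c1⟩))
    by_cases c2 : ((B'.filter fun b => b.2 = p.1).card : ℝ) ≤ K
    · refine Finset.mem_union_left _ (Finset.mem_union_right _ (Finset.mem_image.2 ⟨p.swap, ?_, ?_⟩))
      · exact Finset.mem_filter.2 ⟨Finset.mem_image_of_mem _ hp, c2⟩
      · simp
    refine Finset.mem_union_right _ (Finset.mem_product.2 ⟨?_, ?_⟩)
    · obtain ⟨k, l, hk, _⟩ := hcol p hp
      exact Finset.mem_filter.2 ⟨Finset.mem_image.2 ⟨(k, p.1),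
        Finset.mem_image.2 ⟨_, hk, rfl⟩, rfl⟩, not_le.1 c2⟩
    · obtain ⟨k, l, hk, _⟩ := hrow p hp
      exact Finset.mem_filter.2 ⟨Finset.mem_image.2 ⟨_, hk, rfl⟩, not_le.1 c1⟩
  have hcard : (S.card : ℝ) ≤ S1.card + S2.card + H2.card * H1.card := by
    have e1 := (Finset.card_le_card hsub).trans (Finset.card_union_le _ _)
    have e2 := Finset.card_union_le S1 (S2.image Prod.swap)
    have e3 : (S2.image Prod.swap).card ≤ S2.card := Finset.card_image_le
    rw [Finset.card_product] at e1
    have : S.card ≤ S1.card + S2.card + H2.card * H1.card := by omega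
    exact_mod_cast this
  have e0 : K * n = n ^ (4 / 3 : ℝ) := by
    rw [hK, ← Real.rpow_add_one hBpos.ne']
    norm_num
  have e1 : (n / K) * (n / K) = n ^ (4 / 3 : ℝ) := by
    have : n / K = n ^ (2 / 3 : ℝ) := by
      rw [hK, div_eq_iff hKpos.ne', ← Real.rpow_add hBpos]
      norm_num
    rw [this, ← Real.rpow_add hBpos]
    norm_num
  have h3' : (H1.card : ℝ) ≤ n / K := by
    rw [le_div_iff₀ hKpos]
    linarith
  have h4' : (H2.card : ℝ) ≤ n / K := by
    rw [le_div_iff₀ hKpos]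
    linarith
  have h5 : (H2.card : ℝ) * H1.card ≤ (n / K) * (n / K) :=
    mul_le_mul h4' h3' (Nat.cast_nonneg _) (by positivity)
  nlinarith

end Combinatorics

/-! ### From the discrete bound to box and packing dimensions. -/

section SquareCentres

/-- The cell of the `ε`-grid in the diagonal coordinates `(p 0 + p 1, p 0 - p 1)`. -/
noncomputable def diagonalCell (ε : ℝ) (p : Plane) : ℤ × ℤ :=
  (⌊(p 0 + p 1) / ε⌋, ⌊(p 0 - p 1) / ε⌋)

theorem abs_sub_apply_le_dist (p q : Plane) (i : Fin 2) : |p i - q i| ≤ dist p q := by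
  have := PiLp.norm_apply_le (p - q) i
  rwa [PiLp.sub_apply, Real.norm_eq_abs, ← dist_eq_norm] at this

theorem dist_le_of_sq_add_sq_le {p q : Plane} {r : ℝ} (hr : 0 ≤ r)
    (h : (p 0 - q 0) ^ 2 + (p 1 - q 1) ^ 2 ≤ r ^ 2) : dist p q ≤ r := by
  rw [EuclideanSpace.dist_eq, Fin.sum_univ_two, Real.sqrt_le_left hr, Real.dist_eq, Real.dist_eq,
    sq_abs, sq_abs]
  exact h

theorem abs_floor_sub_floor_le {a b : ℝ} {m : ℤ} (h : |a - b| ≤ m) : |⌊a⌋ - ⌊b⌋| ≤ m := by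
  rw [abs_le] at h ⊢
  have h1 : ⌊a⌋ ≤ ⌊b + m⌋ := Int.floor_mono (by linarith)
  have h2 : ⌊b⌋ ≤ ⌊a + m⌋ := Int.floor_mono (by linarith)
  rw [Int.floor_add_intCast] at h1 h2
  omega

/-- Moving a point by at most `2ε` changes each diagonal coordinate by at most `4ε`, so a ball meets
only cells in a 9 × 9 block. -/
theorem exists_finset_diagonalCell {B : Set Plane} {ε N : ℝ} (hε : 0 < ε)
    (h : CoveredBy B (2 * ε) N) :
    ∃ G : Finset (ℤ × ℤ), (G.card : ℝ) ≤ 81 * N ∧ ∀ p ∈ B, diagonalCell ε p ∈ G := by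
  classical
  obtain ⟨F, hF, hc⟩ := h
  let T : Plane → Finset (ℤ × ℤ) := fun x =>
    Finset.Icc ((diagonalCell ε x).1 - 4) ((diagonalCell ε x).1 + 4) ×ˢ
      Finset.Icc ((diagonalCell ε x).2 - 4) ((diagonalCell ε x).2 + 4)
  refine ⟨F.biUnion T, ?_, fun p hp => ?_⟩
  · have : (F.biUnion T).card ≤ F.card * 81 := by
      refine Finset.card_biUnion_le_card_mul _ _ _ fun x _ => ?_
      simp only [T, Finset.card_product, Int.card_Icc]
      have e : ∀ z : ℤ, (z + 4 + 1 - (z - 4)).toNat = 9 := fun z => by omega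
      rw [e, e]
    have h2 : ((F.biUnion T).card : ℝ) ≤ F.card * 81 := by exact_mod_cast this
    linarith
  · obtain ⟨x, hx, hd⟩ := hc p hp
    have h0 := abs_le.1 ((abs_sub_apply_le_dist p x 0).trans hd)
    have h1 := abs_le.1 ((abs_sub_apply_le_dist p x 1).trans hd)
    have hu : |(p 0 + p 1) / ε - (x 0 + x 1) / ε| ≤ ((4 : ℤ) : ℝ) := by
      rw [← sub_div, abs_div, abs_of_pos hε, div_le_iff₀ hε, abs_le]
      push_cast
      constructor <;> linarith [h0.1, h0.2, h1.1, h1.2]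
    have hw : |(p 0 - p 1) / ε - (x 0 - x 1) / ε| ≤ ((4 : ℤ) : ℝ) := by
      rw [← sub_div, abs_div, abs_of_pos hε, div_le_iff₀ hε, abs_le]
      push_cast
      constructor <;> linarith [h0.1, h0.2, h1.1, h1.2]
    have hu' := abs_le.1 (abs_floor_sub_floor_le hu)
    have hw' := abs_le.1 (abs_floor_sub_floor_le hw)
    refine Finset.mem_biUnion.2 ⟨x, hx, ?_⟩
    simp only [T, diagonalCell, Finset.mem_product, Finset.mem_Icc]
    omega

theorem abs_floor_add_floor_sub_le {u t : ℝ} : |⌊u + t⌋ + ⌊u - t⌋ - 2 * ⌊u⌋| ≤ 1 := by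
  have a1 := Int.floor_le (u + t)
  have a2 := Int.lt_floor_add_one (u + t)
  have b1 := Int.floor_le (u - t)
  have b2 := Int.lt_floor_add_one (u - t)
  have c1 := Int.floor_le u
  have c2 := Int.lt_floor_add_one u
  have h1 : ((⌊u + t⌋ + ⌊u - t⌋ - 2 * ⌊u⌋ : ℤ) : ℝ) < 2 := by push_cast; linarith
  have h2 : (-2 : ℝ) < ((⌊u + t⌋ + ⌊u - t⌋ - 2 * ⌊u⌋ : ℤ) : ℝ) := by push_cast; linarith
  have h1' : ⌊u + t⌋ + ⌊u - t⌋ - 2 * ⌊u⌋ < 2 := by exact_mod_cast h1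
  have h2' : -2 < ⌊u + t⌋ + ⌊u - t⌋ - 2 * ⌊u⌋ := by exact_mod_cast h2
  rw [abs_le]
  omega

theorem coveredBy_centres {S B : Set Plane} (hSB : ContainsSquareVertices B S) {δ N : ℝ}
    (hδ : 0 < δ) (h : CoveredBy B δ N) :
    CoveredBy S δ (5 * (81 * N) ^ (4 / 3 : ℝ)) := by
  classical
  set ε := δ / 2 with hεdef
  have hε : 0 < ε := by positivity
  obtain ⟨G, hG, hGc⟩ := exists_finset_diagonalCell hε (by rwa [show 2 * ε = δ by rw [hεdef]; ring])
  have hvert : ∀ p ∈ S, ∃ t : ℝ,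
      (⌊(p 0 + p 1) / ε + t⌋, ⌊(p 0 - p 1) / ε⌋) ∈ G ∧
      (⌊(p 0 + p 1) / ε - t⌋, ⌊(p 0 - p 1) / ε⌋) ∈ G ∧
      (⌊(p 0 + p 1) / ε⌋, ⌊(p 0 - p 1) / ε + t⌋) ∈ G ∧
      (⌊(p 0 + p 1) / ε⌋, ⌊(p 0 - p 1) / ε - t⌋) ∈ G := by
    intro p hp
    obtain ⟨r, _, hr⟩ := hSB p hp
    -- Each vertex keeps one diagonal coordinate of the centre and moves the other by `± 2r`.
    refine ⟨2 * r / ε, ?_, ?_, ?_, ?_⟩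
    · have := hGc !₂[p 0 + r, p 1 + r] (hr (by simp [squareVertices]))
      convert this using 1
      simp only [diagonalCell, Matrix.cons_val_zero, Matrix.cons_val_one]
      congr 2 <;> ring
    · have := hGc !₂[p 0 - r, p 1 - r] (hr (by simp [squareVertices]))
      convert this using 1
      simp only [diagonalCell, Matrix.cons_val_zero, Matrix.cons_val_one]
      congr 2 <;> ring
    · have := hGc !₂[p 0 + r, p 1 - r] (hr (by simp [squareVertices]))
      convert this using 1
      simp only [diagonalCell, Matrix.cons_val_zero, Matrix.cons_val_one]
      congr 2 <;> ring
    · have := hGc !₂[p 0 - r, p 1 + r] (hr (by simp [squareVertices]))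
      convert this using 1
      simp only [diagonalCell, Matrix.cons_val_zero, Matrix.cons_val_one]
      congr 2 <;> ring
  -- Both indices of a centre cell occur as indices of cells in the finite set `G`.
  have hfin : (diagonalCell ε '' S).Finite := by
    refine (((G ×ˢ G).image fun x => (x.1.1, x.2.2)).finite_toSet).subset ?_
    rintro _ ⟨p, hp, rfl⟩
    obtain ⟨t, h1, _, h3, _⟩ := hvert p hp
    exact Finset.mem_coe.2 (Finset.mem_image.2 ⟨(_, _), Finset.mem_product.2 ⟨h3, h1⟩, rfl⟩)
  have hmem : ∀ z, z ∈ hfin.toFinset ↔ ∃ p ∈ S, diagonalCell ε p = z := fun z => by simp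
  have hcard := card_centres_le hfin.toFinset G
    (by
      intro z hz
      obtain ⟨p, hp, rfl⟩ := (hmem z).1 hz
      obtain ⟨t, h1, h2, _, _⟩ := hvert p hp
      exact ⟨_, _, h1, h2, abs_floor_add_floor_sub_le⟩)
    (by
      intro z hz
      obtain ⟨p, hp, rfl⟩ := (hmem z).1 hz
      obtain ⟨t, _, _, h1, h2⟩ := hvert p hp
      exact ⟨_, _, h1, h2, abs_floor_add_floor_sub_le⟩)
  refine (CoveredBy.of_fibers (δ := δ) hfin.toFinset (diagonalCell ε)
    (fun a ha => (hmem _).2 ⟨a, ha, rfl⟩) ?_).mono le_rfl (hcard.trans ?_)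
  · intro a _ b _ hab
    obtain ⟨h1, h2⟩ := Prod.mk.inj hab
    have h1' := abs_lt.1 (Int.abs_sub_lt_one_of_floor_eq_floor h1)
    have h2' := abs_lt.1 (Int.abs_sub_lt_one_of_floor_eq_floor h2)
    rw [← sub_div, lt_div_iff₀ hε, div_lt_iff₀ hε] at h1' h2'
    apply dist_le_of_sq_add_sq_le hδ.le
    nlinarith [h1'.1, h1'.2, h2'.1, h2'.2]
  · gcongr

theorem ennreal_three_quarters_mul_le {a b : ℝ≥0∞}
    (h : ∀ t : ℝ≥0, b < t → a ≤ ENNReal.ofReal (4 / 3 * t)) : 3 / 4 * a ≤ b := by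
  by_contra hcon
  obtain ⟨t, h1, h2⟩ := ENNReal.lt_iff_exists_nnreal_btwn.1 (not_le.1 hcon)
  refine absurd h2 (not_lt.2 ((mul_le_mul_right (h t h1) (3 / 4)).trans_eq ?_))
  rw [show (3 / 4 : ℝ≥0∞) = ENNReal.ofReal (3 / 4) by
      rw [ENNReal.ofReal_div_of_pos (by norm_num)]; norm_num,
    ← ENNReal.ofReal_mul (by norm_num), ← mul_assoc]
  norm_num

theorem five_mul_rpow_four_thirds {δ t : ℝ} (hδ : 0 < δ) :
    5 * (81 * δ ^ (-t)) ^ (4 / 3 : ℝ) = 5 * 81 ^ (4 / 3 : ℝ) * δ ^ (-(4 / 3 * t)) := by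
  rw [Real.mul_rpow (by norm_num) (Real.rpow_nonneg hδ.le _), ← Real.rpow_mul hδ.le,
    show -t * (4 / 3) = -(4 / 3 * t) by ring, mul_assoc]

theorem upperBoxDim_centres_le {S B : Set Plane} (hSB : ContainsSquareVertices B S) {t : ℝ≥0}
    (h : upperBoxDim B ≤ t) : upperBoxDim S ≤ ENNReal.ofReal (4 / 3 * t) := by
  refine upperBoxDim_le (by positivity) fun t' ht' => ⟨5 * 81 ^ (4 / 3 : ℝ), ?_⟩
  have hlt : upperBoxDim B < ENNReal.ofReal (3 / 4 * t') := by
    refine h.trans_lt ?_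
    rw [← ENNReal.ofReal_coe_nnreal, ENNReal.ofReal_lt_ofReal_iff']
    constructor <;> linarith [t.2, show (0 : ℝ) ≤ t from t.2]
  filter_upwards [eventually_coveredBy_of_upperBoxDim_lt hlt,
    eventually_pos_lt_nhdsGT_zero one_pos] with δ h1 h2
  have := coveredBy_centres hSB h2.1 h1
  rwa [five_mul_rpow_four_thirds (NNReal.coe_pos.2 h2.1), show 4 / 3 * (3 / 4 * t') = t' by ring] at this

theorem lowerBoxDim_centres_le {S B : Set Plane} (hSB : ContainsSquareVertices B S) {t : ℝ≥0}
    (h : lowerBoxDim B ≤ t) : lowerBoxDim S ≤ ENNReal.ofReal (4 / 3 * t) := by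
  refine lowerBoxDim_le (by positivity) fun t' ht' => ⟨5 * 81 ^ (4 / 3 : ℝ), ?_⟩
  have hlt : lowerBoxDim B < ENNReal.ofReal (3 / 4 * t') := by
    refine h.trans_lt ?_
    rw [← ENNReal.ofReal_coe_nnreal, ENNReal.ofReal_lt_ofReal_iff']
    constructor <;> linarith [t.2, show (0 : ℝ) ≤ t from t.2]
  refine ((frequently_coveredBy_of_lowerBoxDim_lt hlt).and_eventually
    (eventually_pos_lt_nhdsGT_zero one_pos)).mono ?_
  rintro δ ⟨h1, h2⟩
  have := coveredBy_centres hSB h2.1 h1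
  rwa [five_mul_rpow_four_thirds (NNReal.coe_pos.2 h2.1), show 4 / 3 * (3 / 4 * t') = t' by ring] at this

theorem upperBoxDim_union_le {X : Type*} [MetricSpace X] {A B : Set X} {t : ℝ≥0}
    (hA : upperBoxDim A ≤ t) (hB : upperBoxDim B ≤ t) : upperBoxDim (A ∪ B) ≤ t := by
  have := upperBoxDim_le (A := A ∪ B) (t := t) t.2 fun t' ht' => ⟨2, by
    have hlt : (t : ℝ≥0∞) < ENNReal.ofReal t' := by
      rw [← ENNReal.ofReal_coe_nnreal, ENNReal.ofReal_lt_ofReal_iff']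
      exact ⟨ht', t.2.trans_lt ht'⟩
    filter_upwards [eventually_coveredBy_of_upperBoxDim_lt (hA.trans_lt hlt),
      eventually_coveredBy_of_upperBoxDim_lt (hB.trans_lt hlt)] with δ h1 h2
    rw [two_mul]
    exact h1.union h2⟩
  simpa using this

theorem upperBoxDim_empty {X : Type*} [MetricSpace X] : upperBoxDim (∅ : Set X) = 0 := by
  have h : boxQuotient (∅ : Set X) = fun _ => 0 := by
    ext δ
    simp [boxQuotient]
  rw [upperBoxDim, h]
  exact limsup_const_bot

theorem upperBoxDim_biUnion_lt_le {X : Type*} [MetricSpace X] {C : ℕ → Set X} {t : ℝ≥0}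
    (h : ∀ i, upperBoxDim (C i) ≤ t) (n : ℕ) : upperBoxDim (⋃ i < n, C i) ≤ t := by
  induction n with
  | zero => simp [upperBoxDim_empty]
  | succ n ih =>
    rw [Set.biUnion_lt_succ]
    exact upperBoxDim_union_le ih (h n)

/-- The four vertices of a square may fall in different pieces of a countable cover of `B`. They do
all lie in some finite union of pieces, and upper box dimension is finitely stable; so cover `S` by
the centres `S' n` of squares with vertices in the first `n` pieces. -/
theorem three_quarters_mul_packingDim_le {S B : Set Plane} (hSB : ContainsSquareVertices B S) :
    3 / 4 * packingDim S ≤ packingDim B := by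
  refine ennreal_three_quarters_mul_le fun t ht => ?_
  obtain ⟨C, hC, hdim⟩ := exists_cover_of_packingDim_lt ht
  let B' : ℕ → Set Plane := fun n => ⋃ i < n, C i
  let S' : ℕ → Set Plane := fun n => {p | ∃ r : ℝ, 0 < r ∧ squareVertices p r ⊆ B' n}
  have hmono : ∀ {v : Plane} {i n : ℕ}, v ∈ C i → i < n → v ∈ B' n := fun hv hi =>
    Set.mem_biUnion (show _ ∈ {j | j < _} from hi) hv
  refine packingDim_le_of_forall_upperBoxDim_le (C := S') (fun p hp => ?_) fun n =>
    upperBoxDim_centres_le (B := B' n) (fun p hp => hp) (upperBoxDim_biUnion_lt_le hdim n)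
  obtain ⟨r, hr, hsub⟩ := hSB p hp
  have hv : ∀ v ∈ squareVertices p r, ∃ i, v ∈ C i := fun v hv =>
    Set.mem_iUnion.1 (hC (hsub hv))
  obtain ⟨i, hi⟩ := hv !₂[p 0 - r, p 1 - r] (by simp [squareVertices])
  obtain ⟨j, hj⟩ := hv !₂[p 0 + r, p 1 - r] (by simp [squareVertices])
  obtain ⟨k, hk⟩ := hv !₂[p 0 - r, p 1 + r] (by simp [squareVertices])
  obtain ⟨l, hl⟩ := hv !₂[p 0 + r, p 1 + r] (by simp [squareVertices])
  refine Set.mem_iUnion.2 ⟨i + j + k + l + 1, r, hr, ?_⟩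
  rintro v (rfl | rfl | rfl | rfl)
  · exact hmono hi (by omega)
  · exact hmono hj (by omega)
  · exact hmono hk (by omega)
  · exact hmono hl (by omega)

theorem three_quarters_mul_upperBoxDim_le {S B : Set Plane} (hSB : ContainsSquareVertices B S) :
    3 / 4 * upperBoxDim S ≤ upperBoxDim B :=
  ennreal_three_quarters_mul_le fun _ ht => upperBoxDim_centres_le hSB ht.le

theorem three_quarters_mul_lowerBoxDim_le {S B : Set Plane} (hSB : ContainsSquareVertices B S) :
    3 / 4 * lowerBoxDim S ≤ lowerBoxDim B :=
  ennreal_three_quarters_mul_le fun _ ht => lowerBoxDim_centres_le hSB ht.le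

theorem dimH_unitSquare : dimH unitSquare = 2 := by
  have hopen : IsOpen {p : Plane | p 0 ∈ Ioo (0 : ℝ) 1 ∧ p 1 ∈ Ioo (0 : ℝ) 1} :=
    (isOpen_Ioo.preimage (by fun_prop : Continuous fun p : Plane => p 0)).inter
      (isOpen_Ioo.preimage (by fun_prop : Continuous fun p : Plane => p 1))
  have hint : (interior unitSquare).Nonempty := by
    refine ⟨!₂[1 / 2, 1 / 2], interior_maximal ?_ hopen ?_⟩
    · rintro p ⟨h0, h1⟩
      exact ⟨Ioo_subset_Icc_self h0, Ioo_subset_Icc_self h1⟩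
    · constructor <;> constructor <;> norm_num
  rw [Real.dimH_of_nonempty_interior hint]
  simp

theorem three_halves_le_of_two_le {a b : ℝ≥0∞} (ha : 2 ≤ a) (h : 3 / 4 * a ≤ b) : 3 / 2 ≤ b := by
  refine le_trans ?_ ((mul_le_mul_right ha (3 / 4)).trans h)
  rw [← ENNReal.toReal_le_toReal (by finiteness) (by finiteness)]
  simp [ENNReal.toReal_mul, ENNReal.toReal_div]
  norm_num

end SquareCentres

/-! ### Hausdorff dimension of products with a line, and the Hausdorff lower bound. -/

section ProductWithLine

open MeasureTheory

theorem ediam_prod_le {X Y : Type*} [PseudoEMetricSpace X] [PseudoEMetricSpace Y] {s : Set X}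
    {t : Set Y} {d : ℝ≥0∞} (hs : Metric.ediam s ≤ d) (ht : Metric.ediam t ≤ d) :
    Metric.ediam (s ×ˢ t) ≤ d :=
  Metric.ediam_le fun _ hx _ hy => by
    rw [Prod.edist_eq]
    exact max_le ((Metric.edist_le_ediam_of_mem hx.1 hy.1).trans hs)
      ((Metric.edist_le_ediam_of_mem hx.2 hy.2).trans ht)

/-- A null set for `μH[t]` has covers by small sets of finite total `t`-content, indexed so that
each set comes with a positive bound for its diameter. -/
theorem exists_cover_of_hausdorffMeasure_eq_zero {X : Type*} [MetricSpace X] [MeasurableSpace X]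
    [BorelSpace X] {U : Set X} {t : ℝ} (ht : 0 < t) (hU : μH[t] U = 0) {r : ℝ} (hr : 0 < r) :
    ∃ (C : ℕ → Set X) (ρ : ℕ → ℝ), U ⊆ ⋃ i, C i ∧ (∀ i, 0 < ρ i ∧ ρ i ≤ r) ∧
      (∀ i, Metric.ediam (C i) ≤ ENNReal.ofReal (ρ i)) ∧
      ∑' i, ENNReal.ofReal (ρ i ^ t) ≤ 3 := by
  rw [Measure.hausdorffMeasure_apply] at hU
  simp only [ENNReal.iSup_eq_zero] at hU
  have h1 := hU (ENNReal.ofReal r) (by simpa using hr)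
  obtain ⟨C, hC, hd, hsum⟩ : ∃ C : ℕ → Set X, U ⊆ ⋃ i, C i ∧
      (∀ n, Metric.ediam (C n) ≤ ENNReal.ofReal r) ∧
      ∑' n, ⨆ _ : (C n).Nonempty, Metric.ediam (C n) ^ t < 1 := by
    have h2 : (⨅ (C : ℕ → Set X) (_ : U ⊆ ⋃ n, C n)
        (_ : ∀ n, Metric.ediam (C n) ≤ ENNReal.ofReal r),
        ∑' n, ⨆ _ : (C n).Nonempty, Metric.ediam (C n) ^ t) < 1 := by
      rw [h1]
      exact one_pos
    simp only [iInf_lt_iff] at h2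
    obtain ⟨C, hC, hd, hs⟩ := h2
    exact ⟨C, hC, hd, hs⟩
  have hterm : ∀ n, (⨆ _ : (C n).Nonempty, Metric.ediam (C n) ^ t) = Metric.ediam (C n) ^ t := by
    intro n
    rcases (C n).eq_empty_or_nonempty with h | h
    · simp [h, ht]
    · simp [h]
  simp only [hterm] at hsum
  have hfin : ∀ n, Metric.ediam (C n) ≠ ⊤ := fun n => ne_top_of_le_ne_top (by simp) (hd n)
  -- A positive lower bound for `ρ i`, since pieces may have diameter zero. It adds at most `∑ 2⁻ⁱ =
  -- 2` to a content below `1`, whence the bound `3`.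
  let e : ℕ → ℝ := fun i => min r (((1 / 2 : ℝ) ^ i) ^ (1 / t))
  have he : ∀ i, 0 < e i := fun i => lt_min hr (by positivity)
  refine ⟨C, fun i => max (Metric.ediam (C i)).toReal (e i), hC,
    fun i => ⟨lt_max_of_lt_right (he i), max_le ?_ (min_le_left _ _)⟩, fun i => ?_, ?_⟩
  · exact ENNReal.toReal_le_of_le_ofReal hr.le (hd i)
  · rw [← ENNReal.ofReal_toReal (hfin i)]
    exact ENNReal.ofReal_le_ofReal (by simp)
  · have hle : ∀ i, ENNReal.ofReal (max (Metric.ediam (C i)).toReal (e i) ^ t) ≤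
        Metric.ediam (C i) ^ t + (2⁻¹ : ℝ≥0∞) ^ i := by
      intro i
      rcases le_total (Metric.ediam (C i)).toReal (e i) with h | h
      · rw [max_eq_right h]
        refine le_trans ?_ le_add_self
        have : e i ^ t ≤ (1 / 2 : ℝ) ^ i := by
          calc e i ^ t ≤ (((1 / 2 : ℝ) ^ i) ^ (1 / t)) ^ t :=
                Real.rpow_le_rpow (he i).le (min_le_right _ _) ht.le
            _ = (1 / 2 : ℝ) ^ i := by
                rw [← Real.rpow_mul (by positivity), one_div_mul_cancel ht.ne', Real.rpow_one]
        refine (ENNReal.ofReal_le_ofReal this).trans_eq ?_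
        rw [ENNReal.ofReal_pow (by norm_num), one_div, ENNReal.ofReal_inv_of_pos (by norm_num)]
        norm_num
      · rw [max_eq_left h, ← ENNReal.ofReal_rpow_of_nonneg ENNReal.toReal_nonneg ht.le,
          ENNReal.ofReal_toReal (hfin i)]
        exact le_self_add
    calc ∑' i, ENNReal.ofReal (max (Metric.ediam (C i)).toReal (e i) ^ t)
        ≤ ∑' i, (Metric.ediam (C i) ^ t + (2⁻¹ : ℝ≥0∞) ^ i) := ENNReal.tsum_le_tsum hle
      _ = ∑' i, Metric.ediam (C i) ^ t + ∑' i, (2⁻¹ : ℝ≥0∞) ^ i := ENNReal.tsum_add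
      _ ≤ 1 + 2 := by
          refine add_le_add hsum.le ?_
          rw [ENNReal.tsum_geometric, ENNReal.one_sub_inv_two, inv_inv]
      _ = 3 := by norm_num

/-- Cut the strip over a covering set of size `ρ` into `⌈1 / ρ⌉` squares of side `ρ`. Their `(t +
1)`-content is at most `2 ρ ^ t`, so a cover of bounded `t`-content of `U` yields one of bounded `(t
+ 1)`-content of the product. -/
theorem dimH_prod_Icc_le (U : Set ℝ) (a : ℝ) :
    dimH (U ×ˢ Icc a (a + 1)) ≤ dimH U + 1 := by
  refine ENNReal.le_of_forall_pos_le_add fun ε hε hfin => ?_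
  have hUfin : dimH U ≠ ⊤ := fun h => by simp [h] at hfin
  set t : ℝ≥0 := (dimH U).toNNReal + ε with htdef
  have ht : 0 < (t : ℝ) := by
    have : 0 < t := by positivity
    exact this
  have hlt : dimH U < t := by
    rw [htdef, ENNReal.coe_add, ENNReal.coe_toNNReal hUfin]
    exact ENNReal.lt_add_right hUfin (by simpa using hε.ne')
  have hU : μH[t] U = 0 := hausdorffMeasure_of_dimH_lt hlt
  have hr : ∀ n : ℕ, (0 : ℝ) < 1 / (n + 1) := fun n => by positivity
  choose C ρ hC hρ hdiam hsum using fun n : ℕ =>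
    exists_cover_of_hausdorffMeasure_eq_zero ht hU (hr n)
  let m : ℕ → ℕ → ℕ := fun n i => ⌈1 / ρ n i⌉₊
  let T : ∀ n, (Σ i, Fin (m n i)) → Set (ℝ × ℝ) := fun n x =>
    C n x.1 ×ˢ Icc (a + x.2 * ρ n x.1) (a + (x.2 + 1) * ρ n x.1)
  have hT : ∀ n x, Metric.ediam (T n x) ≤ ENNReal.ofReal (ρ n x.1) := by
    intro n x
    refine ediam_prod_le (hdiam n x.1) ?_
    rw [Real.ediam_Icc]
    apply ENNReal.ofReal_le_ofReal
    linarith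
  have hlim : Tendsto (fun n : ℕ => ENNReal.ofReal (1 / ((n : ℝ) + 1))) atTop (𝓝 0) := by
    have := (ENNReal.continuous_ofReal.tendsto _).comp
      (tendsto_one_div_add_atTop_nhds_zero_nat (𝕜 := ℝ))
    rwa [ENNReal.ofReal_zero] at this
  have key := Measure.hausdorffMeasure_le_liminf_tsum ((t + 1 : ℝ≥0) : ℝ) (U ×ˢ Icc a (a + 1))
    (l := atTop) (fun n : ℕ => ENNReal.ofReal (1 / ((n : ℝ) + 1))) hlim T
    (Eventually.of_forall fun n x => (hT n x).trans (ENNReal.ofReal_le_ofReal (hρ n x.1).2))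
    (Eventually.of_forall fun n => by
      rintro ⟨x, y⟩ ⟨hx, hy⟩
      obtain ⟨i, hi⟩ := mem_iUnion.1 (hC n hx)
      have hρ0 := (hρ n i).1
      have hmpos : 0 < m n i := Nat.ceil_pos.2 (by positivity)
      have hm1 : 1 ≤ m n i * ρ n i := by
        have := Nat.le_ceil (1 / ρ n i)
        rwa [div_le_iff₀ hρ0] at this
      have hz0 : 0 ≤ (y - a) / ρ n i := div_nonneg (by linarith [hy.1]) hρ0.le
      by_cases hlast : ⌊(y - a) / ρ n i⌋₊ < m n i
      · refine mem_iUnion.2 ⟨⟨i, ⟨_, hlast⟩⟩, hi, ?_, ?_⟩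
        · have := Nat.floor_le hz0
          rw [le_div_iff₀ hρ0] at this
          simp only
          linarith
        · have := (Nat.lt_floor_add_one ((y - a) / ρ n i)).le
          rw [div_le_iff₀ hρ0] at this
          simp only
          linarith
      -- The floor can exceed the last index when `y` is the right endpoint; the last square still
      -- contains the point because `m n i * ρ n i ≥ 1`.
      · refine mem_iUnion.2 ⟨⟨i, ⟨m n i - 1, by omega⟩⟩, hi, ?_, ?_⟩
        · have h1 : ((m n i - 1 : ℕ) : ℝ) ≤ (y - a) / ρ n i := by
            refine le_trans ?_ (Nat.floor_le hz0)
            exact_mod_cast (show m n i - 1 ≤ ⌊(y - a) / ρ n i⌋₊ by omega)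
          rw [le_div_iff₀ hρ0] at h1
          simp only
          linarith
        · have h1 : ((m n i - 1 : ℕ) : ℝ) + 1 = m n i := by
            exact_mod_cast (show m n i - 1 + 1 = m n i by omega)
          simp only
          rw [h1]
          linarith [hy.2])
  have hbound : ∀ n, ∑' x, Metric.ediam (T n x) ^ ((t + 1 : ℝ≥0) : ℝ) ≤ 6 := by
    intro n
    rw [ENNReal.tsum_sigma']
    calc ∑' i, ∑' j : Fin (m n i), Metric.ediam (T n ⟨i, j⟩) ^ ((t + 1 : ℝ≥0) : ℝ)
        ≤ ∑' i, ∑' j : Fin (m n i), ENNReal.ofReal (ρ n i) ^ ((t + 1 : ℝ≥0) : ℝ) :=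
          ENNReal.tsum_le_tsum fun i => ENNReal.tsum_le_tsum fun j =>
            ENNReal.rpow_le_rpow (hT n ⟨i, j⟩) (NNReal.coe_nonneg _)
      _ ≤ ∑' i, 2 * ENNReal.ofReal (ρ n i ^ (t : ℝ)) := by
          refine ENNReal.tsum_le_tsum fun i => ?_
          have hρ0 := (hρ n i).1
          have hρ1 : ρ n i ≤ 1 := (hρ n i).2.trans (by
            rw [div_le_one (by positivity)]
            linarith [Nat.cast_nonneg (α := ℝ) n])
          rw [tsum_fintype, Finset.sum_const, Finset.card_univ, Fintype.card_fin, nsmul_eq_mul,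
            ENNReal.ofReal_rpow_of_pos hρ0, ← ENNReal.ofReal_natCast,
            ← ENNReal.ofReal_mul (Nat.cast_nonneg _), ← ENNReal.ofReal_ofNat,
            ← ENNReal.ofReal_mul (by norm_num)]
          apply ENNReal.ofReal_le_ofReal
          have hm : (m n i : ℝ) * ρ n i ≤ 2 := by
            have := (Nat.ceil_lt_add_one (by positivity : 0 ≤ 1 / ρ n i)).le
            have h2 := mul_le_mul_of_nonneg_right this hρ0.le
            rw [add_mul, one_div_mul_cancel hρ0.ne'] at h2
            change (m n i : ℝ) * ρ n i ≤ _ at h2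
            linarith
          rw [NNReal.coe_add, NNReal.coe_one, Real.rpow_add_one hρ0.ne']
          nlinarith [Real.rpow_pos_of_pos hρ0 (t : ℝ)]
      _ = 2 * ∑' i, ENNReal.ofReal (ρ n i ^ (t : ℝ)) := ENNReal.tsum_mul_left
      _ ≤ 2 * 3 := mul_le_mul_right (hsum n) 2
      _ = 6 := by norm_num
  have hne : μH[((t + 1 : ℝ≥0) : ℝ)] (U ×ˢ Icc a (a + 1)) ≠ ⊤ := by
    refine ne_top_of_le_ne_top (b := 6) (by simp) (key.trans ?_)
    exact liminf_le_of_frequently_le' (Frequently.of_forall hbound)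
  refine (dimH_le_of_hausdorffMeasure_ne_top hne).trans_eq ?_
  rw [htdef, ENNReal.coe_add, ENNReal.coe_add, ENNReal.coe_toNNReal hUfin, ENNReal.coe_one]
  ring

theorem dimH_prod_univ_le (U : Set ℝ) : dimH (U ×ˢ (univ : Set ℝ)) ≤ dimH U + 1 := by
  have hsub : U ×ˢ (univ : Set ℝ) ⊆ ⋃ n : ℤ, U ×ˢ Icc (n : ℝ) (n + 1) := by
    rintro ⟨x, y⟩ ⟨hx, _⟩
    exact mem_iUnion.2 ⟨⌊y⌋, hx, Int.floor_le y, (Int.lt_floor_add_one y).le⟩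
  refine (dimH_mono hsub).trans ?_
  rw [dimH_iUnion]
  exact iSup_le fun n => dimH_prod_Icc_le U n

theorem dist_le_mul_dist_of_apply {p q : Plane} {d : ℝ} (hd : 0 ≤ d) (h0 : |p 0 - q 0| ≤ d)
    (h1 : |p 1 - q 1| ≤ d) : dist p q ≤ 2 * d := by
  apply dist_le_of_sq_add_sq_le (by positivity)
  nlinarith [sq_abs (p 0 - q 0), sq_abs (p 1 - q 1), abs_nonneg (p 0 - q 0),
    abs_nonneg (p 1 - q 1)]

/-- A union of parallel lines through a set `B` exceeds `B` in dimension by at most one. -/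
theorem dimH_diagonal_lines_le (B : Set Plane) {σ : ℝ} (hσ : |σ| = 1) :
    dimH {p : Plane | ∃ b ∈ B, p 0 + σ * p 1 = b 0 + σ * b 1} ≤ dimH B + 1 := by
  have hσ2 : σ * σ = 1 := by rw [← abs_mul_abs_self, hσ, one_mul]
  let π : Plane → ℝ := fun p => p 0 + σ * p 1
  -- `φ (c, y)` is the point at height `y` on the line `π = c`, so the union of lines is the image
  -- of a product.
  let φ : ℝ × ℝ → Plane := fun x => !₂[x.1 - σ * x.2, x.2]
  have hπ : LipschitzWith 2 π := by
    refine LipschitzWith.of_dist_le_mul fun p q => ?_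
    have h0 := abs_sub_apply_le_dist p q 0
    have h1 := abs_sub_apply_le_dist p q 1
    rw [Real.dist_eq, show π p - π q = (p 0 - q 0) + σ * (p 1 - q 1) by simp only [π]; ring]
    refine (abs_add_le _ _).trans ?_
    rw [abs_mul, hσ, one_mul]
    push_cast
    linarith
  have hφ : LipschitzWith 4 φ := by
    refine LipschitzWith.of_dist_le_mul fun x y => ?_
    have h0 : |x.1 - y.1| ≤ dist x y := by rw [Prod.dist_eq]; exact le_max_left _ _
    have h1 : |x.2 - y.2| ≤ dist x y := by rw [Prod.dist_eq]; exact le_max_right _ _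
    refine (dist_le_mul_dist_of_apply (d := 2 * dist x y) (by positivity) ?_ ?_).trans_eq ?_
    · simp only [φ, Matrix.cons_val_zero]
      rw [show x.1 - σ * x.2 - (y.1 - σ * y.2) = (x.1 - y.1) + -(σ * (x.2 - y.2)) by ring]
      refine (abs_add_le _ _).trans ?_
      rw [abs_neg, abs_mul, hσ]
      linarith
    · simp only [φ, Matrix.cons_val_one]
      change |x.2 - y.2| ≤ _
      linarith [abs_nonneg (x.2 - y.2)]
    · push_cast
      ring
  have hsub : {p : Plane | ∃ b ∈ B, p 0 + σ * p 1 = b 0 + σ * b 1} ⊆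
      φ '' ((π '' B) ×ˢ univ) := by
    rintro p ⟨b, hb, hpb⟩
    refine ⟨(π b, p 1), ⟨⟨b, hb, rfl⟩, trivial⟩, ?_⟩
    ext i
    fin_cases i
    · simp only [φ, π, ← hpb]
      simp
    · simp [φ]
  calc dimH {p : Plane | ∃ b ∈ B, p 0 + σ * p 1 = b 0 + σ * b 1}
      ≤ dimH (φ '' ((π '' B) ×ˢ univ)) := dimH_mono hsub
    _ ≤ dimH ((π '' B) ×ˢ (univ : Set ℝ)) := hφ.dimH_image_le _
    _ ≤ dimH (π '' B) + 1 := dimH_prod_univ_le _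
    _ ≤ dimH B + 1 := add_le_add_left (hπ.dimH_image_le B) 1

/-- The vertices on the main diagonal share `x - y` with the centre, the other two share `x + y`;
hence two families of parallel lines through `B` contain `S`. -/
theorem dimH_centres_le {S B : Set Plane} (h : ContainsSomeSquareVertex B S) :
    dimH S ≤ dimH B + 1 := by
  have hsub : S ⊆ {p : Plane | ∃ b ∈ B, p 0 + 1 * p 1 = b 0 + 1 * b 1} ∪
      {p : Plane | ∃ b ∈ B, p 0 + (-1) * p 1 = b 0 + (-1) * b 1} := by
    intro p hp
    obtain ⟨r, _, v, hv, hvB⟩ := h p hp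
    rcases hv with rfl | rfl | rfl | rfl
    · exact Or.inr ⟨_, hvB, by simp; ring⟩
    · exact Or.inl ⟨_, hvB, by simp⟩
    · exact Or.inl ⟨_, hvB, by simp⟩
    · exact Or.inr ⟨_, hvB, by simp⟩
  refine (dimH_mono hsub).trans ?_
  rw [dimH_union]
  exact max_le (dimH_diagonal_lines_le B (by simp)) (dimH_diagonal_lines_le B (by simp))

theorem ContainsSquareVertices.containsSome {S B : Set Plane} (h : ContainsSquareVertices B S) :
    ContainsSomeSquareVertex B S := by
  intro p hp
  obtain ⟨r, hr, hsub⟩ := h p hp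
  exact ⟨r, hr, !₂[p 0 - r, p 1 - r], by simp [squareVertices],
    hsub (by simp [squareVertices])⟩

end ProductWithLine

/-! ### Mixed radix digit sums and greedy expansions. -/

section MixedRadix

/-- The `k`-th denominator `3 · 4 ⋯ (k + 2)` of the mixed radix system with radices `k + 3`. -/
noncomputable def radixProd (k : ℕ) : ℝ := ∏ j ∈ Finset.range k, ((j : ℝ) + 3)

theorem radixProd_zero : radixProd 0 = 1 := by simp [radixProd]

theorem radixProd_succ (k : ℕ) : radixProd (k + 1) = radixProd k * (k + 3) :=
  Finset.prod_range_succ _ _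

theorem radixProd_pos (k : ℕ) : 0 < radixProd k := Finset.prod_pos fun _ _ => by positivity

theorem radixProd_mul_pow_le (k i : ℕ) : radixProd k * 3 ^ i ≤ radixProd (k + i) := by
  induction i with
  | zero => simp
  | succ i ih =>
    rw [← add_assoc, radixProd_succ, pow_succ, ← mul_assoc]
    have h3 : (3 : ℝ) ≤ ((k + i : ℕ) : ℝ) + 3 := by linarith [Nat.cast_nonneg (α := ℝ) (k + i)]
    exact mul_le_mul ih h3 (by norm_num) (radixProd_pos _).le

theorem pow_le_radixProd (k : ℕ) : (3 : ℝ) ^ k ≤ radixProd k := by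
  simpa [radixProd_zero] using radixProd_mul_pow_le 0 k

theorem tendsto_radixProd_atTop : Tendsto radixProd atTop atTop :=
  tendsto_atTop_mono pow_le_radixProd (tendsto_pow_atTop_atTop_of_one_lt (by norm_num))

theorem factorial_le_radixProd (k : ℕ) : (k.factorial : ℝ) ≤ radixProd k := by
  induction k with
  | zero => simp [radixProd_zero]
  | succ k ih =>
    rw [radixProd_succ, Nat.factorial_succ]
    push_cast
    nlinarith [radixProd_pos k, Nat.cast_nonneg (α := ℝ) k]

/-- Exponential factors are negligible against powers of `radixProd`. -/
theorem exists_pow_le_radixProd_rpow {C ε : ℝ} (hC : 0 < C) (hε : 0 < ε) :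
    ∃ K : ℝ, 0 < K ∧ ∀ k : ℕ, C ^ k ≤ K * radixProd k ^ ε := by
  -- `Dᵏ / k! ≤ exp D`, and `radixProd k` dominates `k!`; raising to the power `ε` turns `Dᵏ` back
  -- into `Cᵏ`.
  set D := C ^ (1 / ε) with hD
  have hD0 : 0 < D := Real.rpow_pos_of_pos hC _
  refine ⟨Real.exp D ^ ε, Real.rpow_pos_of_pos (Real.exp_pos _) _, fun k => ?_⟩
  have h1 : D ^ k ≤ Real.exp D * radixProd k := by
    have := Real.pow_div_factorial_le_exp D hD0.le k
    rw [div_le_iff₀ (by positivity)] at this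
    exact this.trans (mul_le_mul_of_nonneg_left (factorial_le_radixProd k) (Real.exp_pos _).le)
  calc C ^ k = (D ^ k) ^ ε := by
        rw [hD, ← Real.rpow_natCast, ← Real.rpow_natCast, ← Real.rpow_mul hC.le,
          ← Real.rpow_mul hC.le]
        congr 1
        field_simp
    _ ≤ (Real.exp D * radixProd k) ^ ε := Real.rpow_le_rpow (by positivity) h1 hε.le
    _ = _ := Real.mul_rpow (Real.exp_pos _).le (radixProd_pos k).le

theorem exists_pow_mul_radixProd_rpow_le {C a b : ℝ} (hC : 0 < C) (hab : a < b) :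
    ∃ K : ℝ, 0 < K ∧ ∀ k : ℕ, C ^ k * radixProd k ^ a ≤ K * radixProd k ^ b := by
  obtain ⟨K, hK, h⟩ := exists_pow_le_radixProd_rpow hC (sub_pos.2 hab)
  refine ⟨K, hK, fun k => ?_⟩
  calc C ^ k * radixProd k ^ a ≤ K * radixProd k ^ (b - a) * radixProd k ^ a :=
        mul_le_mul_of_nonneg_right (h k) (Real.rpow_nonneg (radixProd_pos k).le _)
    _ = K * radixProd k ^ b := by
        rw [mul_assoc, ← Real.rpow_add (radixProd_pos k), sub_add_cancel]

/-- Consecutive scales differ by the factor `k + 3 ≤ 3 · 2ᵏ`, which is at most exponential and hence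
negligible. This permits passing from the scales `1 / radixProd k` to all scales. -/
theorem exists_radixProd_succ_rpow_le {a b : ℝ} (ha : 0 ≤ a) (hab : a < b) :
    ∃ K : ℝ, 0 < K ∧ ∀ k : ℕ, radixProd (k + 1) ^ a ≤ K * radixProd k ^ b := by
  obtain ⟨K, hK, h⟩ := exists_pow_mul_radixProd_rpow_le (C := 2 ^ a)
    (Real.rpow_pos_of_pos (by norm_num) _) hab
  refine ⟨3 ^ a * K, by positivity, fun k => ?_⟩
  have hk : ((k : ℝ) + 3) ≤ 3 * 2 ^ k := by
    have : k + 1 ≤ 2 ^ k := Nat.lt_two_pow_self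
    have h2 : (k : ℝ) + 1 ≤ 2 ^ k := by exact_mod_cast this
    have h3 : (1 : ℝ) ≤ 2 ^ k := one_le_pow₀ (by norm_num)
    linarith
  calc radixProd (k + 1) ^ a = radixProd k ^ a * ((k : ℝ) + 3) ^ a := by
        rw [radixProd_succ, Real.mul_rpow (radixProd_pos k).le (by positivity)]
    _ ≤ radixProd k ^ a * (3 * 2 ^ k) ^ a :=
        mul_le_mul_of_nonneg_left (Real.rpow_le_rpow (by positivity) hk ha)
          (Real.rpow_nonneg (radixProd_pos k).le _)
    _ = 3 ^ a * ((2 ^ a) ^ k * radixProd k ^ a) := by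
        rw [Real.mul_rpow (by norm_num) (by positivity), ← Real.rpow_natCast, ← Real.rpow_natCast,
          ← Real.rpow_mul (by norm_num), ← Real.rpow_mul (by norm_num), mul_comm (k : ℝ) a]
        ring
    _ ≤ 3 ^ a * (K * radixProd k ^ b) := mul_le_mul_of_nonneg_left (h k) (by positivity)
    _ = _ := by ring

/-- The real number with mixed radix digits `z k`, which may be arbitrary reals. -/
noncomputable def digitSum (z : ℕ → ℝ) : ℝ := ∑' k, z k / radixProd (k + 1)

/-- All radices are at least `3`, so digits bounded by `L` times the radix give a tail dominated by
a geometric series of ratio `1/3`. -/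
theorem abs_digit_div_le {x L : ℝ} {k i : ℕ} (hx : |x| ≤ L * ((i + k : ℕ) + 3)) :
    |x / radixProd (i + k + 1)| ≤ L / radixProd k * (1 / 3) ^ i := by
  have hL : 0 ≤ L := by
    by_contra hneg
    have : L * ((i + k : ℕ) + 3) < 0 := mul_neg_of_neg_of_pos (not_le.1 hneg) (by positivity)
    linarith [abs_nonneg x]
  have hp := radixProd_pos k
  rw [abs_div, abs_of_pos (radixProd_pos _), radixProd_succ]
  calc |x| / (radixProd (i + k) * ((i + k : ℕ) + 3))
      ≤ L * ((i + k : ℕ) + 3) / (radixProd (i + k) * ((i + k : ℕ) + 3)) :=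
        div_le_div_of_nonneg_right hx (mul_nonneg (radixProd_pos _).le (by positivity))
    _ = L / radixProd (i + k) := by
        rw [mul_div_mul_right]
        positivity
    _ ≤ L / (radixProd k * 3 ^ i) :=
        div_le_div_of_nonneg_left hL (by positivity)
          (by rw [add_comm i k]; exact radixProd_mul_pow_le k i)
    _ = L / radixProd k * (1 / 3) ^ i := by
        rw [one_div, inv_pow, ← div_eq_mul_inv, div_div]

theorem summable_digit {z : ℕ → ℝ} {L : ℝ} (hz : ∀ j : ℕ, |z j| ≤ L * (j + 3)) :
    Summable fun k => z k / radixProd (k + 1) := by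
  refine Summable.of_norm_bounded (g := fun i : ℕ => L / radixProd 0 * (1 / 3) ^ i)
    ((summable_geometric_of_lt_one (by norm_num) (by norm_num)).mul_left _) fun i => ?_
  rw [Real.norm_eq_abs]
  exact abs_digit_div_le (k := 0) (hz i)

theorem abs_digitSum_le {z : ℕ → ℝ} {L : ℝ} (hz : ∀ j : ℕ, |z j| ≤ L * (j + 3)) {k : ℕ}
    (h0 : ∀ j < k, z j = 0) : |digitSum z| ≤ 3 / 2 * (L / radixProd k) := by
  have hs := summable_digit hz
  rw [digitSum, ← hs.sum_add_tsum_nat_add k, Finset.sum_eq_zero, zero_add, ← Real.norm_eq_abs]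
  · have hg : HasSum (fun i : ℕ => L / radixProd k * (1 / 3 : ℝ) ^ i) (3 / 2 * (L / radixProd k)) := by
      have := (hasSum_geometric_of_lt_one (r := (1 / 3 : ℝ)) (by norm_num)
        (by norm_num)).mul_left (L / radixProd k)
      rwa [show (1 - 1 / 3 : ℝ)⁻¹ = 3 / 2 by norm_num, mul_comm _ (3 / 2 : ℝ)] at this
    refine tsum_of_norm_bounded hg fun i => ?_
    rw [Real.norm_eq_abs]
    exact abs_digit_div_le (hz (i + k))
  · intro j hj
    rw [h0 j (Finset.mem_range.1 hj), zero_div]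

theorem digitSum_add {z z' : ℕ → ℝ} {L L' : ℝ} (hz : ∀ j : ℕ, |z j| ≤ L * (j + 3))
    (hz' : ∀ j : ℕ, |z' j| ≤ L' * (j + 3)) :
    digitSum (fun k => z k + z' k) = digitSum z + digitSum z' := by
  simp only [digitSum, add_div]
  exact (summable_digit hz).tsum_add (summable_digit hz')

theorem digitSum_sub {z z' : ℕ → ℝ} {L L' : ℝ} (hz : ∀ j : ℕ, |z j| ≤ L * (j + 3))
    (hz' : ∀ j : ℕ, |z' j| ≤ L' * (j + 3)) :
    digitSum (fun k => z k - z' k) = digitSum z - digitSum z' := by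
  simp only [digitSum, sub_div]
  exact (summable_digit hz).tsum_sub (summable_digit hz')

theorem abs_digitSum_sub_le {z z' : ℕ → ℝ} {L : ℝ} (hz : ∀ j : ℕ, |z j| ≤ L * (j + 3))
    (hz' : ∀ j : ℕ, |z' j| ≤ L * (j + 3)) {k : ℕ} (h : ∀ j < k, z j = z' j) :
    |digitSum z - digitSum z'| ≤ 3 * L / radixProd k := by
  rw [← digitSum_sub hz hz']
  refine (abs_digitSum_le (L := 2 * L) (fun j => ?_) fun j hj => sub_eq_zero.2 (h j hj)).trans_eq ?_
  · refine (abs_sub _ _).trans ?_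
    linarith [hz j, hz' j]
  · ring

/-- Digit sequences with small digits are separated according to their first disagreement. -/
theorem le_abs_digitSum_sub {u v : ℕ → ℕ} (hu : ∀ k : ℕ, (u k : ℝ) ≤ 1 / 2 * (k + 3))
    (hv : ∀ k : ℕ, (v k : ℝ) ≤ 1 / 2 * (k + 3)) {k : ℕ} (h : ∀ j < k, u j = v j)
    (hk : u k ≠ v k) :
    1 / 4 / radixProd (k + 1) ≤ |digitSum (fun j => u j) - digitSum (fun j => v j)| := by
  have hu' : ∀ j : ℕ, |(u j : ℝ)| ≤ 1 / 2 * (j + 3) := fun j => by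
    rw [abs_of_nonneg (Nat.cast_nonneg _)]
    exact hu j
  have hv' : ∀ j : ℕ, |(v j : ℝ)| ≤ 1 / 2 * (j + 3) := fun j => by
    rw [abs_of_nonneg (Nat.cast_nonneg _)]
    exact hv j
  let d : ℕ → ℝ := fun j => (u j : ℝ) - v j
  have hd : ∀ j : ℕ, |d j| ≤ 1 / 2 * (j + 3) := fun j => by
    have h1 := hu j
    have h2 := hv j
    have h3 := Nat.cast_nonneg (α := ℝ) (u j)
    have h4 := Nat.cast_nonneg (α := ℝ) (v j)
    rw [abs_le]
    constructor <;> simp only [d] <;> linarith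
  -- Split the difference into its first nonzero term, at least `1 / radixProd (k + 1)`, and a tail
  -- of at most `3/4` of that; a quarter remains.
  let e : ℕ → ℝ := fun j => if j = k then d k else 0
  let f : ℕ → ℝ := fun j => if j ≤ k then 0 else d j
  have he : ∀ j : ℕ, |e j| ≤ 1 / 2 * (j + 3) := fun j => by
    simp only [e]
    split_ifs with hj
    · exact hj ▸ hd j
    · rw [abs_zero]; positivity
  have hf : ∀ j : ℕ, |f j| ≤ 1 / 2 * (j + 3) := fun j => by
    simp only [f]
    split_ifs with hj
    · rw [abs_zero]; positivity
    · exact hd j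
  have hsplit : d = fun j => e j + f j := by
    ext j
    simp only [e, f]
    rcases lt_trichotomy j k with hj | hj | hj
    · simp [hj.ne, hj.le, d, h j hj]
    · simp [hj]
    · simp [hj.ne', hj.not_ge]
  have hes : digitSum e = d k / radixProd (k + 1) := by
    rw [digitSum, tsum_eq_single k (fun j hj => by simp [e, hj])]
    simp [e]
  have hfs : |digitSum f| ≤ 3 / 2 * (1 / 2 / radixProd (k + 1)) :=
    abs_digitSum_le hf fun j hj => by simp [f, Nat.lt_succ_iff.1 hj]
  have hd1 : 1 ≤ |d k| := by
    have h1 : (1 : ℤ) ≤ |(u k : ℤ) - v k| := Int.one_le_abs (sub_ne_zero.2 (by exact_mod_cast hk))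
    have h2 : ((1 : ℤ) : ℝ) ≤ ((|(u k : ℤ) - v k| : ℤ) : ℝ) := by exact_mod_cast h1
    rw [Int.cast_abs] at h2
    push_cast at h2
    exact h2
  have hp := radixProd_pos (k + 1)
  have hes' : 1 / radixProd (k + 1) ≤ |digitSum e| := by
    rw [hes, abs_div, abs_of_pos hp]
    exact div_le_div_of_nonneg_right hd1 hp.le
  rw [← digitSum_sub hu' hv', show (fun j => (u j : ℝ) - v j) = d from rfl, hsplit,
    digitSum_add he hf]
  have h1 := abs_sub_abs_le_abs_sub (digitSum e) (-digitSum f)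
  rw [abs_neg, sub_neg_eq_add] at h1
  have h2 : 3 / 2 * (1 / 2 / radixProd (k + 1)) = 3 / 4 * (1 / radixProd (k + 1)) := by ring
  have h3 : 1 / 4 / radixProd (k + 1) = 1 / 4 * (1 / radixProd (k + 1)) := by ring
  linarith

/-- The remainders of the greedy expansion of `v` with radices `N k`. -/
noncomputable def greedyRem (N : ℕ → ℕ) (v : ℝ) : ℕ → ℝ
  | 0 => v
  | k + 1 => N k * greedyRem N v k - (min ⌊N k * greedyRem N v k⌋₊ (N k - 1) : ℕ)

/-- The digits of the greedy expansion of `v` with radices `N k`. -/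
noncomputable def greedyDigit (N : ℕ → ℕ) (v : ℝ) (k : ℕ) : ℕ :=
  -- For `v ∈ [0,1]` the cap acts only when the remainder is `1`; it then keeps the digit admissible
  -- and the next remainder equal to `1`.
  min ⌊N k * greedyRem N v k⌋₊ (N k - 1)

theorem greedyRem_succ (N : ℕ → ℕ) (v : ℝ) (k : ℕ) :
    greedyRem N v (k + 1) = N k * greedyRem N v k - greedyDigit N v k := rfl

theorem greedyDigit_lt {N : ℕ → ℕ} (hN : ∀ k, 1 ≤ N k) (v : ℝ) (k : ℕ) :
    greedyDigit N v k < N k :=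
  (min_le_right _ _).trans_lt (Nat.sub_lt (hN k) one_pos)

theorem greedyRem_mem {N : ℕ → ℕ} (hN : ∀ k, 1 ≤ N k) {v : ℝ} (hv : v ∈ Icc (0 : ℝ) 1) (k : ℕ) :
    greedyRem N v k ∈ Icc (0 : ℝ) 1 := by
  induction k with
  | zero => exact hv
  | succ k ih =>
    have h0 : 0 ≤ N k * greedyRem N v k := mul_nonneg (Nat.cast_nonneg _) ih.1
    have h1 : N k * greedyRem N v k ≤ N k := mul_le_of_le_one_right (Nat.cast_nonneg _) ih.2
    rw [greedyRem_succ]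
    constructor
    · have : (greedyDigit N v k : ℝ) ≤ ⌊N k * greedyRem N v k⌋₊ := by
        exact_mod_cast min_le_left _ _
      linarith [Nat.floor_le h0]
    · rw [greedyDigit]
      rcases min_cases ⌊N k * greedyRem N v k⌋₊ (N k - 1) with h | h
      · rw [h.1]
        linarith [Nat.lt_floor_add_one (N k * greedyRem N v k)]
      · rw [h.1, Nat.cast_sub (hN k)]
        push_cast
        linarith

/-- Equal digits mean that the same affine map of slope `N j` is applied to both remainders at each
step. -/
theorem greedyRem_sub_of_digits_eq (N : ℕ → ℕ) {v v' : ℝ} {k : ℕ}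
    (h : ∀ j < k, greedyDigit N v j = greedyDigit N v' j) :
    greedyRem N v k - greedyRem N v' k = (∏ j ∈ Finset.range k, (N j : ℝ)) * (v - v') := by
  induction k with
  | zero => simp [greedyRem]
  | succ k ih =>
    rw [greedyRem_succ, greedyRem_succ, h k (Nat.lt_succ_self k), Finset.prod_range_succ,
      mul_right_comm, ← ih fun j hj => h j (hj.trans (Nat.lt_succ_self k))]
    ring

theorem abs_sub_le_of_greedyDigit_eq {N : ℕ → ℕ} (hN : ∀ k, 1 ≤ N k) {v v' : ℝ}
    (hv : v ∈ Icc (0 : ℝ) 1) (hv' : v' ∈ Icc (0 : ℝ) 1) {k : ℕ}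
    (h : ∀ j < k, greedyDigit N v j = greedyDigit N v' j) :
    |v - v'| ≤ 1 / ∏ j ∈ Finset.range k, (N j : ℝ) := by
  have hP : 0 < ∏ j ∈ Finset.range k, (N j : ℝ) :=
    Finset.prod_pos fun j _ => by exact_mod_cast hN j
  have h1 := greedyRem_mem hN hv k
  have h2 := greedyRem_mem hN hv' k
  rw [le_div_iff₀ hP, mul_comm, ← abs_of_pos hP, ← abs_mul,
    ← greedyRem_sub_of_digits_eq N h, abs_le]
  constructor <;> linarith [h1.1, h1.2, h2.1, h2.2]

theorem digitSum_greedyDigit {v : ℝ} (hv : v ∈ Icc (0 : ℝ) 1) :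
    digitSum (fun k => greedyDigit (fun k => k + 3) v k) = v := by
  set N : ℕ → ℕ := fun k => k + 3
  have hN : ∀ k, 1 ≤ N k := fun k => by simp [N]
  have hfin : ∀ k, ∑ j ∈ Finset.range k, (greedyDigit N v j : ℝ) / radixProd (j + 1) =
      v - greedyRem N v k / radixProd k := by
    intro k
    induction k with
    | zero => simp [greedyRem, radixProd_zero]
    | succ k ih =>
      have h1 := (radixProd_pos k).ne'
      have h2 : ((k : ℝ) + 3) ≠ 0 := by positivity
      rw [Finset.sum_range_succ, ih, greedyRem_succ, radixProd_succ]
      simp only [N]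
      push_cast
      field_simp
      ring
  have hs : Summable fun k => (greedyDigit N v k : ℝ) / radixProd (k + 1) :=
    summable_digit (L := 1) fun j => by
      rw [abs_of_nonneg (Nat.cast_nonneg _), one_mul]
      have : (greedyDigit N v j : ℝ) ≤ N j := by exact_mod_cast (greedyDigit_lt hN v j).le
      simpa [N] using this
  refine tendsto_nhds_unique hs.hasSum.tendsto_sum_nat ?_
  simp only [hfin]
  have : Tendsto (fun k => greedyRem N v k / radixProd k) atTop (𝓝 0) := by
    refine squeeze_zero (fun k => div_nonneg (greedyRem_mem hN hv k).1 (radixProd_pos k).le)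
      (fun k => div_le_div_of_nonneg_right (greedyRem_mem hN hv k).2 (radixProd_pos k).le) ?_
    simpa only [one_div] using! tendsto_radixProd_atTop.inv_tendsto_atTop
  simpa using tendsto_const_nhds.sub this

end MixedRadix

/-! ### Dimension estimates for sets defined by digit restrictions. -/

section DigitSets

/-- The point of the plane whose coordinates have the mixed radix digits `z k`. -/
noncomputable def digitPoint (z : ℕ → ℤ × ℤ) : Plane :=
  !₂[digitSum fun k => (z k).1, digitSum fun k => (z k).2]

/-- The points with `k`-th digit pair in `Z k`. -/
def digitSet (Z : ℕ → Finset (ℤ × ℤ)) : Set Plane := {p | ∃ z, (∀ k, z k ∈ Z k) ∧ digitPoint z = p}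

/-- The `k`-th digit pairs are bounded by a multiple of the radix. -/
def BoundedDigits (L : ℝ) (Z : ℕ → Finset (ℤ × ℤ)) : Prop :=
  ∀ k, ∀ x ∈ Z k, |(x.1 : ℝ)| ≤ L * (k + 3) ∧ |(x.2 : ℝ)| ≤ L * (k + 3)

/-- The set is the image of a product of finite sets under a uniformly convergent series of
continuous terms. -/
theorem isCompact_digitSet {Z : ℕ → Finset (ℤ × ℤ)} {L : ℝ} (hZ : BoundedDigits L Z) :
    IsCompact (digitSet Z) := by
  have hpi : IsCompact (Set.univ.pi fun k => (Z k : Set (ℤ × ℤ))) :=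
    isCompact_univ_pi fun k => (Z k).finite_toSet.isCompact
  have himg : digitSet Z = digitPoint '' (Set.univ.pi fun k => (Z k : Set (ℤ × ℤ))) := by
    ext p
    simp [digitSet, Set.mem_pi]
  rw [himg]
  refine hpi.image_of_continuousOn ?_
  have hsum : Summable fun i : ℕ => L / radixProd 0 * (1 / 3 : ℝ) ^ i :=
    (summable_geometric_of_lt_one (by norm_num) (by norm_num)).mul_left _
  have hc : ∀ f : ℤ × ℤ → ℤ, (∀ k, ∀ x ∈ Z k, |(f x : ℝ)| ≤ L * (k + 3)) →
      ContinuousOn (fun z : ℕ → ℤ × ℤ => digitSum fun k => f (z k))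
        (Set.univ.pi fun k => (Z k : Set (ℤ × ℤ))) := by
    intro f hf
    refine continuousOn_tsum (fun k => ?_) hsum fun k z hz => ?_
    · have hcont : Continuous fun x : ℤ × ℤ => (f x : ℝ) / radixProd (k + 1) :=
        continuous_of_discreteTopology
      exact (hcont.comp (continuous_apply k)).continuousOn
    · rw [Real.norm_eq_abs]
      exact abs_digit_div_le (k := 0) (hf k (z k) (hz k trivial))
  have h1 := hc Prod.fst fun k x hx => (hZ k x hx).1
  have h2 := hc Prod.snd fun k x hx => (hZ k x hx).2
  have h3 : ContinuousOn (fun z i => (![digitSum fun k => ((z k).1 : ℝ),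
      digitSum fun k => ((z k).2 : ℝ)] : Fin 2 → ℝ) i)
      (Set.univ.pi fun k => (Z k : Set (ℤ × ℤ))) := by
    refine continuousOn_pi.2 fun i => ?_
    fin_cases i
    · exact h1
    · exact h2
  exact (PiLp.continuous_toLp 2 _).comp_continuousOn h3

theorem coveredBy_digitSet {Z : ℕ → Finset (ℤ × ℤ)} {L : ℝ} (hZ : BoundedDigits L Z) (k : ℕ) :
    CoveredBy (digitSet Z) (6 * L / radixProd k) (∏ j ∈ Finset.range k, ((Z j).card : ℝ)) := by
  classical
  rcases (digitSet Z).eq_empty_or_nonempty with he | ⟨p₀, hp₀⟩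
  · rw [he]
    exact ⟨∅, by simpa using Finset.prod_nonneg fun j _ => Nat.cast_nonneg _, by simp⟩
  obtain ⟨z₀, hz₀, _⟩ := hp₀
  have hL : 0 ≤ L := by
    by_contra hneg
    have h1 := (hZ 0 _ (hz₀ 0)).1
    have h2 : L * (((0 : ℕ) : ℝ) + 3) < 0 := mul_neg_of_neg_of_pos (not_le.1 hneg) (by positivity)
    linarith [abs_nonneg ((z₀ 0).1 : ℝ)]
  have hex : ∀ p ∈ digitSet Z, ∃ z, (∀ k, z k ∈ Z k) ∧ digitPoint z = p := fun p hp => hp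
  -- Expansions need not be unique, so one is fixed for each point; points with equal first `k`
  -- digits then differ by at most `3 L / radixProd k` in each coordinate.
  choose! z hz hzp using hex
  have hcard : ((Fintype.piFinset fun j : Fin k => Z j).card : ℝ) =
      ∏ j ∈ Finset.range k, ((Z j).card : ℝ) := by
    rw [Fintype.card_piFinset, Fin.prod_univ_eq_prod_range (fun j => (Z j).card) k]
    push_cast
    rfl
  rw [← hcard]
  refine CoveredBy.of_fibers _ (fun p (j : Fin k) => z p j)
    (fun p hp => Fintype.mem_piFinset.2 fun j => hz p hp j) fun p hp q hq hpq => ?_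
  have hagree : ∀ j < k, z p j = z q j := fun j hj => congrFun hpq ⟨j, hj⟩
  have h1 := abs_digitSum_sub_le (fun j => (hZ j _ (hz p hp j)).1)
    (fun j => (hZ j _ (hz q hq j)).1) (k := k) fun j hj => by rw [hagree j hj]
  have h2 := abs_digitSum_sub_le (fun j => (hZ j _ (hz p hp j)).2)
    (fun j => (hZ j _ (hz q hq j)).2) (k := k) fun j hj => by rw [hagree j hj]
  rw [← hzp p hp, ← hzp q hq]
  refine (dist_le_mul_dist_of_apply (d := 3 * L / radixProd k)
    (div_nonneg (by positivity) (radixProd_pos k).le) h1 h2).trans_eq ?_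
  ring

theorem upperBoxDim_digitSet_le {Z : ℕ → Finset (ℤ × ℤ)} {L : ℝ} (hZ : BoundedDigits L Z)
    (hL : 0 < L) {β : ℝ} (hβ : 0 ≤ β)
    (h : ∀ b > β, ∃ K : ℝ, ∀ k, ∏ j ∈ Finset.range k, ((Z j).card : ℝ) ≤ K * radixProd k ^ b) :
    upperBoxDim (digitSet Z) ≤ ENNReal.ofReal β := by
  refine upperBoxDim_le hβ fun b hb => ?_
  obtain ⟨b', hb1, hb2⟩ := exists_between hb
  obtain ⟨K, hK⟩ := h b' hb1
  obtain ⟨K', hK', hgrow⟩ := exists_radixProd_succ_rpow_le (by linarith : 0 ≤ b') hb2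
  have hKn : 0 ≤ K := by
    have := hK 0
    simp only [Finset.range_zero, Finset.prod_empty, radixProd_zero, Real.one_rpow] at this
    linarith
  refine ⟨K * K' * (6 * L) ^ b, ?_⟩
  filter_upwards [eventually_pos_lt_nhdsGT_zero (c := (6 * L).toNNReal) (by simpa using hL)]
    with δ hδ
  have hδ0 : (0 : ℝ) < δ := hδ.1
  have hδL : (δ : ℝ) < 6 * L := by
    have : (δ : ℝ) < ((6 * L).toNNReal : ℝ) := hδ.2
    rwa [Real.coe_toNNReal _ (by positivity)] at this
  -- The first such index is some `k + 1`: covers at level `k + 1` are fine enough for `δ`, while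
  -- `radixProd k ≤ 6 L / δ` controls their size.
  have hex : ∃ k, 6 * L / δ < radixProd k :=
    (tendsto_radixProd_atTop.eventually_gt_atTop _).exists
  classical
  have hspec := Nat.find_spec hex
  have hmin := fun m => Nat.find_min hex (m := m)
  obtain ⟨k, hk⟩ : ∃ k, Nat.find hex = k + 1 := by
    refine Nat.exists_eq_succ_of_ne_zero fun h0 => ?_
    rw [h0, radixProd_zero, div_lt_one hδ0] at hspec
    linarith
  rw [hk] at hspec hmin
  have hk1 : radixProd k ≤ 6 * L / δ := not_lt.1 (hmin k (Nat.lt_succ_self k))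
  refine (coveredBy_digitSet hZ (k + 1)).mono ?_ ?_
  · rw [div_lt_iff₀ hδ0] at hspec
    rw [div_le_iff₀ (radixProd_pos _)]
    linarith
  · calc ∏ j ∈ Finset.range (k + 1), ((Z j).card : ℝ) ≤ K * radixProd (k + 1) ^ b' := hK _
      _ ≤ K * (K' * radixProd k ^ b) := mul_le_mul_of_nonneg_left (hgrow k) hKn
      _ ≤ K * (K' * (6 * L / δ) ^ b) := by
          gcongr
          · exact (radixProd_pos k).le
          · linarith
      _ = K * K' * (6 * L) ^ b * (δ : ℝ) ^ (-b) := by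
          rw [Real.div_rpow (by positivity) hδ0.le, Real.rpow_neg hδ0.le]
          ring

theorem dimH_digitSet_le {Z : ℕ → Finset (ℤ × ℤ)} {L : ℝ} (hZ : BoundedDigits L Z)
    (hL : 0 < L) {β : ℝ} (hβ : 0 ≤ β) {K : ℝ}
    (h : ∃ᶠ k in atTop, ∏ j ∈ Finset.range k, ((Z j).card : ℝ) ≤ K * radixProd k ^ β) :
    dimH (digitSet Z) ≤ ENNReal.ofReal β := by
  refine dimH_le_of_frequently_coveredBy hβ (K := K * (6 * L) ^ β) ?_
  let δ : ℕ → ℝ≥0 := fun k => (6 * L / radixProd k).toNNReal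
  have hpos : ∀ k, 0 < 6 * L / radixProd k := fun k => div_pos (by positivity) (radixProd_pos k)
  have hδ : ∀ k, (δ k : ℝ) = 6 * L / radixProd k := fun k => Real.coe_toNNReal _ (hpos k).le
  have hlim : Tendsto δ atTop (𝓝[>] 0) := by
    refine tendsto_nhdsWithin_iff.2 ⟨?_, Eventually.of_forall fun k => by simpa [δ] using hpos k⟩
    have h1 : Tendsto (fun k => 6 * L / radixProd k) atTop (𝓝 0) :=
      tendsto_radixProd_atTop.const_div_atTop _
    have h2 := (continuous_real_toNNReal.tendsto 0).comp h1
    rwa [Real.toNNReal_zero] at h2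
  refine hlim.frequently (h.mono fun k hk => ?_)
  rw [hδ]
  refine (coveredBy_digitSet hZ k).mono le_rfl (hk.trans_eq ?_)
  rw [Real.rpow_neg (hpos k).le, Real.div_rpow (by positivity) (radixProd_pos k).le, inv_div,
    mul_assoc, mul_div_cancel₀]
  exact (Real.rpow_pos_of_pos (by positivity) _).ne'

/-- If the parameter `v ∈ [0,1]` depends on the point `π v` in a Hölder way, the set of these
points has dimension at least the Hölder exponent. -/
theorem le_dimH_image_of_holder {X : Type*} [MetricSpace X] (π : ℝ → X) {K r : ℝ} (hr : 0 < r)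
    (h : ∀ v ∈ Icc (0 : ℝ) 1, ∀ v' ∈ Icc (0 : ℝ) 1, |v - v'| ≤ K * dist (π v) (π v') ^ r) :
    ENNReal.ofReal r ≤ dimH (π '' Icc 0 1) := by
  let g : X → ℝ := Function.invFunOn π (Icc 0 1)
  have hg : ∀ x ∈ π '' Icc 0 1, g x ∈ Icc (0 : ℝ) 1 ∧ π (g x) = x := fun x hx =>
    ⟨Function.invFunOn_mem hx, Function.invFunOn_eq hx⟩
  -- At distance zero the Hölder bound forces equality, so `g` inverts `π`. It is `r`-Hölder and
  -- maps the image onto an interval of dimension `1`.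
  have hgπ : ∀ v ∈ Icc (0 : ℝ) 1, g (π v) = v := by
    intro v hv
    have h1 := hg (π v) ⟨v, hv, rfl⟩
    have h2 := h _ h1.1 v hv
    rw [h1.2, dist_self, Real.zero_rpow hr.ne', mul_zero] at h2
    exact sub_eq_zero.1 (abs_nonpos_iff.1 h2)
  have hhol : HolderOnWith K.toNNReal r.toNNReal g (π '' Icc 0 1) := by
    rintro _ ⟨v, hv, rfl⟩ _ ⟨v', hv', rfl⟩
    rw [hgπ v hv, hgπ v' hv', edist_dist, edist_dist, Real.dist_eq, Real.coe_toNNReal _ hr.le,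
      ENNReal.ofReal_rpow_of_nonneg dist_nonneg hr.le, ← ENNReal.ofReal_coe_nnreal,
      ← ENNReal.ofReal_mul (NNReal.coe_nonneg _)]
    exact ENNReal.ofReal_le_ofReal ((h v hv v' hv').trans (mul_le_mul_of_nonneg_right
      (Real.le_coe_toNNReal K) (Real.rpow_nonneg dist_nonneg _)))
  have h1 := hhol.dimH_image_le (Real.toNNReal_pos.2 hr)
  have himg : g '' (π '' Icc 0 1) = Icc 0 1 := by
    rw [image_image]
    ext v
    constructor
    · rintro ⟨w, hw, rfl⟩
      simpa only [hgπ w hw] using hw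
    · exact fun hv => ⟨v, hv, hgπ v hv⟩
  have hdim : dimH (Icc (0 : ℝ) 1) = 1 := by
    rw [Real.dimH_of_nonempty_interior (by rw [interior_Icc]; exact ⟨1 / 2, by norm_num⟩)]
    simp
  rw [himg, hdim, ENNReal.le_div_iff_mul_le (Or.inl (by simpa using hr)) (Or.inl (by simp)),
    one_mul] at h1
  exact h1

/-- The points of `ℝ × ℝ` whose coordinates have digits below `U k` and `W k`. -/
def digitRect (U W : ℕ → ℕ) : Set (ℝ × ℝ) :=
  {x | ∃ u w : ℕ → ℕ, (∀ k, u k < U k) ∧ (∀ k, w k < W k) ∧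
    x = (digitSum fun k => u k, digitSum fun k => w k)}

/-- Expand `v ∈ [0,1]` greedily with radices `U k * W k` and split each digit into a pair `(u, w)`.
If two parameters first disagree at digit `k`, they are within `1 / ∏ (U j * W j)`, while their
image points are at least `1 / (4 radixProd (k + 1))` apart because the digits are at most half the
radix. This is a Hölder bound of any exponent below `s`. -/
theorem le_dimH_digitRect {U W : ℕ → ℕ} (hU0 : ∀ k, 1 ≤ U k) (hW0 : ∀ k, 1 ≤ W k)
    (hU : ∀ k, U k - 1 ≤ (k + 3) / 2) (hW : ∀ k, W k - 1 ≤ (k + 3) / 2) {s : ℝ}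
    (hgrow : ∀ r < s, ∃ K : ℝ, 0 < K ∧ ∀ k,
      radixProd k ^ r ≤ K * ∏ j ∈ Finset.range k, ((U j * W j : ℕ) : ℝ)) :
    ENNReal.ofReal s ≤ dimH (digitRect U W) := by
  refine le_of_forall_lt_imp_le_of_dense fun a ha => ?_
  obtain ⟨a', ha1, ha2⟩ := exists_between ha
  have hs : 0 < s := by
    by_contra hneg
    rw [ENNReal.ofReal_of_nonpos (not_lt.1 hneg)] at ha
    simp at ha
  set r := a'.toReal with hrdef
  have ha'top : a' ≠ ⊤ := ha2.ne_top
  have hr0 : 0 < r := ENNReal.toReal_pos (bot_le.trans_lt ha1).ne' ha'top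
  have hrs : r < s := by
    rw [← ENNReal.ofReal_toReal ha'top] at ha2
    exact (ENNReal.ofReal_lt_ofReal_iff hs).1 ha2
  refine ha1.le.trans ?_
  rw [← ENNReal.ofReal_toReal ha'top, ← hrdef]
  obtain ⟨r', hr1, hr2⟩ := exists_between hrs
  obtain ⟨K, hK, hKb⟩ := hgrow r' hr2
  obtain ⟨K', hK', hKb'⟩ := exists_radixProd_succ_rpow_le hr0.le hr1
  set N : ℕ → ℕ := fun k => U k * W k with hNdef
  have hN : ∀ k, 1 ≤ N k := fun k => Nat.mul_pos (hU0 k) (hW0 k)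
  let u : ℝ → ℕ → ℕ := fun v k => greedyDigit N v k % U k
  let w : ℝ → ℕ → ℕ := fun v k => greedyDigit N v k / U k
  have hu : ∀ v k, u v k < U k := fun v k => Nat.mod_lt _ (hU0 k)
  have hw : ∀ v k, w v k < W k := fun v k =>
    Nat.div_lt_of_lt_mul (greedyDigit_lt hN v k)
  have hhalf : ∀ {a A k : ℕ}, a < A → A - 1 ≤ (k + 3) / 2 → (a : ℝ) ≤ 1 / 2 * (k + 3) := by
    intro a A k h1 h2
    have h3 : 2 * a ≤ k + 3 := by omega
    have h4 : (2 : ℝ) * a ≤ k + 3 := by exact_mod_cast h3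
    linarith
  let π : ℝ → ℝ × ℝ := fun v => (digitSum fun k => u v k, digitSum fun k => w v k)
  refine (le_dimH_image_of_holder π (K := K * K' * 4 ^ r) hr0 ?_).trans (dimH_mono ?_)
  · intro v hv v' hv'
    by_cases hall : ∀ k, greedyDigit N v k = greedyDigit N v' k
    -- Parameters with the same digits coincide, because the growth hypothesis sends the product of
    -- the radices to infinity.
    · have hz : |v - v'| ≤ 0 := by
        have hlim : Tendsto (fun k => K * (radixProd k ^ r')⁻¹) atTop (𝓝 0) := by
          have h1 := ((tendsto_rpow_atTop (hr0.trans hr1)).comp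
            tendsto_radixProd_atTop).inv_tendsto_atTop.const_mul K
          rwa [mul_zero] at h1
        refine ge_of_tendsto' hlim fun k => ?_
        refine (abs_sub_le_of_greedyDigit_eq hN hv hv' (k := k) fun j _ => hall j).trans ?_
        have hP : 0 < ∏ j ∈ Finset.range k, (N j : ℝ) :=
          Finset.prod_pos fun j _ => by exact_mod_cast hN j
        rw [div_le_iff₀ hP, mul_right_comm, ← div_eq_mul_inv,
          le_div_iff₀ (Real.rpow_pos_of_pos (radixProd_pos k) _), one_mul]
        exact hKb k
      exact hz.trans (by positivity)
    · classical
      push Not at hall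
      have hspec := Nat.find_spec hall
      have hmin : ∀ j < Nat.find hall, greedyDigit N v j = greedyDigit N v' j := fun j hj =>
        not_not.1 (Nat.find_min hall hj)
      set k := Nat.find hall
      have hdist : 1 / 4 / radixProd (k + 1) ≤ dist (π v) (π v') := by
        have hdiff : u v k ≠ u v' k ∨ w v k ≠ w v' k := by
          by_contra! hcon
          apply hspec
          rw [← Nat.mod_add_div (greedyDigit N v k) (U k),
            ← Nat.mod_add_div (greedyDigit N v' k) (U k)]
          exact congrArg₂ (fun a b => a + U k * b) hcon.1 hcon.2
        rw [Prod.dist_eq]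
        rcases hdiff with hne | hne
        · exact (le_abs_digitSum_sub (fun j => hhalf (hu v j) (hU j))
            (fun j => hhalf (hu v' j) (hU j)) (fun j hj => by simp only [u, hmin j hj]) hne).trans
            (le_max_left _ _)
        · exact (le_abs_digitSum_sub (fun j => hhalf (hw v j) (hW j))
            (fun j => hhalf (hw v' j) (hW j)) (fun j hj => by simp only [w, hmin j hj]) hne).trans
            (le_max_right _ _)
      have hP : 0 < ∏ j ∈ Finset.range k, (N j : ℝ) :=
        Finset.prod_pos fun j _ => by exact_mod_cast hN j
      have hQ := radixProd_pos (k + 1)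
      have hQr := Real.rpow_pos_of_pos hQ r
      calc |v - v'| ≤ 1 / ∏ j ∈ Finset.range k, (N j : ℝ) :=
            abs_sub_le_of_greedyDigit_eq hN hv hv' hmin
        _ ≤ K * K' / radixProd (k + 1) ^ r := by
            rw [div_le_div_iff₀ hP hQr, one_mul]
            refine (hKb' k).trans ?_
            have := mul_le_mul_of_nonneg_left (hKb k) hK'.le
            calc K' * radixProd k ^ r' ≤ _ := this
              _ = _ := by ring
        _ = K * K' * 4 ^ r * (1 / 4 / radixProd (k + 1)) ^ r := by
            rw [Real.div_rpow (by norm_num) hQ.le, Real.div_rpow (by norm_num) (by norm_num),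
              Real.one_rpow]
            field_simp
        _ ≤ K * K' * 4 ^ r * dist (π v) (π v') ^ r :=
            mul_le_mul_of_nonneg_left (Real.rpow_le_rpow (div_nonneg (by norm_num) hQ.le) hdist
              hr0.le) (by positivity)
  · rintro _ ⟨v, _, rfl⟩
    exact ⟨u v, w v, hu v, hw v, rfl⟩

end DigitSets

/-! ### Families of squares with half sides chosen digit by digit. -/

section SquareFamilies

theorem upperBoxDim_image_le {X Y : Type*} [MetricSpace X] [MetricSpace Y] {f : X → Y}
    (hf : Isometry f) {A : Set X} {t : ℝ≥0} (h : upperBoxDim A ≤ t) :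
    upperBoxDim (f '' A) ≤ t := by
  have := upperBoxDim_le (A := f '' A) (t := t) t.2 fun t' ht' => ⟨1, by
    have hlt : (t : ℝ≥0∞) < ENNReal.ofReal t' := by
      rw [← ENNReal.ofReal_coe_nnreal, ENNReal.ofReal_lt_ofReal_iff']
      exact ⟨ht', t.2.trans_lt ht'⟩
    filter_upwards [eventually_coveredBy_of_upperBoxDim_lt (h.trans_lt hlt)] with δ h1
    have h2 := h1.image (f := f) (K := 1) (fun x y => by rw [hf.dist_eq, one_mul]) zero_le_one
    simpa using h2⟩
  simpa using this

theorem upperBoxDim_mono {X : Type*} [MetricSpace X] {A B : Set X} (h : A ⊆ B) {t : ℝ≥0}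
    (hB : upperBoxDim B ≤ t) : upperBoxDim A ≤ t := by
  have := upperBoxDim_le (A := A) (t := t) t.2 fun t' ht' => ⟨1, by
    have hlt : (t : ℝ≥0∞) < ENNReal.ofReal t' := by
      rw [← ENNReal.ofReal_coe_nnreal, ENNReal.ofReal_lt_ofReal_iff']
      exact ⟨ht', t.2.trans_lt ht'⟩
    filter_upwards [eventually_coveredBy_of_upperBoxDim_lt (hB.trans_lt hlt)] with δ h1
    rw [one_mul]
    exact h1.subset h⟩
  simpa using this

/-- The digits of the vertex in direction `(a, b)` of squares with centre digits `Z k` and half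
side digits `τ k`. -/
def vertexDigits (Z : ℕ → Finset (ℤ × ℤ)) (τ : ℕ → ℤ × ℤ → ℤ) (a b : ℤ) (k : ℕ) :
    Finset (ℤ × ℤ) :=
  (Z k).image fun z => (z.1 + a * τ k z, z.2 + b * τ k z)

/-- The set of all vertices in direction `(a, b)` of the squares with centre digits `Z k` and half
side digits `τ k`, where the half sides are increased by `2 * L` to make them positive. -/
noncomputable def vertexSet (Z : ℕ → Finset (ℤ × ℤ)) (τ : ℕ → ℤ × ℤ → ℤ) (L : ℝ) (a b : ℤ) :
    Set Plane :=
  (IsometryEquiv.addRight (!₂[2 * L * a, 2 * L * b] : Plane)) '' digitSet (vertexDigits Z τ a b)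

/-- The set of all vertices of the squares with centre digits `Z k` and half side digits `τ k`. -/
noncomputable def allVertices (Z : ℕ → Finset (ℤ × ℤ)) (τ : ℕ → ℤ × ℤ → ℤ) (L : ℝ) : Set Plane :=
  (vertexSet Z τ L 1 1 ∪ vertexSet Z τ L (-1) (-1)) ∪
    (vertexSet Z τ L 1 (-1) ∪ vertexSet Z τ L (-1) 1)

variable {Z : ℕ → Finset (ℤ × ℤ)} {τ : ℕ → ℤ × ℤ → ℤ} {L : ℝ}

theorem boundedDigits_vertexDigits (hZ : BoundedDigits L Z)
    (hτ : ∀ k, ∀ z ∈ Z k, |(τ k z : ℝ)| ≤ L * (k + 3)) {a b : ℤ} (ha : |(a : ℝ)| = 1)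
    (hb : |(b : ℝ)| = 1) : BoundedDigits (2 * L) (vertexDigits Z τ a b) := by
  intro k x hx
  obtain ⟨z, hz, rfl⟩ := Finset.mem_image.1 hx
  have h1 := hZ k z hz
  have h2 := hτ k z hz
  push_cast
  constructor
  · refine (abs_add_le _ _).trans ?_
    rw [abs_mul, ha]
    linarith [h1.1]
  · refine (abs_add_le _ _).trans ?_
    rw [abs_mul, hb]
    linarith [h1.2]

theorem isCompact_vertexSet (hZ : BoundedDigits L Z)
    (hτ : ∀ k, ∀ z ∈ Z k, |(τ k z : ℝ)| ≤ L * (k + 3)) {a b : ℤ} (ha : |(a : ℝ)| = 1)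
    (hb : |(b : ℝ)| = 1) : IsCompact (vertexSet Z τ L a b) :=
  (isCompact_digitSet (boundedDigits_vertexDigits hZ hτ ha hb)).image
    (IsometryEquiv.continuous _)

theorem isCompact_allVertices (hZ : BoundedDigits L Z)
    (hτ : ∀ k, ∀ z ∈ Z k, |(τ k z : ℝ)| ≤ L * (k + 3)) : IsCompact (allVertices Z τ L) :=
  ((isCompact_vertexSet hZ hτ (by simp) (by simp)).union
    (isCompact_vertexSet hZ hτ (by simp) (by simp))).union
    ((isCompact_vertexSet hZ hτ (by simp) (by simp)).union
    (isCompact_vertexSet hZ hτ (by simp) (by simp)))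

/-- Digit sums add termwise without carries, as digits are not confined to the range of the radix;
so the digits of a vertex are those of the centre plus or minus those of the half side. -/
theorem mem_vertexSet (hZ : BoundedDigits L Z)
    (hτ : ∀ k, ∀ z ∈ Z k, |(τ k z : ℝ)| ≤ L * (k + 3)) (a b : ℤ) {z : ℕ → ℤ × ℤ}
    (hz : ∀ k, z k ∈ Z k) :
    !₂[digitPoint z 0 + a * (digitSum (fun k => τ k (z k)) + 2 * L),
      digitPoint z 1 + b * (digitSum (fun k => τ k (z k)) + 2 * L)] ∈ vertexSet Z τ L a b := by
  have hmul : ∀ c : ℤ, digitSum (fun k => (c : ℝ) * τ k (z k)) =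
      c * digitSum (fun k => τ k (z k)) := fun c => by
    simp only [digitSum, mul_div_assoc]
    exact tsum_mul_left
  have hb : ∀ c : ℤ, ∀ k : ℕ, |(c : ℝ) * τ k (z k)| ≤ |(c : ℝ)| * L * (k + 3) := fun c k => by
    rw [abs_mul, mul_assoc]
    exact mul_le_mul_of_nonneg_left (hτ k _ (hz k)) (abs_nonneg _)
  have h1 := digitSum_add (fun k => (hZ k _ (hz k)).1) (hb a)
  have h2 := digitSum_add (fun k => (hZ k _ (hz k)).2) (hb b)
  rw [hmul] at h1 h2
  refine ⟨digitPoint fun k => ((z k).1 + a * τ k (z k), (z k).2 + b * τ k (z k)),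
    ⟨_, fun k => Finset.mem_image_of_mem _ (hz k), rfl⟩, ?_⟩
  ext i
  fin_cases i
  · simp only [digitPoint, IsometryEquiv.addRight_apply]
    simp
    rw [h1]
    ring
  · simp only [digitPoint, IsometryEquiv.addRight_apply]
    simp
    rw [h2]
    ring

theorem containsSquareVertices_allVertices (hL : 0 < L) (hZ : BoundedDigits L Z)
    (hτ : ∀ k, ∀ z ∈ Z k, |(τ k z : ℝ)| ≤ L * (k + 3)) :
    ContainsSquareVertices (allVertices Z τ L) (digitSet Z) := by
  rintro _ ⟨z, hz, rfl⟩
  -- The digit sum is at least `-3/2 L`, so adding `2 L` makes the half side positive.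
  have hr := abs_le.1 (abs_digitSum_le (z := fun k => (τ k (z k) : ℝ))
    (fun k => hτ k _ (hz k)) (k := 0) (by simp))
  rw [radixProd_zero, div_one] at hr
  have hmem := fun a b => mem_vertexSet hZ hτ a b hz
  refine ⟨digitSum (fun k => τ k (z k)) + 2 * L, by linarith [hr.1], ?_⟩
  rintro v (rfl | rfl | rfl | rfl)
  · exact Or.inl (Or.inr (by simpa [sub_eq_add_neg] using hmem (-1) (-1)))
  · exact Or.inr (Or.inl (by simpa [sub_eq_add_neg] using hmem 1 (-1)))
  · exact Or.inr (Or.inr (by simpa [sub_eq_add_neg] using hmem (-1) 1))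
  · exact Or.inl (Or.inl (by simpa using hmem 1 1))

theorem upperBoxDim_allVertices_le {t : ℝ≥0}
    (h : ∀ a b : ℤ, |(a : ℝ)| = 1 → |(b : ℝ)| = 1 →
      upperBoxDim (digitSet (vertexDigits Z τ a b)) ≤ t) :
    upperBoxDim (allVertices Z τ L) ≤ t := by
  have h' : ∀ a b : ℤ, |(a : ℝ)| = 1 → |(b : ℝ)| = 1 → upperBoxDim (vertexSet Z τ L a b) ≤ t :=
    fun a b ha hb => upperBoxDim_image_le (IsometryEquiv.isometry _) (h a b ha hb)
  exact upperBoxDim_union_le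
    (upperBoxDim_union_le (h' _ _ (by simp) (by simp)) (h' _ _ (by simp) (by simp)))
    (upperBoxDim_union_le (h' _ _ (by simp) (by simp)) (h' _ _ (by simp) (by simp)))

theorem dimH_allVertices_le {t : ℝ≥0∞} (h1 : dimH (digitSet (vertexDigits Z τ 1 1)) ≤ t)
    (h2 : dimH (digitSet (vertexDigits Z τ (-1) (-1))) ≤ t)
    (h3 : dimH (digitSet (vertexDigits Z τ 1 (-1))) ≤ t)
    (h4 : dimH (digitSet (vertexDigits Z τ (-1) 1)) ≤ t) : dimH (allVertices Z τ L) ≤ t := by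
  simp only [allVertices, vertexSet, dimH_union, IsometryEquiv.dimH_image]
  exact max_le (max_le h1 h2) (max_le h3 h4)

/-- Roughly `(k + 3) ^ p` digits out of the first half of the digits in radix `k + 3`. -/
noncomputable def digitCount (p : ℝ) (k : ℕ) : ℕ := min ⌈((k : ℝ) + 3) ^ p⌉₊ ((k + 3) / 2 + 1)

theorem one_le_rpow_radix {p : ℝ} (hp : 0 ≤ p) (k : ℕ) : 1 ≤ ((k : ℝ) + 3) ^ p :=
  Real.one_le_rpow (by linarith [Nat.cast_nonneg (α := ℝ) k]) hp

theorem one_le_digitCount (p : ℝ) (k : ℕ) : 1 ≤ digitCount p k :=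
  le_min (Nat.ceil_pos.2 (Real.rpow_pos_of_pos (by positivity) _)) (by omega)

theorem digitCount_sub_one_le (p : ℝ) (k : ℕ) : digitCount p k - 1 ≤ (k + 3) / 2 := by
  have : digitCount p k ≤ (k + 3) / 2 + 1 := min_le_right _ _
  omega

theorem digitCount_le_radix (p : ℝ) (k : ℕ) : digitCount p k ≤ k + 3 := by
  have := digitCount_sub_one_le p k
  omega

theorem digitCount_le {p : ℝ} (hp : 0 ≤ p) (k : ℕ) :
    (digitCount p k : ℝ) ≤ 2 * ((k : ℝ) + 3) ^ p := by
  have h1 : (digitCount p k : ℝ) ≤ ⌈((k : ℝ) + 3) ^ p⌉₊ :=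
    Nat.cast_le.2 (min_le_left _ _)
  have h2 := Nat.ceil_lt_add_one (a := ((k : ℝ) + 3) ^ p) (by positivity)
  linarith [one_le_rpow_radix hp k]

/-- Capping at about half of the radix, needed for separation, loses only a factor `2` since `p ≤
1`. -/
theorem le_digitCount {p : ℝ} (hp : p ≤ 1) (k : ℕ) :
    ((k : ℝ) + 3) ^ p ≤ 2 * (digitCount p k : ℝ) := by
  have h0 : (0 : ℝ) < ((k : ℝ) + 3) ^ p := by positivity
  rw [digitCount]
  rcases min_cases ⌈((k : ℝ) + 3) ^ p⌉₊ ((k + 3) / 2 + 1) with h | h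
  · rw [h.1]
    linarith [Nat.le_ceil (((k : ℝ) + 3) ^ p)]
  · rw [h.1]
    have h1 : ((k : ℝ) + 3) ^ p ≤ (k : ℝ) + 3 := by
      have := Real.rpow_le_rpow_of_exponent_le
        (by linarith [Nat.cast_nonneg (α := ℝ) k] : (1 : ℝ) ≤ (k : ℝ) + 3) hp
      rwa [Real.rpow_one] at this
    have h2 : k + 3 ≤ 2 * ((k + 3) / 2 + 1) := by omega
    have h3 : (k : ℝ) + 3 ≤ 2 * (((k + 3) / 2 + 1 : ℕ) : ℝ) := by exact_mod_cast h2
    linarith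

theorem prod_const_mul_radix_rpow (c p : ℝ) (k : ℕ) :
    ∏ j ∈ Finset.range k, (c * ((j : ℝ) + 3) ^ p) = c ^ k * radixProd k ^ p := by
  rw [Finset.prod_mul_distrib, Finset.prod_const, Finset.card_range, radixProd,
    Real.finsetProd_rpow _ _ fun j _ => by positivity]

/-- A factor `c` per digit multiplies to `cᵏ`, which the gap between `β` and `b` absorbs. -/
theorem exists_prod_card_le {c β : ℝ} (hc : 0 < c)
    (h : ∀ k, ((Z k).card : ℝ) ≤ c * ((k : ℝ) + 3) ^ β) :
    ∀ b > β, ∃ K : ℝ, ∀ k, ∏ j ∈ Finset.range k, ((Z j).card : ℝ) ≤ K * radixProd k ^ b := by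
  intro b hb
  obtain ⟨K, _, hK⟩ := exists_pow_mul_radixProd_rpow_le hc hb
  refine ⟨K, fun k => le_trans ?_ (hK k)⟩
  rw [← prod_const_mul_radix_rpow]
  exact Finset.prod_le_prod (fun j _ => Nat.cast_nonneg _) fun j _ => h j

theorem exists_radixProd_rpow_le_prod {N : ℕ → ℕ} {c s : ℝ} (hc : 0 < c)
    (h : ∀ k : ℕ, ((k : ℝ) + 3) ^ s ≤ c * N k) :
    ∀ r < s, ∃ K : ℝ, 0 < K ∧ ∀ k, radixProd k ^ r ≤ K * ∏ j ∈ Finset.range k, (N j : ℝ) := by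
  intro r hr
  obtain ⟨K, hK, hKb⟩ := exists_pow_mul_radixProd_rpow_le hc hr
  refine ⟨K, hK, fun k => ?_⟩
  have h1 : radixProd k ^ s ≤ c ^ k * ∏ j ∈ Finset.range k, (N j : ℝ) := by
    have := Finset.prod_le_prod (s := Finset.range k)
      (fun j _ => Real.rpow_nonneg (by positivity : (0 : ℝ) ≤ (j : ℝ) + 3) s) fun j _ => h j
    rwa [Finset.prod_mul_distrib, Finset.prod_const, Finset.card_range,
      Real.finsetProd_rpow _ _ fun j _ => by positivity] at this
  have h2 : c ^ k * radixProd k ^ r ≤ c ^ k * (K * ∏ j ∈ Finset.range k, (N j : ℝ)) :=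
    (hKb k).trans (by
      have := mul_le_mul_of_nonneg_left h1 hK.le
      linarith)
  exact le_of_mul_le_mul_left h2 (by positivity)

theorem isCompact_unitSquare : IsCompact unitSquare := by
  have h : unitSquare = (WithLp.toLp 2) '' (Set.univ.pi fun _ : Fin 2 => Icc (0 : ℝ) 1) := by
    ext p
    constructor
    · rintro ⟨h0, h1⟩
      refine ⟨WithLp.ofLp p, fun i _ => ?_, rfl⟩
      fin_cases i
      · exact h0
      · exact h1
    · rintro ⟨f, hf, rfl⟩
      exact ⟨hf 0 trivial, hf 1 trivial⟩
  rw [h]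
  exact (isCompact_univ_pi fun _ => isCompact_Icc).image (PiLp.continuous_toLp 2 _)

theorem unitSquare_nonempty : unitSquare.Nonempty := ⟨0, by simp [unitSquare]⟩

end SquareFamilies

/-! ### Sharp examples for packing and box dimensions. -/

section BoxSharpness

/-- All pairs of digits below `N k`. -/
noncomputable def gridDigits (N : ℕ → ℕ) (k : ℕ) : Finset (ℤ × ℤ) :=
  Finset.Ico (0 : ℤ) (N k) ×ˢ Finset.Ico (0 : ℤ) (N k)

/-- Half side digits `τ` such that `d + τ` and `d - τ` both take few values when `(c, d)` ranges
over the grid: they are twice the lower and twice the upper half of `d`. -/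
def splitHalfSide (N : ℕ → ℕ) (k : ℕ) (z : ℤ × ℤ) : ℤ :=
  z.2 % (Nat.sqrt (N k) + 1 : ℕ) - (Nat.sqrt (N k) + 1 : ℕ) * (z.2 / (Nat.sqrt (N k) + 1 : ℕ))

theorem splitHalfSide_bounds {N : ℕ → ℕ} {k : ℕ} {z : ℤ × ℤ} (hz : z ∈ gridDigits N k) :
    -(N k : ℤ) < splitHalfSide N k z ∧ splitHalfSide N k z < N k ∧
      0 ≤ z.2 % (Nat.sqrt (N k) + 1 : ℕ) ∧
      z.2 % (Nat.sqrt (N k) + 1 : ℕ) < (Nat.sqrt (N k) + 1 : ℕ) ∧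
      0 ≤ z.2 / (Nat.sqrt (N k) + 1 : ℕ) ∧
      z.2 / (Nat.sqrt (N k) + 1 : ℕ) < (Nat.sqrt (N k) + 1 : ℕ) := by
  obtain ⟨_, h2⟩ := Finset.mem_product.1 hz
  obtain ⟨h0, h1⟩ := Finset.mem_Ico.1 h2
  have hn : z.2 < (Nat.sqrt (N k) + 1 : ℕ) * (Nat.sqrt (N k) + 1 : ℕ) :=
    h1.trans (by exact_mod_cast Nat.lt_succ_sqrt (N k))
  rw [splitHalfSide]
  set n : ℤ := ((Nat.sqrt (N k) + 1 : ℕ) : ℤ) with hndef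
  have hpos : 0 < n := by rw [hndef]; positivity
  have e := Int.emod_add_mul_ediv z.2 n
  have a1 := Int.emod_nonneg z.2 hpos.ne'
  have a2 := Int.emod_lt_of_pos z.2 hpos
  have b1 : 0 ≤ z.2 / n := Int.ediv_nonneg h0 hpos.le
  have b2 : z.2 / n < n := Int.ediv_lt_of_lt_mul hpos hn
  have c1 : 0 ≤ n * (z.2 / n) := mul_nonneg hpos.le b1
  exact ⟨by linarith, by linarith, a1, a2, b1, b2⟩

theorem boundedDigits_gridDigits {N : ℕ → ℕ} (hN : ∀ k, N k ≤ k + 3) :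
    BoundedDigits 1 (gridDigits N) := by
  intro k z hz
  obtain ⟨h1, h2⟩ := Finset.mem_product.1 hz
  rw [Finset.mem_Ico] at h1 h2
  have hNk : ((N k : ℤ) : ℝ) ≤ k + 3 := by exact_mod_cast hN k
  have a0 : (0 : ℝ) ≤ z.1 := by exact_mod_cast h1.1
  have a1 : (z.1 : ℝ) ≤ (N k : ℤ) := by exact_mod_cast h1.2.le
  have b0 : (0 : ℝ) ≤ z.2 := by exact_mod_cast h2.1
  have b1 : (z.2 : ℝ) ≤ (N k : ℤ) := by exact_mod_cast h2.2.le
  rw [abs_of_nonneg a0, abs_of_nonneg b0]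
  constructor <;> linarith

theorem abs_splitHalfSide_le {N : ℕ → ℕ} (hN : ∀ k, N k ≤ k + 3) (k : ℕ) (z : ℤ × ℤ)
    (hz : z ∈ gridDigits N k) : |(splitHalfSide N k z : ℝ)| ≤ 1 * (k + 3) := by
  obtain ⟨h1, h2, _⟩ := splitHalfSide_bounds hz
  have hNk : ((N k : ℤ) : ℝ) ≤ k + 3 := by exact_mod_cast hN k
  have h3 : (-((N k : ℤ) : ℝ)) < splitHalfSide N k z := by exact_mod_cast h1
  have h4 : (splitHalfSide N k z : ℝ) < (N k : ℤ) := by exact_mod_cast h2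
  rw [abs_le]
  constructor <;> linarith

/-- The second vertex coordinate is twice the lower part of `z.2`, or `2n` times its upper part, so
it takes at most `n = √N + 1` values (rounded down root). The first lies in a window of `3 N`
integers. As `n ≤ 2 √N`, the product is at most `6 N ^ (3/2)`. -/
theorem card_vertexDigits_grid_le {N : ℕ → ℕ} (hN : ∀ k, 1 ≤ N k) {a b : ℤ}
    (ha : |(a : ℝ)| = 1) (hb : |(b : ℝ)| = 1) (k : ℕ) :
    ((vertexDigits (gridDigits N) (splitHalfSide N) a b k).card : ℝ) ≤
      6 * (N k : ℝ) ^ (3 / 2 : ℝ) := by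
  classical
  set n : ℕ := Nat.sqrt (N k) + 1 with hn
  have hunit : ∀ c : ℤ, |(c : ℝ)| = 1 → c = 1 ∨ c = -1 := fun c hc => by
    have : |c| = 1 := by exact_mod_cast hc
    exact (abs_eq one_pos.le).1 this
  have key : ∀ f : ℤ → ℤ, (∀ z ∈ gridDigits N k, ∃ m : ℕ, m < n ∧
      z.2 + b * splitHalfSide N k z = f m) →
      (vertexDigits (gridDigits N) (splitHalfSide N) a b k).card ≤ 3 * N k * n := by
    intro f hf
    have hsub : vertexDigits (gridDigits N) (splitHalfSide N) a b k ⊆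
        Finset.Ico (-(N k : ℤ)) (2 * N k) ×ˢ (Finset.range n).image fun m : ℕ => f m := by
      intro x hx
      obtain ⟨z, hz, rfl⟩ := Finset.mem_image.1 hx
      obtain ⟨m, hm, hfm⟩ := hf z hz
      obtain ⟨h1, h2, _⟩ := splitHalfSide_bounds hz
      obtain ⟨h3, _⟩ := Finset.mem_product.1 hz
      rw [Finset.mem_Ico] at h3
      refine Finset.mem_product.2 ⟨?_, Finset.mem_image.2 ⟨m, Finset.mem_range.2 hm, hfm.symm⟩⟩
      rw [Finset.mem_Ico]
      rcases hunit a ha with rfl | rfl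
      · constructor <;> simp only <;> linarith
      · constructor <;> simp only <;> linarith
    refine (Finset.card_le_card hsub).trans ?_
    rw [Finset.card_product, Int.card_Ico]
    refine Nat.mul_le_mul (by omega) (Finset.card_image_le.trans (by simp))
  have hle : (vertexDigits (gridDigits N) (splitHalfSide N) a b k).card ≤ 3 * N k * n := by
    rcases hunit b hb with rfl | rfl
    · refine key (fun m => 2 * m) fun z hz => ?_
      obtain ⟨_, _, h1, h2, _⟩ := splitHalfSide_bounds hz
      rw [← hn] at h1 h2
      refine ⟨(z.2 % (n : ℕ)).toNat, by omega, ?_⟩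
      have e := Int.emod_add_mul_ediv z.2 n
      rw [Int.toNat_of_nonneg h1, splitHalfSide]
      linarith
    · refine key (fun m => 2 * n * m) fun z hz => ?_
      obtain ⟨_, _, _, _, h1, h2⟩ := splitHalfSide_bounds hz
      rw [← hn] at h1 h2
      refine ⟨(z.2 / (n : ℕ)).toNat, by omega, ?_⟩
      have e := Int.emod_add_mul_ediv z.2 n
      rw [Int.toNat_of_nonneg h1, splitHalfSide]
      linarith
  have hN1 : (1 : ℝ) ≤ N k := by exact_mod_cast hN k
  have hn2 : (n : ℝ) ≤ 2 * (N k : ℝ) ^ (1 / 2 : ℝ) := by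
    rw [← Real.sqrt_eq_rpow, hn]
    push_cast
    have h1 : (Nat.sqrt (N k) : ℝ) ≤ Real.sqrt (N k) := Real.nat_sqrt_le_real_sqrt
    have h2 : 1 ≤ Real.sqrt (N k) := Real.one_le_sqrt.2 hN1
    linarith
  calc ((vertexDigits (gridDigits N) (splitHalfSide N) a b k).card : ℝ) ≤ 3 * N k * n := by
        exact_mod_cast hle
    _ ≤ 3 * N k * (2 * (N k : ℝ) ^ (1 / 2 : ℝ)) :=
        mul_le_mul_of_nonneg_left hn2 (by positivity)
    _ = 6 * ((N k : ℝ) ^ (1 : ℝ) * (N k : ℝ) ^ (1 / 2 : ℝ)) := by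
        rw [Real.rpow_one]
        ring
    _ = 6 * (N k : ℝ) ^ (3 / 2 : ℝ) := by
        rw [← Real.rpow_add (by linarith)]
        norm_num

theorem upperBoxDim_allVertices_grid_le {N : ℕ → ℕ} (hN : ∀ k, 1 ≤ N k)
    (hN' : ∀ k, N k ≤ k + 3) {s : ℝ} (hs : 0 ≤ s)
    (hNs : ∀ k : ℕ, (N k : ℝ) ≤ 2 * ((k : ℝ) + 3) ^ (s / 2)) :
    upperBoxDim (allVertices (gridDigits N) (splitHalfSide N) 1) ≤ ENNReal.ofReal (3 / 4 * s) := by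
  refine upperBoxDim_allVertices_le (t := (3 / 4 * s).toNNReal) fun a b ha hb => ?_
  refine upperBoxDim_digitSet_le (boundedDigits_vertexDigits (boundedDigits_gridDigits hN')
    (abs_splitHalfSide_le hN') ha hb) (by norm_num) (by positivity)
    (exists_prod_card_le (c := 6 * 2 ^ (3 / 2 : ℝ)) (by positivity) fun k => ?_)
  refine (card_vertexDigits_grid_le hN ha hb k).trans ?_
  have hk : (0 : ℝ) ≤ (k : ℝ) + 3 := by positivity
  calc 6 * (N k : ℝ) ^ (3 / 2 : ℝ) ≤ 6 * (2 * ((k : ℝ) + 3) ^ (s / 2)) ^ (3 / 2 : ℝ) := by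
        gcongr
        exact hNs k
    _ = 6 * 2 ^ (3 / 2 : ℝ) * ((k : ℝ) + 3) ^ (3 / 4 * s) := by
        rw [Real.mul_rpow (by norm_num) (by positivity), ← Real.rpow_mul hk]
        ring_nf

theorem upperBoxDim_grid_le {N : ℕ → ℕ} (hN' : ∀ k, N k ≤ k + 3) {s : ℝ} (hs : 0 ≤ s)
    (hNs : ∀ k : ℕ, (N k : ℝ) ≤ 2 * ((k : ℝ) + 3) ^ (s / 2)) :
    upperBoxDim (digitSet (gridDigits N)) ≤ ENNReal.ofReal s := by
  refine upperBoxDim_digitSet_le (boundedDigits_gridDigits hN') one_pos hs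
    (exists_prod_card_le (c := 4) (by norm_num) fun k => ?_)
  have h1 : ((gridDigits N k).card : ℝ) = N k * N k := by
    simp [gridDigits, Finset.card_product]
  have h2 : ((k : ℝ) + 3) ^ s = ((k : ℝ) + 3) ^ (s / 2) * ((k : ℝ) + 3) ^ (s / 2) := by
    rw [← Real.rpow_add (by positivity)]
    ring_nf
  rw [h1, h2]
  have := mul_le_mul (hNs k) (hNs k) (Nat.cast_nonneg _) (by positivity)
  linarith

theorem digitRect_subset_image_grid (N : ℕ → ℕ) :
    digitRect N N ⊆ (fun p : Plane => (p 0, p 1)) '' digitSet (gridDigits N) := by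
  rintro _ ⟨u, w, hu, hw, rfl⟩
  refine ⟨_, ⟨fun k => (u k, w k), fun k => ?_, rfl⟩, ?_⟩
  · simpa [gridDigits] using ⟨hu k, hw k⟩
  · simp [digitPoint]

theorem unitSquare_subset_grid : unitSquare ⊆ digitSet (gridDigits fun k => k + 3) := by
  rintro p ⟨h0, h1⟩
  have hN : ∀ k : ℕ, 1 ≤ k + 3 := fun k => by omega
  refine ⟨fun k => (greedyDigit (fun k => k + 3) (p 0) k, greedyDigit (fun k => k + 3) (p 1) k),
    fun k => ?_, ?_⟩
  · have e0 := greedyDigit_lt hN (p 0) k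
    have e1 := greedyDigit_lt hN (p 1) k
    simp only [gridDigits, Finset.mem_product, Finset.mem_Ico]
    omega
  · ext i
    fin_cases i
    · simpa [digitPoint] using digitSum_greedyDigit h0
    · simpa [digitPoint] using digitSum_greedyDigit h1

/-- Take about `(k + 3) ^ (s / 2)` digits per coordinate. For `s = 2` all digits are used, so the
centres include the unit square, which itself serves as `S`. -/
theorem exists_box_sharp {s : ℝ} (h0 : 0 ≤ s) (h2 : s ≤ 2) :
    ∃ S B : Set Plane, S.Nonempty ∧ IsCompact S ∧ IsCompact B ∧ ContainsSquareVertices B S ∧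
      ENNReal.ofReal s ≤ dimH S ∧ upperBoxDim S ≤ ENNReal.ofReal s ∧
      upperBoxDim B ≤ ENNReal.ofReal (3 / 4 * s) ∧ (s = 2 → S = unitSquare) := by
  rcases h2.lt_or_eq with hlt | rfl
  · have hN := one_le_digitCount (s / 2)
    have hN' := digitCount_le_radix (s / 2)
    have hNs := digitCount_le (p := s / 2) (by linarith)
    have hb := boundedDigits_gridDigits hN'
    refine ⟨digitSet (gridDigits (digitCount (s / 2))), _, ?_, isCompact_digitSet hb,
      isCompact_allVertices hb (abs_splitHalfSide_le hN'),
      containsSquareVertices_allVertices one_pos hb (abs_splitHalfSide_le hN'), ?_,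
      upperBoxDim_grid_le hN' h0 hNs, upperBoxDim_allVertices_grid_le hN hN' h0 hNs,
      fun h => absurd h hlt.ne⟩
    · refine ⟨_, fun _ => (0, 0), fun k => ?_, rfl⟩
      have := hN k
      simp only [gridDigits, Finset.mem_product, Finset.mem_Ico]
      omega
    · have hlip : LipschitzWith 1 fun p : Plane => (p 0, p 1) := by
        refine LipschitzWith.of_dist_le_mul fun p q => ?_
        rw [NNReal.coe_one, one_mul, Prod.dist_eq]
        exact max_le (abs_sub_apply_le_dist p q 0) (abs_sub_apply_le_dist p q 1)
      refine le_trans ?_ ((dimH_mono (digitRect_subset_image_grid _)).trans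
        (hlip.dimH_image_le _))
      refine le_dimH_digitRect hN hN (digitCount_sub_one_le _) (digitCount_sub_one_le _)
        (exists_radixProd_rpow_le_prod (c := 4) (by norm_num) fun k => ?_)
      have e : ((k : ℝ) + 3) ^ s = ((k : ℝ) + 3) ^ (s / 2) * ((k : ℝ) + 3) ^ (s / 2) := by
        rw [← Real.rpow_add (by positivity)]
        ring_nf
      have h1 := le_digitCount (p := s / 2) (by linarith) k
      have := mul_le_mul h1 h1 (by positivity) (by positivity)
      rw [e]
      push_cast
      linarith
  · have hN : ∀ k : ℕ, 1 ≤ k + 3 := fun k => by omega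
    have hN' : ∀ k : ℕ, k + 3 ≤ k + 3 := fun k => le_rfl
    have hNs : ∀ k : ℕ, ((k + 3 : ℕ) : ℝ) ≤ 2 * ((k : ℝ) + 3) ^ ((2 : ℝ) / 2) := fun k => by
      rw [div_self two_ne_zero, Real.rpow_one]
      push_cast
      linarith [Nat.cast_nonneg (α := ℝ) k]
    have hb := boundedDigits_gridDigits hN'
    refine ⟨unitSquare, _, unitSquare_nonempty, isCompact_unitSquare,
      isCompact_allVertices hb (abs_splitHalfSide_le hN'),
      fun p hp => containsSquareVertices_allVertices one_pos hb (abs_splitHalfSide_le hN') p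
        (unitSquare_subset_grid hp), by rw [dimH_unitSquare]; simp,
      upperBoxDim_mono (t := (2 : ℝ).toNNReal) unitSquare_subset_grid
        (upperBoxDim_grid_le hN' h0 hNs),
      upperBoxDim_allVertices_grid_le hN hN' h0 hNs, fun _ => rfl⟩

end BoxSharpness

/-! ### Sharp examples for Hausdorff dimension. -/

section HausdorffSharpness

/-- The class mod `4` of the doubly exponential block `[2 ^ 2 ^ n, 2 ^ 2 ^ (n + 1))` that
contains `k`. -/
def blockClass (k : ℕ) : ℕ := Nat.log 2 (Nat.log 2 k) % 4

theorem blockClass_eq {n k : ℕ} (h1 : 2 ^ 2 ^ n ≤ k) (h2 : k < 2 ^ 2 ^ (n + 1)) :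
    blockClass k = n % 4 := by
  have hk : k ≠ 0 := by
    have : 0 < 2 ^ 2 ^ n := by positivity
    omega
  have a1 : 2 ^ n ≤ Nat.log 2 k := Nat.le_log_of_pow_le one_lt_two h1
  have a2 : Nat.log 2 k < 2 ^ (n + 1) := Nat.log_lt_of_lt_pow hk h2
  rw [blockClass, Nat.log_eq_of_pow_le_of_lt_pow a1 a2]

/-- All choices for the first `T` digits together are only exponential in `T * T`, hence negligible
at the scale where the block `[T, T * T)` ends. -/
theorem radixProd_sq_le (T : ℕ) : radixProd T ^ (2 : ℕ) ≤ 36 ^ (T * T) := by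
  have h1 : radixProd T ≤ ((T : ℝ) + 3) ^ T := by
    rw [radixProd]
    calc ∏ j ∈ Finset.range T, ((j : ℝ) + 3) ≤ ∏ _j ∈ Finset.range T, ((T : ℝ) + 3) := by
          refine Finset.prod_le_prod (fun j _ => by positivity) fun j hj => ?_
          have : (j : ℝ) ≤ T := by exact_mod_cast (Finset.mem_range.1 hj).le
          linarith
      _ = _ := by simp
  rcases Nat.eq_zero_or_pos T with rfl | hT
  · simp [radixProd_zero]
  have h2 : (T : ℝ) + 3 ≤ 6 ^ T := by
    have e : ∀ n : ℕ, 0 < n → n + 3 ≤ 6 ^ n := fun n hn => by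
      induction n, hn using Nat.le_induction with
      | base => norm_num
      | succ m hm ih => rw [pow_succ]; omega
    exact_mod_cast e T hT
  calc radixProd T ^ (2 : ℕ) ≤ ((6 ^ T) ^ T) ^ (2 : ℕ) :=
        pow_le_pow_left₀ (radixProd_pos T).le
          (h1.trans (pow_le_pow_left₀ (by positivity) h2 T)) 2
    _ = 36 ^ (T * T) := by
        rw [show (36 : ℝ) = 6 ^ 2 by norm_num, ← pow_mul, ← pow_mul, ← pow_mul]
        congr 1
        ring

/-- Cover at the end of a block of class `i`: inside it the digit counts are good, and the trivial
bound on all earlier digits costs an exponential factor. There are infinitely many such blocks, and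
Hausdorff dimension needs no more. -/
theorem dimH_digitSet_le_of_blocks {Z : ℕ → Finset (ℤ × ℤ)} {L : ℝ} (hZ : BoundedDigits L Z)
    (hL : 0 < L) {q c : ℝ} (hq : 0 ≤ q) (hc : 0 < c) {i : ℕ} (hi : i < 4)
    (hall : ∀ k : ℕ, ((Z k).card : ℝ) ≤ c * ((k : ℝ) + 3) ^ q * ((k : ℝ) + 3) ^ (2 : ℕ))
    (hcls : ∀ k : ℕ, blockClass k = i → ((Z k).card : ℝ) ≤ c * ((k : ℝ) + 3) ^ q) :
    dimH (digitSet Z) ≤ ENNReal.ofReal q := by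
  refine ENNReal.le_of_forall_pos_le_add fun ε hε _ => ?_
  have hε' : (0 : ℝ) < ε := hε
  obtain ⟨K, _, hK⟩ := exists_pow_mul_radixProd_rpow_le (C := 36 * c) (by positivity)
    (show q < q + ε by linarith)
  have := dimH_digitSet_le hZ hL (β := q + ε) (by positivity) (K := K) ?_
  · rwa [ENNReal.ofReal_add hq hε'.le, ENNReal.ofReal_coe_nnreal] at this
  refine frequently_atTop.2 fun m => ?_
  -- The `n`-th block is `[T, T * T)` and has class `i`.
  set n := 4 * m + i with hn
  set T := 2 ^ 2 ^ n with hT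
  have hTT : 2 ^ 2 ^ (n + 1) = T * T := by rw [hT, ← pow_add, pow_succ]; ring_nf
  have hT1 : 1 ≤ T := Nat.one_le_two_pow
  have hTle : T ≤ T * T := Nat.le_mul_of_pos_left T hT1
  refine ⟨T * T, ?_, le_trans ?_ (hK _)⟩
  · have h1 : n < 2 ^ n := Nat.lt_two_pow_self
    have h2 : 2 ^ n < T := Nat.lt_two_pow_self
    omega
  have hbound : ∀ j ∈ Finset.range (T * T), ((Z j).card : ℝ) ≤
      c * ((j : ℝ) + 3) ^ q * (if j < T then ((j : ℝ) + 3) ^ (2 : ℕ) else 1) := by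
    intro j hj
    split_ifs with hjT
    · exact hall j
    · rw [mul_one]
      refine hcls j ?_
      rw [blockClass_eq (not_lt.1 hjT) (by rw [hTT]; exact Finset.mem_range.1 hj)]
      omega
  have hsq : ∏ j ∈ Finset.range (T * T), (if j < T then ((j : ℝ) + 3) ^ (2 : ℕ) else 1) =
      radixProd T ^ (2 : ℕ) := by
    rw [← Finset.prod_filter, radixProd, ← Finset.prod_pow]
    congr 1
    ext j
    simp only [Finset.mem_filter, Finset.mem_range]
    omega
  calc ∏ j ∈ Finset.range (T * T), ((Z j).card : ℝ)
      ≤ ∏ j ∈ Finset.range (T * T), (c * ((j : ℝ) + 3) ^ q *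
          (if j < T then ((j : ℝ) + 3) ^ (2 : ℕ) else 1)) :=
        Finset.prod_le_prod (fun j _ => Nat.cast_nonneg _) hbound
    _ = c ^ (T * T) * radixProd (T * T) ^ q * radixProd T ^ (2 : ℕ) := by
        rw [Finset.prod_mul_distrib, prod_const_mul_radix_rpow, hsq]
    _ ≤ c ^ (T * T) * radixProd (T * T) ^ q * 36 ^ (T * T) :=
        mul_le_mul_of_nonneg_left (radixProd_sq_le T)
          (mul_nonneg (by positivity) (Real.rpow_nonneg (radixProd_pos _).le _))
    _ = (36 * c) ^ (T * T) * radixProd (T * T) ^ q := by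
        rw [mul_pow]
        ring

/-- `A k` in blocks of class `0, 1` and `D k` in blocks of class `2, 3`. -/
def alternating (A D : ℕ → ℕ) (k : ℕ) : ℕ := if blockClass k < 2 then A k else D k

/-- Digits `(u + w, u - w)` where `u` and `w` take `A k` and `D k` values, in an order that
alternates between blocks. -/
noncomputable def diagonalDigits (A D : ℕ → ℕ) (k : ℕ) : Finset (ℤ × ℤ) :=
  (Finset.Ico (0 : ℤ) (alternating A D k) ×ˢ Finset.Ico (0 : ℤ) (alternating D A k)).image
    fun x => (x.1 + x.2, x.1 - x.2)

/-- In each class of blocks, the half side digits annihilate the diagonal coordinate of one of the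
four vertices. -/
def diagonalHalfSide (k : ℕ) (z : ℤ × ℤ) : ℤ :=
  if blockClass k = 0 then -((z.1 + z.2) / 2)
  else if blockClass k = 1 then (z.1 + z.2) / 2
  else if blockClass k = 2 then -((z.1 - z.2) / 2)
  else (z.1 - z.2) / 2

theorem alternating_mem {A D : ℕ → ℕ} {P : ℕ → Prop} {k : ℕ} (hA : P (A k)) (hD : P (D k)) :
    P (alternating A D k) := by
  unfold alternating
  split_ifs
  · exact hA
  · exact hD

theorem alternating_mul_alternating (A D : ℕ → ℕ) (k : ℕ) :
    alternating A D k * alternating D A k = A k * D k := by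
  unfold alternating
  split_ifs
  · rfl
  · exact mul_comm _ _

variable {A D : ℕ → ℕ}

theorem exists_of_mem_diagonalDigits {k : ℕ} {z : ℤ × ℤ} (hz : z ∈ diagonalDigits A D k) :
    ∃ u w : ℕ, u < alternating A D k ∧ w < alternating D A k ∧
      z = ((u : ℤ) + w, (u : ℤ) - w) := by
  obtain ⟨⟨u, w⟩, hx, rfl⟩ := Finset.mem_image.1 hz
  simp only [Finset.mem_product, Finset.mem_Ico] at hx
  refine ⟨u.toNat, w.toNat, by omega, by omega, ?_⟩
  simp only [Int.toNat_of_nonneg hx.1.1, Int.toNat_of_nonneg hx.2.1]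

theorem diagonal_bounds (hA : ∀ k, A k ≤ k + 3) (hD : ∀ k, D k ≤ k + 3) {k : ℕ} {z : ℤ × ℤ}
    (hz : z ∈ diagonalDigits A D k) :
    |z.1| ≤ 2 * (k + 3) ∧ |z.2| ≤ 2 * (k + 3) ∧ |diagonalHalfSide k z| ≤ 2 * (k + 3) := by
  obtain ⟨u, w, hu, hw, rfl⟩ := exists_of_mem_diagonalDigits hz
  have h1 : alternating A D k ≤ k + 3 := alternating_mem (P := (· ≤ k + 3)) (hA k) (hD k)
  have h2 : alternating D A k ≤ k + 3 := alternating_mem (P := (· ≤ k + 3)) (hD k) (hA k)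
  simp only [diagonalHalfSide, abs_le]
  refine ⟨by omega, by omega, ?_⟩
  split_ifs <;> omega

theorem boundedDigits_diagonalDigits (hA : ∀ k, A k ≤ k + 3) (hD : ∀ k, D k ≤ k + 3) :
    BoundedDigits 2 (diagonalDigits A D) := fun k z hz => by
  obtain ⟨h1, h2, _⟩ := diagonal_bounds hA hD hz
  exact ⟨by exact_mod_cast h1, by exact_mod_cast h2⟩

theorem abs_diagonalHalfSide_le (hA : ∀ k, A k ≤ k + 3) (hD : ∀ k, D k ≤ k + 3) (k : ℕ)
    (z : ℤ × ℤ) (hz : z ∈ diagonalDigits A D k) : |(diagonalHalfSide k z : ℝ)| ≤ 2 * (k + 3) := by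
  exact_mod_cast (diagonal_bounds hA hD hz).2.2

theorem card_diagonalDigits_le (k : ℕ) : (diagonalDigits A D k).card ≤ A k * D k := by
  refine Finset.card_image_le.trans ?_
  simp [Finset.card_product, alternating_mul_alternating]

theorem card_vertexDigits_diagonal_le {a b : ℤ} {k : ℕ} {f : ℕ → ℤ × ℤ}
    (h : ∀ u w : ℕ, u < alternating A D k → w < alternating D A k → ∃ m < D k,
      ((u : ℤ) + w + a * diagonalHalfSide k (u + w, u - w),
        (u : ℤ) - w + b * diagonalHalfSide k (u + w, u - w)) = f m) :
    (vertexDigits (diagonalDigits A D) diagonalHalfSide a b k).card ≤ D k := by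
  have hsub : vertexDigits (diagonalDigits A D) diagonalHalfSide a b k ⊆
      (Finset.range (D k)).image f := by
    intro x hx
    obtain ⟨z, hz, rfl⟩ := Finset.mem_image.1 hx
    obtain ⟨u, w, hu, hw, rfl⟩ := exists_of_mem_diagonalDigits hz
    obtain ⟨m, hm, hmf⟩ := h u w hu hw
    exact Finset.mem_image.2 ⟨m, Finset.mem_range.2 hm, hmf.symm⟩
  exact (Finset.card_le_card hsub).trans (Finset.card_image_le.trans (by simp))

/-- Each vertex direction has its own class of blocks. There the half side digit cancels the
diagonal coordinate with `A k` values, leaving pairs `(w, -w)` or `(u, u)` with at most `D k`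
values; elsewhere the trivial count is used. -/
theorem dimH_allVertices_diagonal_le (hA : ∀ k, A k ≤ k + 3) (hD : ∀ k, D k ≤ k + 3) {q : ℝ}
    (hq : 0 ≤ q) (hDq : ∀ k : ℕ, (D k : ℝ) ≤ 2 * ((k : ℝ) + 3) ^ q) :
    dimH (allVertices (diagonalDigits A D) diagonalHalfSide 2) ≤ ENNReal.ofReal q := by
  have hb := boundedDigits_diagonalDigits hA hD
  have hall : ∀ a b : ℤ, ∀ k : ℕ,
      ((vertexDigits (diagonalDigits A D) diagonalHalfSide a b k).card : ℝ) ≤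
        2 * ((k : ℝ) + 3) ^ q * ((k : ℝ) + 3) ^ (2 : ℕ) := by
    intro a b k
    have h1 : (vertexDigits (diagonalDigits A D) diagonalHalfSide a b k).card ≤
        (k + 3) * (k + 3) :=
      Finset.card_image_le.trans ((card_diagonalDigits_le k).trans
        (Nat.mul_le_mul (hA k) (hD k)))
    have h2 : ((vertexDigits (diagonalDigits A D) diagonalHalfSide a b k).card : ℝ) ≤
        ((k : ℝ) + 3) * ((k : ℝ) + 3) := by exact_mod_cast h1
    have h3 := one_le_rpow_radix hq k
    have h4 : (0 : ℝ) ≤ ((k : ℝ) + 3) * ((k : ℝ) + 3) := by positivity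
    nlinarith
  have hdim : ∀ a b : ℤ, ∀ i < 4, |(a : ℝ)| = 1 → |(b : ℝ)| = 1 →
      (∀ k, blockClass k = i →
        (vertexDigits (diagonalDigits A D) diagonalHalfSide a b k).card ≤ D k) →
      dimH (digitSet (vertexDigits (diagonalDigits A D) diagonalHalfSide a b)) ≤
        ENNReal.ofReal q := fun a b i hi ha' hb' hcls =>
    dimH_digitSet_le_of_blocks
      (boundedDigits_vertexDigits hb (abs_diagonalHalfSide_le hA hD) ha' hb') (by norm_num) hq
      two_pos hi (hall a b) fun k hk => le_trans (by exact_mod_cast hcls k hk) (hDq k)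
  refine dimH_allVertices_le
    (hdim 1 1 0 (by norm_num) (by simp) (by simp) fun k hk =>
      card_vertexDigits_diagonal_le (f := fun m => (m, -m)) fun u w hu hw => ⟨w, ?_, ?_⟩)
    (hdim (-1) (-1) 1 (by norm_num) (by simp) (by simp) fun k hk =>
      card_vertexDigits_diagonal_le (f := fun m => (m, -m)) fun u w hu hw => ⟨w, ?_, ?_⟩)
    (hdim 1 (-1) 2 (by norm_num) (by simp) (by simp) fun k hk =>
      card_vertexDigits_diagonal_le (f := fun m => (m, m)) fun u w hu hw => ⟨u, ?_, ?_⟩)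
    (hdim (-1) 1 3 (by norm_num) (by simp) (by simp) fun k hk =>
      card_vertexDigits_diagonal_le (f := fun m => (m, m)) fun u w hu hw => ⟨u, ?_, ?_⟩)
  all_goals first
    | simpa [alternating, hk] using hw
    | simpa [alternating, hk] using hu
    | (simp only [diagonalHalfSide, hk, Prod.mk.injEq]
       constructor <;> norm_num <;> omega)

theorem upperBoxDim_diagonal_le (hA : ∀ k, A k ≤ k + 3) (hD : ∀ k, D k ≤ k + 3) {p q : ℝ}
    (hpq : 0 ≤ p + q) (hAp : ∀ k : ℕ, (A k : ℝ) ≤ 2 * ((k : ℝ) + 3) ^ p)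
    (hDq : ∀ k : ℕ, (D k : ℝ) ≤ 2 * ((k : ℝ) + 3) ^ q) :
    upperBoxDim (digitSet (diagonalDigits A D)) ≤ ENNReal.ofReal (p + q) := by
  refine upperBoxDim_digitSet_le (boundedDigits_diagonalDigits hA hD) two_pos hpq
    (exists_prod_card_le (c := 4) (by norm_num) fun k => ?_)
  have h1 : ((diagonalDigits A D k).card : ℝ) ≤ A k * D k := by
    exact_mod_cast card_diagonalDigits_le k
  have h2 := mul_le_mul (hAp k) (hDq k) (Nat.cast_nonneg _) (by positivity)
  rw [Real.rpow_add (by positivity)]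
  linarith

theorem mem_digitSet_diagonal (hA : ∀ k, A k ≤ k + 3) (hD : ∀ k, D k ≤ k + 3) {u w : ℕ → ℕ}
    (hu : ∀ k, u k < alternating A D k) (hw : ∀ k, w k < alternating D A k) :
    !₂[digitSum (fun k => u k) + digitSum (fun k => w k),
      digitSum (fun k => u k) - digitSum (fun k => w k)] ∈ digitSet (diagonalDigits A D) := by
  have hle : ∀ {v B C : ℕ → ℕ}, (∀ k, B k ≤ k + 3) → (∀ k, C k ≤ k + 3) →
      (∀ k, v k < alternating B C k) → ∀ k : ℕ, |(v k : ℝ)| ≤ 1 * (k + 3) := by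
    intro v B C hB hC hv k
    rw [abs_of_nonneg (Nat.cast_nonneg _), one_mul]
    exact_mod_cast (hv k).le.trans (alternating_mem (P := (· ≤ k + 3)) (hB k) (hC k))
  have h1 := digitSum_add (hle hA hD hu) (hle hD hA hw)
  have h2 := digitSum_sub (hle hA hD hu) (hle hD hA hw)
  refine ⟨fun k => ((u k : ℤ) + w k, (u k : ℤ) - w k), fun k => Finset.mem_image.2
    ⟨(u k, w k), ?_, rfl⟩, ?_⟩
  · simp only [Finset.mem_product, Finset.mem_Ico]
    have := hu k
    have := hw k
    omega
  · rw [← h1, ← h2]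
    simp [digitPoint]

/-- Half sum and half difference recover the digit sums of `u` and `w`. Alternating the two roles
does not change the number of pairs per digit, so the centres keep dimension `p + q`. -/
theorem le_dimH_diagonal {p q : ℝ} (hp : p ≤ 1) (hq : q ≤ 1) :
    ENNReal.ofReal (p + q) ≤ dimH (digitSet (diagonalDigits (digitCount p) (digitCount q))) := by
  let f : Plane → ℝ × ℝ := fun x => ((x 0 + x 1) / 2, (x 0 - x 1) / 2)
  have hlip : LipschitzWith 1 f := by
    refine LipschitzWith.of_dist_le_mul fun x y => ?_
    have h0 := abs_le.1 (abs_sub_apply_le_dist x y 0)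
    have h1 := abs_le.1 (abs_sub_apply_le_dist x y 1)
    rw [NNReal.coe_one, one_mul, Prod.dist_eq, Real.dist_eq, Real.dist_eq]
    refine max_le (abs_le.2 ?_) (abs_le.2 ?_) <;> simp only [f] <;> constructor <;>
      linarith [h0.1, h0.2, h1.1, h1.2]
  have hsub : digitRect (alternating (digitCount p) (digitCount q))
      (alternating (digitCount q) (digitCount p)) ⊆
      f '' digitSet (diagonalDigits (digitCount p) (digitCount q)) := by
    rintro _ ⟨u, w, hu, hw, rfl⟩
    refine ⟨_, mem_digitSet_diagonal (digitCount_le_radix p) (digitCount_le_radix q) hu hw, ?_⟩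
    simp [f]
  refine le_trans ?_ ((dimH_mono hsub).trans (hlip.dimH_image_le _))
  refine le_dimH_digitRect
    (fun k => alternating_mem (P := (1 ≤ ·)) (one_le_digitCount p k) (one_le_digitCount q k))
    (fun k => alternating_mem (P := (1 ≤ ·)) (one_le_digitCount q k) (one_le_digitCount p k))
    (fun k => alternating_mem (P := (· - 1 ≤ (k + 3) / 2)) (digitCount_sub_one_le p k)
      (digitCount_sub_one_le q k))
    (fun k => alternating_mem (P := (· - 1 ≤ (k + 3) / 2)) (digitCount_sub_one_le q k)
      (digitCount_sub_one_le p k))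
    (exists_radixProd_rpow_le_prod (c := 4) (by norm_num) fun k => ?_)
  rw [alternating_mul_alternating, Real.rpow_add (by positivity)]
  have := mul_le_mul (le_digitCount hp k) (le_digitCount hq k) (by positivity) (by positivity)
  push_cast
  linarith

theorem ContainsSquareVertices.translate {S B : Set Plane} (h : ContainsSquareVertices B S)
    (v : Plane) :
    ContainsSquareVertices ((IsometryEquiv.addRight v) '' B) {p | p - v ∈ S} := by
  intro p hp
  obtain ⟨r, hr, hsub⟩ := h _ hp
  refine ⟨r, hr, ?_⟩
  rintro x hx
  refine ⟨x - v, hsub ?_, by simp⟩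
  rcases hx with rfl | rfl | rfl | rfl
  · refine Or.inl ?_
    ext i
    fin_cases i <;> simp <;> ring
  · refine Or.inr (Or.inl ?_)
    ext i
    fin_cases i <;> simp <;> ring
  · refine Or.inr (Or.inr (Or.inl ?_))
    ext i
    fin_cases i <;> simp <;> ring
  · refine Or.inr (Or.inr (Or.inr ?_))
    ext i
    fin_cases i <;> simp <;> ring

/-- On the unit square the half difference of the coordinates lies in `[-1/2, 1/2]`; the translation
raises it by `1/2` and fixes the half sum, so both lie in `[0,1]` and have greedy expansions. -/
theorem unitSquare_subset_diagonal {p : Plane} (hp : p ∈ unitSquare) :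
    p - !₂[-1 / 2, 1 / 2] ∈ digitSet (diagonalDigits (fun k => k + 3) fun k => k + 3) := by
  obtain ⟨⟨h0, h0'⟩, h1, h1'⟩ := hp
  have hN : ∀ k : ℕ, 1 ≤ k + 3 := fun k => by omega
  have hu : (p 0 + p 1) / 2 ∈ Icc (0 : ℝ) 1 := ⟨by linarith, by linarith⟩
  have hw : (p 0 - p 1 + 1) / 2 ∈ Icc (0 : ℝ) 1 := ⟨by linarith, by linarith⟩
  have hmem := mem_digitSet_diagonal (A := fun k => k + 3) (D := fun k => k + 3)
    (fun k => le_rfl) (fun k => le_rfl)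
    (u := greedyDigit (fun k => k + 3) ((p 0 + p 1) / 2))
    (w := greedyDigit (fun k => k + 3) ((p 0 - p 1 + 1) / 2))
    (fun k => by simpa [alternating] using greedyDigit_lt hN _ k)
    (fun k => by simpa [alternating] using greedyDigit_lt hN _ k)
  rw [digitSum_greedyDigit hu, digitSum_greedyDigit hw] at hmem
  convert hmem using 1
  ext i
  fin_cases i <;> simp <;> ring

theorem exists_hausdorff_sharp {s : ℝ} (h0 : 0 ≤ s) (h2 : s ≤ 2) :
    ∃ S B : Set Plane, S.Nonempty ∧ IsCompact S ∧ IsCompact B ∧ ContainsSquareVertices B S ∧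
      dimH S = ENNReal.ofReal s ∧ dimH B ≤ ENNReal.ofReal (max (s - 1) 0) ∧
      (s = 2 → S = unitSquare) := by
  rcases h2.lt_or_eq with hlt | rfl
  · set p : ℝ := min s 1 with hp
    set q : ℝ := max (s - 1) 0 with hq
    have hpq : p + q = s := by
      rw [hp, hq]
      rcases le_total s 1 with h | h
      · rw [min_eq_left h, max_eq_right (by linarith), add_zero]
      · rw [min_eq_right h, max_eq_left (by linarith)]
        ring
    have hp0 : 0 ≤ p := le_min h0 zero_le_one
    have hq0 : 0 ≤ q := le_max_right _ _
    have hp1 : p ≤ 1 := min_le_right _ _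
    have hq1 : q ≤ 1 := max_le (by linarith) zero_le_one
    have hA := digitCount_le_radix p
    have hD := digitCount_le_radix q
    have hb := boundedDigits_diagonalDigits hA hD
    refine ⟨digitSet (diagonalDigits (digitCount p) (digitCount q)), _, ?_, isCompact_digitSet hb,
      isCompact_allVertices hb (abs_diagonalHalfSide_le hA hD),
      containsSquareVertices_allVertices two_pos hb (abs_diagonalHalfSide_le hA hD),
      le_antisymm ?_ ?_, dimH_allVertices_diagonal_le hA hD hq0 (digitCount_le hq0),
      fun h => absurd h hlt.ne⟩
    · exact ⟨_, mem_digitSet_diagonal hA hD (u := fun _ => 0) (w := fun _ => 0)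
        (fun k => alternating_mem (P := (0 < ·)) (one_le_digitCount p k) (one_le_digitCount q k))
        (fun k => alternating_mem (P := (0 < ·)) (one_le_digitCount q k)
          (one_le_digitCount p k))⟩
    · rw [← hpq]
      exact (dimH_le_lowerBoxDim _).trans ((lowerBoxDim_le_upperBoxDim _).trans
        (upperBoxDim_diagonal_le hA hD (by linarith) (digitCount_le hp0) (digitCount_le hq0)))
    · rw [← hpq]
      exact le_dimH_diagonal hp1 hq1
  · have hN : ∀ k : ℕ, k + 3 ≤ k + 3 := fun k => le_rfl
    have hb := boundedDigits_diagonalDigits hN hN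
    have hsq := containsSquareVertices_allVertices two_pos hb (abs_diagonalHalfSide_le hN hN)
    refine ⟨unitSquare, _, unitSquare_nonempty, isCompact_unitSquare,
      (isCompact_allVertices hb (abs_diagonalHalfSide_le hN hN)).image
        (IsometryEquiv.continuous _),
      fun p hp => hsq.translate !₂[-1 / 2, 1 / 2] p (unitSquare_subset_diagonal hp),
      by rw [dimH_unitSquare]; simp, ?_, fun _ => rfl⟩
    rw [IsometryEquiv.dimH_image, show max ((2 : ℝ) - 1) 0 = 1 by norm_num]
    refine dimH_allVertices_diagonal_le hN hN zero_le_one fun k => ?_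
    rw [Real.rpow_one]
    push_cast
    linarith [Nat.cast_nonneg (α := ℝ) k]

end HausdorffSharpness

/-! ### Assembly of the lower bounds and the sharp examples. -/

theorem max_dimH_sub_one_le {S B : Set Plane} (h : ContainsSomeSquareVertex B S) :
    max (dimH S - 1) 0 ≤ dimH B :=
  max_le (tsub_le_iff_right.2 (dimH_centres_le h)) bot_le

/-- Subtraction in `ℝ≥0∞` is truncated at `0`, so `max (dimH S - 1) 0` is the usual
`max (dim_H S - 1, 0)`. -/
theorem theorem1p4 :
    -- Hausdorff lower bound; one vertex of each square is enough
    (∀ S B : Set Plane, ContainsSomeSquareVertex B S → max (dimH S - 1) 0 ≤ dimH B) ∧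
    (∀ S B : Set Plane, ContainsSquareVertices B S → max (dimH S - 1) 0 ≤ dimH B) ∧
    (∀ B : Set Plane, ContainsSquareVertices B unitSquare → 1 ≤ dimH B) ∧
    -- packing lower bound, for arbitrary sets
    (∀ S B : Set Plane, ContainsSquareVertices B S → 3 / 4 * packingDim S ≤ packingDim B) ∧
    (∀ B : Set Plane, ContainsSquareVertices B unitSquare → 3 / 2 ≤ packingDim B) ∧
    -- box lower bounds; the sets are bounded (`S` is bounded because `B` is)
    (∀ S B : Set Plane, Bornology.IsBounded B → ContainsSquareVertices B S →
      3 / 4 * upperBoxDim S ≤ upperBoxDim B ∧ 3 / 4 * lowerBoxDim S ≤ lowerBoxDim B) ∧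
    (∀ B : Set Plane, Bornology.IsBounded B → ContainsSquareVertices B unitSquare →
      3 / 2 ≤ upperBoxDim B ∧ 3 / 2 ≤ lowerBoxDim B) ∧
    -- sharpness for the Hausdorff dimension
    (∀ s : ℝ, 0 ≤ s → s ≤ 2 → ∃ S B : Set Plane,
      S.Nonempty ∧ IsCompact S ∧ IsCompact B ∧ ContainsSquareVertices B S ∧
      dimH S = ENNReal.ofReal s ∧ dimH B = ENNReal.ofReal (max (s - 1) 0) ∧
      (s = 2 → S = unitSquare)) ∧
    -- sharpness for the packing and box dimensions
    (∀ s : ℝ, 0 ≤ s → s ≤ 2 → ∃ S B : Set Plane,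
      S.Nonempty ∧ IsCompact S ∧ IsCompact B ∧ ContainsSquareVertices B S ∧
      packingDim S = ENNReal.ofReal s ∧
      lowerBoxDim S = ENNReal.ofReal s ∧ upperBoxDim S = ENNReal.ofReal s ∧
      packingDim B = ENNReal.ofReal (3 / 4 * s) ∧
      lowerBoxDim B = ENNReal.ofReal (3 / 4 * s) ∧
      upperBoxDim B = ENNReal.ofReal (3 / 4 * s) ∧
      (s = 2 → S = unitSquare)) := by
  refine ⟨fun S B h => ?_, fun S B h => ?_, fun B h => ?_, fun S B h =>
    three_quarters_mul_packingDim_le h, fun B h => ?_, fun S B _ h =>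
    ⟨three_quarters_mul_upperBoxDim_le h, three_quarters_mul_lowerBoxDim_le h⟩, fun B _ h =>
    ⟨?_, ?_⟩, fun s h0 h2 => ?_, fun s h0 h2 => ?_⟩
  · exact max_dimH_sub_one_le h
  · exact max_dimH_sub_one_le h.containsSome
  · have := max_dimH_sub_one_le h.containsSome
    rw [dimH_unitSquare] at this
    refine le_trans ?_ ((le_max_left _ _).trans this)
    rw [show (2 : ℝ≥0∞) = 1 + 1 by norm_num, ENNReal.add_sub_cancel_right ENNReal.one_ne_top]
  · exact three_halves_le_of_two_le (dimH_unitSquare.ge.trans (dimH_le_packingDim _))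
      (three_quarters_mul_packingDim_le h)
  · exact three_halves_le_of_two_le (dimH_unitSquare.ge.trans
      ((dimH_le_lowerBoxDim _).trans (lowerBoxDim_le_upperBoxDim _)))
      (three_quarters_mul_upperBoxDim_le h)
  · exact three_halves_le_of_two_le (dimH_unitSquare.ge.trans (dimH_le_lowerBoxDim _))
      (three_quarters_mul_lowerBoxDim_le h)
  · obtain ⟨S, B, hne, hS, hB, hSB, hdS, hdB, hsq⟩ := exists_hausdorff_sharp h0 h2
    refine ⟨S, B, hne, hS, hB, hSB, hdS, le_antisymm hdB ?_, hsq⟩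
    refine le_trans (le_of_eq ?_) (max_dimH_sub_one_le hSB.containsSome)
    rw [hdS, ENNReal.ofReal_max, ENNReal.ofReal_sub _ zero_le_one, ENNReal.ofReal_one,
      ENNReal.ofReal_zero]
  · obtain ⟨S, B, hne, hS, hB, hSB, hdS, huS, huB, hsq⟩ := exists_box_sharp h0 h2
    -- Hausdorff dimension is the smallest and upper box dimension the largest of the dimensions
    -- involved, so two bounds fix all of them for `S`; for `B` the lower bounds are the
    -- inequalities with factor `3/4`.
    have hpS := hdS.trans (dimH_le_packingDim S)
    have hlS := hdS.trans (dimH_le_lowerBoxDim S)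
    have hscale : ∀ {a : ℝ≥0∞}, ENNReal.ofReal s ≤ a →
        ENNReal.ofReal (3 / 4 * s) ≤ 3 / 4 * a := fun ha => by
      rw [ENNReal.ofReal_mul (by norm_num), ENNReal.ofReal_div_of_pos (by norm_num)]
      refine (mul_le_mul_right ha _).trans_eq ?_
      norm_num
    have hpB := (hscale hpS).trans (three_quarters_mul_packingDim_le hSB)
    have hlB := (hscale hlS).trans (three_quarters_mul_lowerBoxDim_le hSB)
    exact ⟨S, B, hne, hS, hB, hSB,
      le_antisymm ((packingDim_le_upperBoxDim S).trans huS) hpS,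
      le_antisymm ((lowerBoxDim_le_upperBoxDim S).trans huS) hlS,
      le_antisymm huS (hlS.trans (lowerBoxDim_le_upperBoxDim S)),
      le_antisymm ((packingDim_le_upperBoxDim B).trans huB) hpB,
      le_antisymm ((lowerBoxDim_le_upperBoxDim B).trans huB) hlB,
      le_antisymm huB (hlB.trans (lowerBoxDim_le_upperBoxDim B)), hsq⟩
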